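/- **Notation.** Let $\ell$ be an odd prime and $n\ge 1$. For a finite abelian $\ell$-group $G$ put $G^\vee=\mathrm{Hom}(G,\mathbb Q/\mathbb Z)$ and let $\wedge^2G\subset G\otimes G$ be the subgroup generated by the elements $x\wedge y:=x\otimes y-y\otimes x$. An *$\ell^n$-BEG* is a triple $(G,\omega,\psi)$ with $G$ a finite abelian $\ell$-group, $\omega\in(\wedge^2G)[\ell^n]$ and $\psi:G^\vee[\ell^n]\to G[\ell^n]$ a homomorphism such that $$\beta(\psi(\ell^r\alpha))=\alpha(\psi(\ell^r\beta))+2\,\omega_{n+r}(\alpha,\beta)\qquad\text{for all } r\ge0,\ \alpha,\beta\in G^\vee[\ell^{n+r}],$$ where $\omega_m(\alpha,\beta)\in\frac1{\ell^m}\mathbb Z/\mathbb Z\cong\mathbb Z/\ell^m$ is the value at $\omega$ of $\alpha\otimes\beta:G\otimes G\to\mathbb Z/\ell^m\otimes\mathbb Z/\ell^m=\mathbb Z/\ell^m$. A homomorphism $f:G\to H$ pushes $(\omega,\psi)$ forward to $((f\otimes f)(\omega),\,f\circ\psi\circ f^\vee)$; an isomorphism of BEGs is a group isomorphism carrying one pair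 $(\omega,\psi)$ to the other, and $(G,\omega,\psi)/N$ denotes $G/N$ with the pushed-forward pair. Let $\mathcal C_{\ell,n}$ be the (countable) set of isomorphism classes of $\ell^n$-BEGs; measures on it are given by their point masses. Let $M$ be random for the Haar probability measure on the skew-symplectic endomorphisms of $\mathbb Z_\ell^{2g}$, which carries the standard symplectic form with symplectic basis $e_i,f_i$. Put $G_M=\mathrm{coker}(M+\ell^n)$, let $\omega_M$ be the image of $\sum_i e_i\wedge f_i$, and let $\psi_M:G_M^\vee[\ell^n]\to G_M[\ell^n]$ send $\alpha$ to the class of $(M+\ell^n)\alpha'$, where $\alpha$ is regarded as an element of $(\mathbb Q_\ell/\mathbb Z_\ell)^{2g}$ through $s\mapsto\langle\,\bullet\,,s\rangle$ and $\alpha'\in\mathbb Q_\ell^{2g}$ is any lift of it. Let $\mu_g$ be the distribution of $(G_M,\omega_M,\psi_M)$ on $\mathcal C_{\ell,n}$ and let $\mu=\lim_{g\to\infty}\mu_g$ (limit of the mass of each point). For a measure $\nu$ on $\mathcal C_{\ell,n}$ define $$Q\nu(G,\omega_G,\psi_G)=\int_{\mathcal C_{\ell,n}}\frac{\#\{f:\mathbb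 Z_\ell\to H\mid (H,\omega_H,\psi_H)/\mathrm{Im}f\cong(G,\omega_G,\psi_G)\}}{|H|}\,d\nu(H,\omega_H,\psi_H),$$ and let $Q^t\mu$ be the result of applying $Q$ to $\mu$ $t$ times. Write $Q^t\mu(G)$ for the sum of $Q^t\mu(c)$ over all classes $c\in\mathcal C_{\ell,n}$ whose underlying group is isomorphic to $G$. Finally $(x)_j=\prod_{i=1}^j(1-x^i)$. **Lemma (agreement with Malle's conjecture).** Let $\ell$ be an odd prime and $n=1$. The limit defining $\mu$ exists at every point of $\mathcal C_{\ell,1}$, and for every integer $t\ge0$ and every finite abelian $\ell$-group $G$ of $\ell$-rank $r$, $Q^t\mu(G)$ equals the probability conjectured by Malle: $$Q^t\mu(G)=\frac{\prod_{i=t+1}^\infty(1+\ell^{-i})^{-1}}{|\mathrm{Aut}\,G|\,|G|^t}\cdot\frac{\ell^{\binom r2}(\ell^{-1})_{r+t}}{(\ell^{-1})_t}.$$ -/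

import Mathlib

open scoped TensorProduct ENNReal

/-! ### Bilinearly enhanced groups -/

/-- The Pontryagin dual `Hom(G, ℚ/ℤ)` of an abelian group. -/
abbrev PDual (G : Type*) [AddCommGroup G] := G →+ AddCircle (1 : ℚ)

/-- The subgroup `A[N]` of elements killed by `N`. -/
abbrev Tors (N : ℕ) (A : Type*) [AddCommGroup A] : AddSubgroup A :=
  AddSubgroup.torsionBy A (N : ℤ)

theorem mem_tors {N : ℕ} {A : Type*} [AddCommGroup A] {x : A} :
    x ∈ Tors N A ↔ N • x = 0 :=
  AddSubgroup.torsionBy.nsmul_iff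

/-- `∧²G`, the subgroup of `G ⊗ G` spanned by all `x ⊗ y - y ⊗ x`. -/
def wedgeTwo (G : Type*) [AddCommGroup G] : AddSubgroup (G ⊗[ℤ] G) :=
  AddSubgroup.closure {z | ∃ x y : G, z = x ⊗ₜ[ℤ] y - y ⊗ₜ[ℤ] x}

/-- The identification of `ℤ/N` with `(1/N)ℤ/ℤ` inside `ℚ/ℤ`, `1 ↦ 1/N`. -/
noncomputable def zmodToCircle (N : ℕ) : ZMod N →+ AddCircle (1 : ℚ) :=
  ZMod.lift N ⟨zmultiplesHom (AddCircle (1 : ℚ)) (((1 / N : ℚ)) : AddCircle (1 : ℚ)), by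
    rw [zmultiplesHom_apply, ← AddCircle.coe_zsmul, AddCircle.coe_eq_zero_iff]
    by_cases hN : N = 0
    · exact ⟨0, by simp [hN]⟩
    · refine ⟨1, ?_⟩
      have : (N : ℚ) ≠ 0 := Nat.cast_ne_zero.mpr hN
      simp [this]⟩

/-- For `a, b : G → ℤ/N`, the map `a ⊗ b : G ⊗ G → ℤ/N ⊗ ℤ/N = ℤ/N`. -/
noncomputable def tensorEval {G : Type*} [AddCommGroup G] {N : ℕ} (a b : G →+ ZMod N) :
    G ⊗[ℤ] G →ₗ[ℤ] ZMod N :=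
  LinearMap.mul' ℤ (ZMod N) ∘ₗ TensorProduct.map a.toIntLinearMap b.toIntLinearMap

/-- The map `f ⊗ f : G ⊗ G → H ⊗ H`. -/
noncomputable def tensorSq {G H : Type*} [AddCommGroup G] [AddCommGroup H] (f : G →+ H) :
    G ⊗[ℤ] G →ₗ[ℤ] H ⊗[ℤ] H :=
  TensorProduct.map f.toIntLinearMap f.toIntLinearMap

/-- A pair `(ω, ψ)` with `ω ∈ G ⊗ G` and `ψ : G^∨[ℓ^n] → G[ℓ^n]`. -/
@[ext] structure EnhData (ℓ n : ℕ) (G : Type*) [AddCommGroup G] where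
  omega : G ⊗[ℤ] G
  psi : Tors (ℓ ^ n) (PDual G) →+ Tors (ℓ ^ n) G

/-- The element `ℓ^r α` of `G^∨[ℓ^n]`, where `α ∈ G^∨[ℓ^(n+r)]` corresponds to
`a : G → ℤ/ℓ^(n+r)`. -/
noncomputable def scaledChar {ℓ n r : ℕ} {G : Type*} [AddCommGroup G]
    (a : G →+ ZMod (ℓ ^ (n + r))) : Tors (ℓ ^ n) (PDual G) :=
  ⟨ℓ ^ r • (zmodToCircle (ℓ ^ (n + r))).comp a, by
    rw [mem_tors]
    ext x
    have h : (ℓ ^ (n + r)) • a x = 0 := by simp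
    simp only [AddMonoidHom.nsmul_apply, AddMonoidHom.comp_apply, AddMonoidHom.zero_apply]
    rw [← mul_nsmul', ← pow_add, ← map_nsmul, h, map_zero]⟩

/-- The conditions making `(G, ω, ψ)` an `ℓ^n`-BEG: `ω` lies in `(∧²G)[ℓ^n]`, and
`⟨ℓ^r α, β⟩ = ⟨ℓ^r β, α⟩ + 2 ω_{n+r}(α, β)` for all `r ≥ 0` and `α, β ∈ G^∨[ℓ^(n+r)]`, where
`⟨γ, δ⟩ = δ(ψ(γ))`.  Here `G^∨[ℓ^(n+r)]` is identified with `Hom(G, ℤ/ℓ^(n+r))`, and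
`ω_{n+r}(α, β)` is the value of `α ⊗ β` at `ω`. -/
structure EnhData.IsBEG {ℓ n : ℕ} {G : Type*} [AddCommGroup G] (d : EnhData ℓ n G) : Prop where
  omega_mem : d.omega ∈ wedgeTwo G
  omega_torsion : ℓ ^ n • d.omega = 0
  compat : ∀ (r : ℕ) (a b : G →+ ZMod (ℓ ^ (n + r))),
    zmodToCircle (ℓ ^ (n + r)) (b (d.psi (scaledChar a))) =
      zmodToCircle (ℓ ^ (n + r)) (a (d.psi (scaledChar b))) +
        2 • zmodToCircle (ℓ ^ (n + r)) (tensorEval a b d.omega)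

/-- The map `H^∨[N] → G^∨[N]` induced by `f : G → H`. -/
def torsDual (N : ℕ) {G H : Type*} [AddCommGroup G] [AddCommGroup H] (f : G →+ H) :
    Tors N (PDual H) →+ Tors N (PDual G) where
  toFun γ := ⟨γ.1.comp f, by
    have h := mem_tors.1 γ.2
    rw [mem_tors]
    ext x
    exact DFunLike.congr_fun h (f x)⟩
  map_zero' := rfl
  map_add' _ _ := rfl

/-- The map `G[N] → H[N]` induced by `f : G → H`. -/
def torsMap (N : ℕ) {G H : Type*} [AddCommGroup G] [AddCommGroup H] (f : G →+ H) :
    Tors N G →+ Tors N H where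
  toFun x := ⟨f x.1, by
    have h := mem_tors.1 x.2
    rw [mem_tors, ← map_nsmul, h, map_zero]⟩
  map_zero' := by ext; simp
  map_add' _ _ := by ext; simp

/-- The pushforward `(f_* ω, f_* ψ)`, where `f_* ψ = f ∘ ψ ∘ f^∨`. -/
noncomputable def EnhData.push {ℓ n : ℕ} {G H : Type*} [AddCommGroup G] [AddCommGroup H]
    (f : G →+ H) (d : EnhData ℓ n G) : EnhData ℓ n H where
  omega := tensorSq f d.omega
  psi := ((torsMap (ℓ ^ n) f).comp d.psi).comp (torsDual (ℓ ^ n) f)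

theorem EnhData.push_id {ℓ n : ℕ} {G : Type*} [AddCommGroup G] (d : EnhData ℓ n G) :
    d.push (AddMonoidHom.id G) = d := by
  apply EnhData.ext
  · have : (AddMonoidHom.id G).toIntLinearMap = LinearMap.id := rfl
    simp only [EnhData.push, tensorSq, this, TensorProduct.map_id]
    rfl
  · rfl

theorem EnhData.push_push {ℓ n : ℕ} {G H K : Type*} [AddCommGroup G] [AddCommGroup H]
    [AddCommGroup K] (f : G →+ H) (g : H →+ K) (d : EnhData ℓ n G) :
    (d.push f).push g = d.push (g.comp f) := by
  apply EnhData.ext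
  · have : (g.comp f).toIntLinearMap = g.toIntLinearMap ∘ₗ f.toIntLinearMap := rfl
    simp only [EnhData.push, tensorSq, this, TensorProduct.map_comp]
    rfl
  · rfl

theorem EnhData.IsBEG.push {ℓ n : ℕ} {G H : Type*} [AddCommGroup G] [AddCommGroup H]
    {d : EnhData ℓ n G} (hd : d.IsBEG) (f : G →+ H) : (d.push f).IsBEG where
  omega_mem := by
    have h : wedgeTwo G ≤ (wedgeTwo H).comap (tensorSq f).toAddMonoidHom := by
      rw [wedgeTwo, AddSubgroup.closure_le]
      rintro _ ⟨x, y, rfl⟩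
      refine AddSubgroup.subset_closure ⟨f x, f y, ?_⟩
      rw [map_sub]
      rfl
    exact h hd.omega_mem
  omega_torsion := by
    change ℓ ^ n • tensorSq f d.omega = 0
    rw [← map_nsmul, hd.omega_torsion, map_zero]
  compat r a b := by
    have key : tensorEval a b (tensorSq f d.omega) =
        tensorEval (a.comp f) (b.comp f) d.omega := by
      have ha : (a.comp f).toIntLinearMap = a.toIntLinearMap ∘ₗ f.toIntLinearMap := rfl
      have hb : (b.comp f).toIntLinearMap = b.toIntLinearMap ∘ₗ f.toIntLinearMap := rfl
      simp only [tensorEval, tensorSq, ha, hb, TensorProduct.map_comp]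
      rfl
    have h := hd.compat r (a.comp f) (b.comp f)
    rw [← key] at h
    exact h

/-- An `ℓ^n`-BEG: a finite abelian `ℓ`-group `G` with a compatible pair `(ω, ψ)`. -/
structure BEG (ℓ n : ℕ) where
  carrier : Type
  [group : AddCommGroup carrier]
  [finite : Finite carrier]
  ellGroup : ∀ x : carrier, ∃ k : ℕ, ℓ ^ k • x = 0
  data : EnhData ℓ n carrier
  isBEG : data.IsBEG

attribute [instance] BEG.group BEG.finite

/-- Isomorphism in the category of `ℓ^n`-BEGs. -/
def BEG.Iso {ℓ n : ℕ} (X Y : BEG ℓ n) : Prop :=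
  ∃ e : X.carrier ≃+ Y.carrier, X.data.push e.toAddMonoidHom = Y.data

instance BEG.setoid (ℓ n : ℕ) : Setoid (BEG ℓ n) where
  r := BEG.Iso
  iseqv :=
    { refl := fun X => ⟨AddEquiv.refl _, X.data.push_id⟩
      symm := by
        rintro X Y ⟨e, he⟩
        refine ⟨e.symm, ?_⟩
        rw [← he, EnhData.push_push]
        have : e.symm.toAddMonoidHom.comp e.toAddMonoidHom = AddMonoidHom.id _ := by
          ext x; simp
        rw [this, EnhData.push_id]
      trans := by
        rintro X Y Z ⟨e, he⟩ ⟨f, hf⟩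
        refine ⟨e.trans f, ?_⟩
        rw [← hf, ← he, EnhData.push_push]
        rfl }

/-- The set of isomorphism classes of `ℓ^n`-BEGs. -/
abbrev BEGClass (ℓ n : ℕ) := Quotient (BEG.setoid ℓ n)

/-- The quotient `(H, ω, ψ)/N`: the group `H/N` with the pushforward data. -/
noncomputable def BEG.quot {ℓ n : ℕ} (X : BEG ℓ n) (N : AddSubgroup X.carrier) : BEG ℓ n where
  carrier := X.carrier ⧸ N
  ellGroup := by
    intro x
    obtain ⟨y, rfl⟩ := QuotientAddGroup.mk_surjective x
    obtain ⟨k, hk⟩ := X.ellGroup y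
    exact ⟨k, by rw [← QuotientAddGroup.mk_nsmul, hk, QuotientAddGroup.mk_zero]⟩
  data := X.data.push (QuotientAddGroup.mk' N)
  isBEG := X.isBEG.push _

/-! ### The linear random matrix model -/

/-- The standard symplectic form on `ℤ_ℓ^{2g}`, for which `⟨e_i, f_i⟩ = 1`. -/
noncomputable def sympForm {ℓ : ℕ} [Fact ℓ.Prime] {g : ℕ} (v w : Fin g ⊕ Fin g → ℤ_[ℓ]) : ℤ_[ℓ] :=
  ∑ i, (v (Sum.inl i) * w (Sum.inr i) - v (Sum.inr i) * w (Sum.inl i))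

/-- The additive group of skew-symplectic `2g × 2g` matrices over `ℤ_ℓ`. -/
noncomputable abbrev SkewSymp (ℓ : ℕ) [Fact ℓ.Prime] (g : ℕ) :
    AddSubgroup (Matrix (Fin g ⊕ Fin g) (Fin g ⊕ Fin g) ℤ_[ℓ]) :=
  (skewAdjointMatricesSubmodule (Matrix.J (Fin g) ℤ_[ℓ])).toAddSubgroup

section LinearModel

variable {ℓ : ℕ} [Fact ℓ.Prime] {g : ℕ}

theorem sympForm_eq (v w : Fin g ⊕ Fin g → ℤ_[ℓ]) :
    sympForm v w = -(v ⬝ᵥ (Matrix.J (Fin g) ℤ_[ℓ]).mulVec w) := by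
  simp [sympForm, Matrix.J, Matrix.fromBlocks_mulVec, dotProduct, Fintype.sum_sum_type,
    Finset.sum_sub_distrib, Matrix.neg_mulVec]
  ring

/-- Membership in `SkewSymp` is skewness for the standard symplectic form. -/
theorem SkewSymp.skew (M : SkewSymp ℓ g) (v w : Fin g ⊕ Fin g → ℤ_[ℓ]) :
    sympForm (M.1.mulVec v) w = -sympForm v (M.1.mulVec w) := by
  have h : M.1.transpose * Matrix.J (Fin g) ℤ_[ℓ] = Matrix.J (Fin g) ℤ_[ℓ] * (-M.1) :=
    (mem_skewAdjointMatricesSubmodule _ _).1 M.2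
  rw [sympForm_eq, sympForm_eq, neg_inj, ← neg_eq_iff_eq_neg, Matrix.mulVec_mulVec]
  rw [mul_neg] at h
  rw [← neg_eq_iff_eq_neg] at h
  rw [← h, Matrix.neg_mulVec, dotProduct_neg, neg_inj, ← Matrix.mulVec_mulVec,
    Matrix.dotProduct_mulVec v, Matrix.vecMul_transpose]

/-- The endomorphism `M + ℓ^n` of `ℤ_ℓ^{2g}`. -/
noncomputable def shiftMap (n : ℕ) (M : SkewSymp ℓ g) :
    (Fin g ⊕ Fin g → ℤ_[ℓ]) →ₗ[ℤ_[ℓ]] (Fin g ⊕ Fin g → ℤ_[ℓ]) :=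
  M.1.mulVecLin + (ℓ : ℤ_[ℓ]) ^ n • LinearMap.id

/-- `G_M`, the cokernel of `M + ℓ^n`. -/
abbrev LinCoker (n : ℕ) (M : SkewSymp ℓ g) :=
  (Fin g ⊕ Fin g → ℤ_[ℓ]) ⧸ LinearMap.range (shiftMap n M)

/-- The projection `ℤ_ℓ^{2g} → G_M`. -/
noncomputable def toCoker (n : ℕ) (M : SkewSymp ℓ g) (v : Fin g ⊕ Fin g → ℤ_[ℓ]) : LinCoker n M :=
  (LinearMap.range (shiftMap n M)).mkQ v

/-- `ω_M`, the image of `∑ e_i ∧ f_i` in `∧² G_M`. -/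
noncomputable def linOmega (n : ℕ) (M : SkewSymp ℓ g) : LinCoker n M ⊗[ℤ] LinCoker n M :=
  ∑ i : Fin g,
    (toCoker n M (Pi.single (Sum.inl i) 1) ⊗ₜ[ℤ] toCoker n M (Pi.single (Sum.inr i) 1) -
      toCoker n M (Pi.single (Sum.inr i) 1) ⊗ₜ[ℤ] toCoker n M (Pi.single (Sum.inl i) 1))

/-- For `α ∈ G_M^∨`, this says that `α` corresponds to `u / ℓ^n ∈ (ℚ_ℓ/ℤ_ℓ)^{2g}` under the
identification of `Hom(ℤ_ℓ^{2g}, ℚ_ℓ/ℤ_ℓ)` with `(ℚ_ℓ/ℤ_ℓ)^{2g}` by `s ↦ ⟨•, s⟩`, and that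
`(M + ℓ^n)(u / ℓ^n) = w` lies in `ℤ_ℓ^{2g}`. -/
def IsSnakeLift (n : ℕ) (M : SkewSymp ℓ g) (α : PDual (LinCoker n M))
    (u w : Fin g ⊕ Fin g → ℤ_[ℓ]) : Prop :=
  (∀ v, α (toCoker n M v) = zmodToCircle (ℓ ^ n) (PadicInt.toZModPow n (sympForm v u))) ∧
    shiftMap n M u = (ℓ : ℤ_[ℓ]) ^ n • w

theorem zmodToCircle_intCast (N : ℕ) (k : ℤ) :
    zmodToCircle N (k : ZMod N) = ((k * (1 / N) : ℚ) : AddCircle (1 : ℚ)) := by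
  rw [zmodToCircle, ZMod.lift_coe]
  simp only [zmultiplesHom_apply]
  rw [← AddCircle.coe_zsmul, zsmul_eq_mul]

theorem zmodToCircle_injective {N : ℕ} (hN : N ≠ 0) :
    Function.Injective (zmodToCircle N) := by
  rw [injective_iff_map_eq_zero]
  intro a ha
  obtain ⟨k, rfl⟩ := ZMod.intCast_surjective a
  rw [zmodToCircle_intCast, AddCircle.coe_eq_zero_iff] at ha
  obtain ⟨m, hm⟩ := ha
  have hN' : (N : ℚ) ≠ 0 := Nat.cast_ne_zero.mpr hN
  have h2 : ((m * N : ℤ) : ℚ) = k := by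
    push_cast
    field_simp at hm
    simpa [mul_comm] using hm
  have h3 : m * N = k := by exact_mod_cast h2
  rw [ZMod.intCast_zmod_eq_zero_iff_dvd]
  exact ⟨m, by rw [← h3, mul_comm]⟩

theorem exists_zmodToCircle_eq {N : ℕ} (hN : N ≠ 0) (x : AddCircle (1 : ℚ)) (hx : N • x = 0) :
    ∃ c : ZMod N, zmodToCircle N c = x := by
  obtain ⟨q, rfl⟩ := QuotientAddGroup.mk_surjective x
  have hx' : ((N • q : ℚ) : AddCircle (1 : ℚ)) = 0 := hx
  rw [AddCircle.coe_eq_zero_iff] at hx'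
  obtain ⟨m, hm⟩ := hx'
  have hN' : (N : ℚ) ≠ 0 := Nat.cast_ne_zero.mpr hN
  refine ⟨(m : ZMod N), ?_⟩
  rw [zmodToCircle_intCast]
  have : (m * (1 / N) : ℚ) = q := by
    field_simp
    simpa using hm
  rw [this]

theorem sympForm_add_right (v u u' : Fin g ⊕ Fin g → ℤ_[ℓ]) :
    sympForm v (u + u') = sympForm v u + sympForm v u' := by
  simp only [sympForm, Pi.add_apply, ← Finset.sum_add_distrib]
  exact Finset.sum_congr rfl fun i _ => by ring

theorem sympForm_add_left (v v' u : Fin g ⊕ Fin g → ℤ_[ℓ]) :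
    sympForm (v + v') u = sympForm v u + sympForm v' u := by
  simp only [sympForm, Pi.add_apply, ← Finset.sum_add_distrib]
  exact Finset.sum_congr rfl fun i _ => by ring

theorem sympForm_smul_right (c : ℤ_[ℓ]) (v u : Fin g ⊕ Fin g → ℤ_[ℓ]) :
    sympForm v (c • u) = c * sympForm v u := by
  simp only [sympForm, Pi.smul_apply, smul_eq_mul, Finset.mul_sum]
  exact Finset.sum_congr rfl fun i _ => by ring

theorem sympForm_smul_left (c : ℤ_[ℓ]) (v u : Fin g ⊕ Fin g → ℤ_[ℓ]) :
    sympForm (c • v) u = c * sympForm v u := by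
  simp only [sympForm, Pi.smul_apply, smul_eq_mul, Finset.mul_sum]
  exact Finset.sum_congr rfl fun i _ => by ring

theorem sympForm_inl (i : Fin g) (u : Fin g ⊕ Fin g → ℤ_[ℓ]) :
    sympForm (Pi.single (Sum.inl i) 1) u = u (Sum.inr i) := by
  simp [sympForm, Pi.single_apply]

theorem sympForm_inr (i : Fin g) (u : Fin g ⊕ Fin g → ℤ_[ℓ]) :
    sympForm (Pi.single (Sum.inr i) 1) u = -u (Sum.inl i) := by
  simp [sympForm, Pi.single_apply]

theorem toZModPow_eq_zero {n : ℕ} {x : ℤ_[ℓ]} :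
    PadicInt.toZModPow n x = 0 ↔ ∃ y, x = (ℓ : ℤ_[ℓ]) ^ n * y := by
  rw [← RingHom.mem_ker, PadicInt.ker_toZModPow, Ideal.mem_span_singleton]
  rfl

/-- A vector pairing to `0` modulo `ℓ^n` with everything is divisible by `ℓ^n`. -/
theorem exists_smul_of_sympForm {n : ℕ} {u : Fin g ⊕ Fin g → ℤ_[ℓ]}
    (h : ∀ v, PadicInt.toZModPow n (sympForm v u) = 0) : ∃ w, u = (ℓ : ℤ_[ℓ]) ^ n • w := by
  have h' : ∀ j, ∃ y, u j = (ℓ : ℤ_[ℓ]) ^ n * y := by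
    rintro (i | i)
    · have := h (Pi.single (Sum.inr i) 1)
      rw [sympForm_inr, map_neg, neg_eq_zero] at this
      exact toZModPow_eq_zero.1 this
    · have := h (Pi.single (Sum.inl i) 1)
      rw [sympForm_inl] at this
      exact toZModPow_eq_zero.1 this
  choose w hw using h'
  exact ⟨w, funext hw⟩

theorem ell_pow_ne_zero (n : ℕ) : ℓ ^ n ≠ 0 := pow_ne_zero _ (Fact.out : ℓ.Prime).ne_zero

theorem toCoker_add (n : ℕ) (M : SkewSymp ℓ g) (v w : Fin g ⊕ Fin g → ℤ_[ℓ]) :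
    toCoker n M (v + w) = toCoker n M v + toCoker n M w := map_add _ _ _

theorem toCoker_nsmul (n k : ℕ) (M : SkewSymp ℓ g) (v : Fin g ⊕ Fin g → ℤ_[ℓ]) :
    toCoker n M (k • v) = k • toCoker n M v := map_nsmul _ _ _

theorem toCoker_shiftMap (n : ℕ) (M : SkewSymp ℓ g) (v : Fin g ⊕ Fin g → ℤ_[ℓ]) :
    toCoker n M (shiftMap n M v) = 0 := by
  rw [toCoker, Submodule.mkQ_apply, Submodule.Quotient.mk_eq_zero]
  exact ⟨v, rfl⟩

theorem toCoker_eq {n : ℕ} {M : SkewSymp ℓ g} {w w' x : Fin g ⊕ Fin g → ℤ_[ℓ]}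
    (h : w = w' + shiftMap n M x) : toCoker n M w = toCoker n M w' := by
  rw [h, toCoker_add, toCoker_shiftMap, add_zero]

theorem exists_isSnakeLift (n : ℕ) (M : SkewSymp ℓ g) (α : PDual (LinCoker n M))
    (hα : ℓ ^ n • α = 0) : ∃ u w, IsSnakeLift n M α u w := by
  have hN := ell_pow_ne_zero (ℓ := ℓ) n
  have hz : ∀ x, ℓ ^ n • α x = 0 := fun x => DFunLike.congr_fun hα x
  have hc : ∀ j, ∃ d : ℤ_[ℓ], α (toCoker n M (Pi.single j 1)) =
      zmodToCircle (ℓ ^ n) (PadicInt.toZModPow n d) := by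
    intro j
    obtain ⟨c, hc⟩ := exists_zmodToCircle_eq hN _ (hz (toCoker n M (Pi.single j 1)))
    obtain ⟨k, rfl⟩ := ZMod.intCast_surjective c
    exact ⟨k, by rw [← hc, map_intCast (PadicInt.toZModPow n)]⟩
  choose d hd using hc
  let u : Fin g ⊕ Fin g → ℤ_[ℓ] :=
    Sum.elim (fun i => -d (Sum.inr i)) (fun i => d (Sum.inl i))
  have hu : ∀ j, sympForm (Pi.single j 1) u = d j := by
    rintro (i | i)
    · rw [sympForm_inl]; rfl
    · rw [sympForm_inr]; simp [u]
  let A : (Fin g ⊕ Fin g → ℤ_[ℓ]) →+ AddCircle (1 : ℚ) :=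
    { toFun := fun v => α (toCoker n M v)
      map_zero' := by
        have : toCoker n M 0 = 0 := map_zero _
        rw [this, map_zero]
      map_add' := fun v w => by rw [toCoker_add, map_add] }
  let B : (Fin g ⊕ Fin g → ℤ_[ℓ]) →+ AddCircle (1 : ℚ) :=
    { toFun := fun v => zmodToCircle (ℓ ^ n) (PadicInt.toZModPow n (sympForm v u))
      map_zero' := by simp [sympForm]
      map_add' := fun v w => by rw [sympForm_add_left, map_add, map_add] }
  have hAB : A = B := by
    refine AddMonoidHom.functions_ext _ _ _ fun j x => ?_
    obtain ⟨y, hy⟩ := toZModPow_eq_zero.1 (show PadicInt.toZModPow n (x - (x.appr n : ℤ_[ℓ])) = 0 by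
      rw [← RingHom.mem_ker, PadicInt.ker_toZModPow]; exact PadicInt.appr_spec n x)
    have hx : (Pi.single j x : Fin g ⊕ Fin g → ℤ_[ℓ]) =
        x.appr n • Pi.single j 1 + ℓ ^ n • Pi.single j y := by
      rw [← Pi.single_smul, ← Pi.single_smul, ← Pi.single_add]
      congr 1
      rw [nsmul_eq_mul, nsmul_eq_mul, mul_one, Nat.cast_pow, ← hy]
      ring
    have hA : ∀ v, ℓ ^ n • A v = 0 := fun v => hz _
    have hB : ∀ v, ℓ ^ n • B v = 0 := fun v => by
      change ℓ ^ n • zmodToCircle (ℓ ^ n) _ = 0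
      rw [← map_nsmul]
      simp
    rw [hx, map_add, map_add, map_nsmul, map_nsmul, map_nsmul, map_nsmul, hA, hB]
    congr 2
    change α _ = zmodToCircle _ _
    rw [hd, hu]
  have h1 : ∀ v, α (toCoker n M v) =
      zmodToCircle (ℓ ^ n) (PadicInt.toZModPow n (sympForm v u)) :=
    fun v => DFunLike.congr_fun hAB v
  have h2 : ∀ v, PadicInt.toZModPow n (sympForm v (shiftMap n M u)) = 0 := by
    intro v
    have h3 := h1 (shiftMap n M v)
    rw [toCoker_shiftMap, map_zero] at h3
    have h4 := zmodToCircle_injective hN (h3.symm.trans (map_zero _).symm)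
    have h5 : sympForm v (shiftMap n M u) =
        (ℓ : ℤ_[ℓ]) ^ n * (2 * sympForm v u) - sympForm (shiftMap n M v) u := by
      simp only [shiftMap, LinearMap.add_apply, LinearMap.smul_apply, LinearMap.id_apply,
        Matrix.mulVecLin_apply, sympForm_add_left, sympForm_add_right, sympForm_smul_left,
        sympForm_smul_right, SkewSymp.skew]
      ring
    rw [h5, map_sub, h4, sub_zero]
    exact toZModPow_eq_zero.2 ⟨_, rfl⟩
  obtain ⟨w, hw⟩ := exists_smul_of_sympForm h2
  exact ⟨u, w, h1, hw⟩

theorem IsSnakeLift.add {n : ℕ} {M : SkewSymp ℓ g} {α α' : PDual (LinCoker n M)}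
    {u w u' w' : Fin g ⊕ Fin g → ℤ_[ℓ]} (h : IsSnakeLift n M α u w)
    (h' : IsSnakeLift n M α' u' w') : IsSnakeLift n M (α + α') (u + u') (w + w') := by
  refine ⟨fun v => ?_, ?_⟩
  · rw [AddMonoidHom.add_apply, h.1, h'.1, sympForm_add_right, map_add, map_add]
  · rw [map_add, h.2, h'.2, smul_add]

theorem IsSnakeLift.toCoker_eq {n : ℕ} {M : SkewSymp ℓ g} {α : PDual (LinCoker n M)}
    {u w u' w' : Fin g ⊕ Fin g → ℤ_[ℓ]} (h : IsSnakeLift n M α u w)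
    (h' : IsSnakeLift n M α u' w') : toCoker n M w = toCoker n M w' := by
  have hN := ell_pow_ne_zero (ℓ := ℓ) n
  have hu : ∀ v, PadicInt.toZModPow n (sympForm v (u - u')) = 0 := by
    intro v
    have e := zmodToCircle_injective hN ((h.1 v).symm.trans (h'.1 v))
    have e2 : sympForm v u = sympForm v (u - u') + sympForm v u' := by
      rw [← sympForm_add_right, sub_add_cancel]
    rw [e2, map_add] at e
    exact add_eq_right.1 e
  obtain ⟨x, hx⟩ := exists_smul_of_sympForm hu
  have hp : (ℓ : ℤ_[ℓ]) ^ n ≠ 0 := by exact_mod_cast hN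
  refine _root_.toCoker_eq (x := x) ?_
  have h3 : (ℓ : ℤ_[ℓ]) ^ n • w = (ℓ : ℤ_[ℓ]) ^ n • (w' + shiftMap n M x) := by
    rw [smul_add, ← map_smul, ← hx, ← h.2, ← h'.2, map_sub]
    abel
  exact smul_right_injective _ hp h3

theorem IsSnakeLift.nsmul_eq_zero {n : ℕ} {M : SkewSymp ℓ g} {α : PDual (LinCoker n M)}
    {u w : Fin g ⊕ Fin g → ℤ_[ℓ]} (h : IsSnakeLift n M α u w) :
    ℓ ^ n • toCoker n M w = 0 := by
  have e : ℓ ^ n • w = shiftMap n M u := by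
    rw [h.2]
    ext j
    simp
  rw [← toCoker_nsmul, e, toCoker_shiftMap]

/-- `ψ_M : G_M^∨[ℓ^n] → G_M[ℓ^n]`, sending `α`, viewed as an element of `(ℚ_ℓ/ℤ_ℓ)^{2g}`, to the
class of `(M + ℓ^n) α'` for any lift `α'` of `α` to `ℚ_ℓ^{2g}`. -/
noncomputable def linPsi (n : ℕ) (M : SkewSymp ℓ g) :
    Tors (ℓ ^ n) (PDual (LinCoker n M)) →+ Tors (ℓ ^ n) (LinCoker n M) :=
  AddMonoidHom.mk'
    (fun α =>
      ⟨toCoker n M (exists_isSnakeLift n M α.1 (mem_tors.1 α.2)).choose_spec.choose,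
        mem_tors.2 (exists_isSnakeLift n M α.1
          (mem_tors.1 α.2)).choose_spec.choose_spec.nsmul_eq_zero⟩)
    (fun α β => Subtype.ext <|
      (IsSnakeLift.toCoker_eq
        (exists_isSnakeLift n M (α + β).1 (mem_tors.1 (α + β).2)).choose_spec.choose_spec
        ((exists_isSnakeLift n M α.1 (mem_tors.1 α.2)).choose_spec.choose_spec.add
          (exists_isSnakeLift n M β.1 (mem_tors.1 β.2)).choose_spec.choose_spec)).trans
        (toCoker_add n M _ _))

theorem linPsi_eq {n : ℕ} {M : SkewSymp ℓ g} (α : Tors (ℓ ^ n) (PDual (LinCoker n M)))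
    {u w : Fin g ⊕ Fin g → ℤ_[ℓ]} (h : IsSnakeLift n M α.1 u w) :
    (linPsi n M α : LinCoker n M) = toCoker n M w :=
  (exists_isSnakeLift n M α.1 (mem_tors.1 α.2)).choose_spec.choose_spec.toCoker_eq h

/-- The pair `(ω_M, ψ_M)` on `G_M`. -/
noncomputable def linData (n : ℕ) (M : SkewSymp ℓ g) : EnhData ℓ n (LinCoker n M) :=
  ⟨linOmega n M, linPsi n M⟩

end LinearModel

instance SkewSymp.compactSpace (ℓ : ℕ) [Fact ℓ.Prime] (g : ℕ) : CompactSpace (SkewSymp ℓ g) := by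
  suffices hc : IsCompact (SkewSymp ℓ g : Set (Matrix (Fin g ⊕ Fin g) (Fin g ⊕ Fin g) ℤ_[ℓ])) from
    isCompact_iff_compactSpace.1 hc
  have : CompactSpace (Matrix (Fin g ⊕ Fin g) (Fin g ⊕ Fin g) ℤ_[ℓ]) :=
    inferInstanceAs (CompactSpace (Fin g ⊕ Fin g → Fin g ⊕ Fin g → ℤ_[ℓ]))
  refine IsClosed.isCompact ?_
  have h : (SkewSymp ℓ g : Set (Matrix (Fin g ⊕ Fin g) (Fin g ⊕ Fin g) ℤ_[ℓ])) =
      {M | M.transpose * Matrix.J (Fin g) ℤ_[ℓ] = Matrix.J (Fin g) ℤ_[ℓ] * (-M)} := by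
    ext M
    exact mem_skewAdjointMatricesSubmodule _ _
  rw [h]
  exact isClosed_eq (by fun_prop) (by fun_prop)

/-- The mass that the linear measure `μ_g` gives to an isomorphism class `c`: the probability,
for the Haar probability measure on skew-symplectic matrices `M`, that `(G_M, ω_M, ψ_M)` belongs
to `c`. -/
noncomputable def linearMeasure (ℓ n g : ℕ) [Fact ℓ.Prime] (c : BEGClass ℓ n) : ℝ≥0∞ :=
  letI : MeasurableSpace (SkewSymp ℓ g) := borel _
  haveI : BorelSpace (SkewSymp ℓ g) := ⟨rfl⟩
  MeasureTheory.Measure.addHaarMeasure (⊤ : TopologicalSpace.PositiveCompacts (SkewSymp ℓ g))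
    {M | ∃ X : BEG ℓ n, (⟦X⟧ : BEGClass ℓ n) = c ∧
      ∃ e : LinCoker n M ≃+ X.carrier, (linData n M).push e.toAddMonoidHom = X.data}

/-- The universal measure `μ`, the limit of the measures `μ_g`.  Measures on the countable discrete
set of isomorphism classes are given by their point masses. -/
noncomputable def universalMeasure (ℓ n : ℕ) [Fact ℓ.Prime] (c : BEGClass ℓ n) : ℝ≥0∞ :=
  Filter.limUnder Filter.atTop fun g => linearMeasure ℓ n g c

/-! ### Quotients by random elements -/

/-- The measure `Qν`: the integral over `H` of the proportion of homomorphisms `f : ℤ_ℓ → H` for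
which `H / Im f` belongs to `c` (there are `|H|` homomorphisms `ℤ_ℓ → H` in total). -/
noncomputable def quotMeasure {ℓ n : ℕ} [Fact ℓ.Prime] (ν : BEGClass ℓ n → ℝ≥0∞)
    (c : BEGClass ℓ n) : ℝ≥0∞ :=
  ∑' h : BEGClass ℓ n,
    (Nat.card {f : ℤ_[ℓ] →+ h.out.carrier // (⟦h.out.quot f.range⟧ : BEGClass ℓ n) = c} : ℝ≥0∞) /
      (Nat.card h.out.carrier : ℝ≥0∞) * ν h

/-- The total mass `∑_{(ω, ψ)} ν(G, ω, ψ)` of the isomorphism classes with underlying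
group `G`. -/
noncomputable def groupMass {ℓ n : ℕ} (ν : BEGClass ℓ n → ℝ≥0∞) (G : Type*) [AddCommGroup G] :
    ℝ≥0∞ :=
  ∑' c : {c : BEGClass ℓ n // ∃ X : BEG ℓ n, ⟦X⟧ = c ∧ Nonempty (X.carrier ≃+ G)}, ν c

/-- `(x)_j = ∏_{i=1}^j (1 - x^i)`. -/
noncomputable def qPoch (x : ℝ) (j : ℕ) : ℝ := ∏ i ∈ Finset.Icc 1 j, (1 - x ^ i)

/-- The `ℓ`-rank of `G`, the dimension of `G/ℓG` over `ℤ/ℓ`. -/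
noncomputable def ellRank (ℓ : ℕ) (G : Type*) [AddCommGroup G] : ℕ :=
  Module.finrank (ZMod ℓ) (ModN G ℓ)

/-! The formula is proved for t = 0 by computing the limit of the linear measures, and carried from
t to t + 1 by the recursion that Q imposes on group masses. Every finite abelian ℓ-group is replaced
by a model G = ∏ ℤ/ℓ^(lam i + 1) of rank r.

The case t = 0. Multiplication by J turns a skew-symplectic M into the symmetric matrix MJ, and the
cokernel of M + ℓ into that of MJ + ℓJ (`shiftForm`). An isomorphism of this cokernel with G is a
surjection x : ℤ_ℓ^(2g) → G whose kernel is the image of M + ℓ. On the coordinate characters, ψ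
becomes an r × r matrix C over ℤ/ℓ, namely the first digits of X (MJ + ℓJ) Xᵀ that the kernel
condition does not force to vanish, X being a lift of x (`isPsiMatrix_push_iff`). Since ℓ is odd and
n = 1, the compatibility identity recovers ω from ψ (`EnhData.IsBEG.ext_psi`). A class of BEGs on G
therefore amounts to a set of matrices C, and |Aut G| times its mass is the sum, over these C and
all x, of the probability that (x, C) presents M.

To find that probability, complete X to an invertible matrix P. In the new coordinates, being a
presentation means that C is invertible, that the leading block of P (MJ + ℓJ) Pᵀ has prescribed
residues, that its upper border is divisible by the elementary divisors, and that its last block is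
invertible modulo ℓ (`range_eq_elemDiv_iff`). Residues of a Haar-random symmetric matrix are
uniform, so the probability is explicit. An off-diagonal entry of the symmetric matrix is however
prescribed twice, and the two prescriptions agree only if a sum of g alternating products of the
entries of x takes a given value. This is a random walk on a finite group, which equidistributes
(`tendsto_card_sum_eq`). Counting residues (`card_symm_mul_card_alt`), the expected number of
presentations with a given invertible C tends to ℓ^(-binom(r+1,2)) times the limiting probability
that a symmetric matrix over 𝔽_ℓ is invertible. That probability is the product of the 1 - ℓ^(-j)
over odd j, which by Euler's identity is the product of the (1 + ℓ^(-i))⁻¹ over i ≥ 1. Summing over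
the ℓ^(r²) (ℓ⁻¹)_r invertible matrices C and dividing by |Aut G| gives the formula.

From t to t + 1. If x in H has order ℓ^k and H/⟨x⟩ ≅ G, then lifts of the standard generators of G
identify H with one of the extensions E_a (`CycExt`), where a in (ℤ/ℓ^k)^r records the multiples of
x that the relations of G become. Counting lifts shows that Qν(G) is the sum over k and a of |Aut
E_a| ν(E_a) / (|Aut G| ℓ^(kr) |E_a|). When ν has Malle's masses, |Aut E_a| cancels and the summand
depends on a only through the rank of E_a, which is r + 1 if k ≥ 1 and a ≡ 0 modulo ℓ, and r
otherwise. The sum over k is then geometric with ratio ℓ^(-(t+1)) and evaluates to the next formula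
(`hasSum_malleSummand`). -/

set_option linter.unusedSectionVars false

/-! ### Counting invertible symmetric matrices over a finite field -/

section SymmetricCount

variable {F : Type*} [Field F]

/-- Symmetric matrices. -/
abbrev SymMat (ι F : Type*) := {A : Matrix ι ι F // A.IsSymm}

/-- Invertible symmetric matrices. -/
abbrev SymInv (ι F : Type*) [Fintype ι] [DecidableEq ι] [Field F] :=
  {A : Matrix ι ι F // A.IsSymm ∧ A.det ≠ 0}

/-- The symmetric matrix with corner `a`, border `v` and remaining block `D`. -/
def bordered {ι : Type*} (a : F) (v : ι → F) (D : Matrix ι ι F) :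
    Matrix (Unit ⊕ ι) (Unit ⊕ ι) F :=
  Matrix.fromBlocks (Matrix.of fun _ _ => a) (Matrix.replicateRow Unit v) (Matrix.replicateCol Unit v) D

section
variable {ι : Type*} (a : F) (v : ι → F) (D : Matrix ι ι F)

@[simp] theorem bordered_inl_inl (i j : Unit) : bordered a v D (Sum.inl i) (Sum.inl j) = a := rfl

@[simp] theorem bordered_inl_inr (i : Unit) (j : ι) :
    bordered a v D (Sum.inl i) (Sum.inr j) = v j := rfl

@[simp] theorem bordered_inr_inl (i : ι) (j : Unit) :
    bordered a v D (Sum.inr i) (Sum.inl j) = v i := rfl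

@[simp] theorem bordered_inr_inr (i j : ι) : bordered a v D (Sum.inr i) (Sum.inr j) = D i j := rfl

end

/-- A symmetric matrix is a corner, a border and a smaller symmetric matrix. -/
def symMatEquivBordered (ι : Type*) : SymMat (Unit ⊕ ι) F ≃ F × (ι → F) × SymMat ι F where
  toFun A := (A.1 (Sum.inl ()) (Sum.inl ()), fun i => A.1 (Sum.inl ()) (Sum.inr i),
    ⟨A.1.toBlocks₂₂, by ext i j; exact A.2.apply (Sum.inr i) (Sum.inr j)⟩)
  invFun p := ⟨bordered p.1 p.2.1 p.2.2.1, by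
    refine Matrix.IsSymm.fromBlocks rfl rfl p.2.2.2⟩
  left_inv A := by
    ext i j
    rcases i with i | i <;> rcases j with j | j
    · rfl
    · rfl
    · exact A.2.apply (Sum.inr i) (Sum.inl ())
    · rfl
  right_inv p := rfl

/-- Schur complement with respect to the corner. -/
theorem bordered_det_of_ne_zero {ι : Type*} [Fintype ι] [DecidableEq ι] {a : F} (ha : a ≠ 0)
    (v : ι → F) (D : Matrix ι ι F) :
    (bordered a v D).det = a * (D - a⁻¹ • Matrix.vecMulVec v v).det := by
  have hA : IsUnit (Matrix.of fun _ _ => a : Matrix Unit Unit F).det := by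
    rw [Matrix.det_unique]; exact ha.isUnit
  let := Matrix.invertibleOfIsUnitDet _ hA
  rw [bordered, Matrix.det_fromBlocks₁₁, Matrix.det_unique]
  congr 3
  ext i j
  simp [Matrix.mul_apply, Matrix.vecMulVec, Ring.inverse_eq_inv]
  ring

theorem bordered_zero_congr {ι : Type*} [Fintype ι] [DecidableEq ι] (P : Matrix ι ι F) (v : ι → F)
    (D : Matrix ι ι F) :
    (bordered 0 (P.mulVec v) (P * D * P.transpose)).det = P.det ^ 2 * (bordered 0 v D).det := by
  have h : bordered 0 (P.mulVec v) (P * D * P.transpose) =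
      Matrix.fromBlocks 1 0 0 P * bordered 0 v D *
        (Matrix.fromBlocks 1 0 0 P : Matrix (Unit ⊕ ι) (Unit ⊕ ι) F).transpose := by
    rw [bordered, bordered, Matrix.fromBlocks_transpose, Matrix.fromBlocks_multiply,
      Matrix.fromBlocks_multiply]
    congr 1
    · ext; simp
    · ext i j
      simp [Matrix.mul_apply, Matrix.mulVec, dotProduct, mul_comm]
    · ext i j
      simp [Matrix.mul_apply, Matrix.mulVec, dotProduct]
    · simp
  rw [h, Matrix.det_mul, Matrix.det_mul, Matrix.det_transpose, Matrix.det_fromBlocks_zero₂₁]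
  simp
  ring

theorem exists_mulVec_eq {ι : Type*} [Fintype ι] [DecidableEq ι] {v : ι → F} (hv : v ≠ 0) (k : ι) :
    ∃ P : Matrix ι ι F, P.det ≠ 0 ∧ P.mulVec (Pi.single k 1) = v := by
  obtain ⟨j, hj⟩ := Function.ne_iff.1 hv
  -- The identity with column j replaced by v has determinant v j; exchanging columns j and k brings
  -- v to position k.
  refine ⟨Matrix.submatrix (Matrix.updateCol 1 j v) id (Equiv.swap k j), ?_, ?_⟩
  · rw [Matrix.det_permute']
    have : (Matrix.updateCol (1 : Matrix ι ι F) j v).det = v j := by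
      rw [← Matrix.cramer_apply, Matrix.cramer_one]
      rfl
    rw [this]
    refine mul_ne_zero ?_ hj
    rcases Int.units_eq_one_or (Equiv.Perm.sign (Equiv.swap k j)) with h | h <;> simp [h]
  · rw [Matrix.mulVec_single_one]
    ext i
    simp [Matrix.col]

/-- A kernel vector has second coordinate zero by the first row; the second row then determines its
first coordinate, and what remains is a kernel vector of D. The entries b and w play no role, which
makes them free in the count. -/
theorem bordered_zero_single_det_ne_zero {κ : Type*} [Fintype κ] [DecidableEq κ]
    (b : F) (w : κ → F) (D : Matrix κ κ F) :
    (bordered 0 (Pi.single (Sum.inl ()) 1) (bordered b w D)).det ≠ 0 ↔ D.det ≠ 0 := by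
  rw [not_iff_not, ← Matrix.exists_mulVec_eq_zero_iff, ← Matrix.exists_mulVec_eq_zero_iff]
  have key : ∀ u : Unit ⊕ Unit ⊕ κ → F,
      (bordered 0 (Pi.single (Sum.inl ()) 1) (bordered b w D)).mulVec u = 0 ↔
        u (Sum.inr (Sum.inl ())) = 0 ∧
        u (Sum.inl ()) = - (w ⬝ᵥ fun i => u (Sum.inr (Sum.inr i))) ∧
        D.mulVec (fun i => u (Sum.inr (Sum.inr i))) = 0 := by
    intro u
    constructor
    · intro h
      have h1 := congrFun h (Sum.inl ())
      have h2 := congrFun h (Sum.inr (Sum.inl ()))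
      have h3 := fun i => congrFun h (Sum.inr (Sum.inr i))
      simp [Matrix.mulVec, dotProduct, Fintype.sum_sum_type] at h1 h2 h3
      refine ⟨h1, ?_, ?_⟩
      · rw [h1] at h2
        simp [dotProduct]
        linear_combination h2
      · ext i
        have := h3 i
        rw [h1] at this
        simpa [Matrix.mulVec, dotProduct] using this
    · rintro ⟨h1, h2, h3⟩
      ext (i | i | i)
      · simp [Matrix.mulVec, dotProduct, Fintype.sum_sum_type, h1]
      · simp [Matrix.mulVec, dotProduct, Fintype.sum_sum_type, h1, h2]
      · have := congrFun h3 i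
        simp [Matrix.mulVec, dotProduct] at this
        simp [Matrix.mulVec, dotProduct, Fintype.sum_sum_type, h1, this]
  constructor
  · rintro ⟨u, hu, h⟩
    obtain ⟨h1, h2, h3⟩ := (key u).1 h
    refine ⟨_, fun h0 => hu ?_, h3⟩
    ext (i | i | i)
    · rw [show i = () from rfl, h2, h0]; simp
    · exact h1
    · exact congrFun h0 i
  · rintro ⟨y, hy, h⟩
    refine ⟨Sum.elim (fun _ => -(w ⬝ᵥ y)) (Sum.elim 0 y), fun h0 => hy ?_, ?_⟩
    · ext i
      exact congrFun h0 (Sum.inr (Sum.inr i))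
    · rw [key]
      exact ⟨rfl, rfl, h⟩

section

variable [Finite F]

theorem card_symMat_unit_sum (ι : Type*) [Finite ι] :
    Nat.card (SymMat (Unit ⊕ ι) F) =
      Nat.card F * (Nat.card F ^ Nat.card ι * Nat.card (SymMat ι F)) := by
  rw [Nat.card_congr (symMatEquivBordered ι), Nat.card_prod, Nat.card_prod, Nat.card_fun]

/-- The number of symmetric blocks completing a given corner and border to an invertible matrix. -/
noncomputable def completionCount {ι : Type*} [Fintype ι] [DecidableEq ι] (a : F) (v : ι → F) : ℕ :=
  Nat.card {D : SymMat ι F // (bordered a v D.1).det ≠ 0}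

theorem card_symInv_eq_sum (ι : Type*) [Fintype ι] [DecidableEq ι] [Fintype F] [DecidableEq F] :
    Nat.card (SymInv (Unit ⊕ ι) F) = ∑ a : F, ∑ v : ι → F, completionCount a v := by
  have e : SymInv (Unit ⊕ ι) F ≃
      Σ a : F, Σ v : ι → F, {D : SymMat ι F // (bordered a v D.1).det ≠ 0} :=
    (Equiv.subtypeSubtypeEquivSubtypeInter _ _).symm.trans <|
    { toFun := fun A => ⟨(symMatEquivBordered ι A.1).1, (symMatEquivBordered ι A.1).2.1,
        (symMatEquivBordered ι A.1).2.2, by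
          have := congrArg Subtype.val ((symMatEquivBordered ι).symm_apply_apply A.1)
          change bordered _ _ _ = _ at this
          rw [this]; exact A.2⟩
      invFun := fun p => ⟨(symMatEquivBordered ι).symm (p.1, p.2.1, p.2.2.1), p.2.2.2⟩
      left_inv := fun A => Subtype.ext ((symMatEquivBordered ι).symm_apply_apply A.1)
      right_inv := fun p => rfl }
  rw [Nat.card_congr e, Nat.card_sigma]
  refine Finset.sum_congr rfl fun a _ => ?_
  rw [Nat.card_sigma]
  rfl

variable {ι : Type*} [Fintype ι] [DecidableEq ι]

/-- Subtracting the symmetric matrix a⁻¹ v vᵀ replaces the remaining block by its Schur complement.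
-/
theorem completionCount_of_ne_zero {a : F} (ha : a ≠ 0) (v : ι → F) :
    completionCount a v = Nat.card (SymInv ι F) := by
  have hs : (a⁻¹ • Matrix.vecMulVec v v).IsSymm := by
    ext i j
    simp [Matrix.vecMulVec, mul_comm]
  refine Nat.card_congr
    { toFun := fun D => ⟨D.1.1 - a⁻¹ • Matrix.vecMulVec v v, D.1.2.sub hs, ?_⟩
      invFun := fun D => ⟨⟨D.1 + a⁻¹ • Matrix.vecMulVec v v, D.2.1.add hs⟩, ?_⟩
      left_inv := fun D => by ext; simp
      right_inv := fun D => by ext; simp }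
  · have := D.2
    rw [bordered_det_of_ne_zero ha] at this
    exact right_ne_zero_of_mul this
  · rw [bordered_det_of_ne_zero ha]
    simpa using ⟨ha, D.2.2⟩

theorem completionCount_zero_zero : completionCount (0 : F) (0 : ι → F) = 0 := by
  rw [completionCount, Nat.card_eq_zero]
  left
  refine ⟨fun D => D.2 (Matrix.det_eq_zero_of_row_eq_zero (Sum.inl ()) ?_)⟩
  rintro (i | i) <;> rfl

/-- Congruence by diag(1, P) permutes the completions. Since GL acts transitively on nonzero
borders, the count for corner 0 can be made at a single standard vector. -/
theorem completionCount_mulVec {P : Matrix ι ι F} (hP : P.det ≠ 0) (v : ι → F) :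
    completionCount (0 : F) (P.mulVec v) = completionCount (0 : F) v := by
  have hPu : IsUnit P.det := hP.isUnit
  have hPt : IsUnit P.transpose.det := by rwa [Matrix.det_transpose]
  have hsymm : ∀ (Q : Matrix ι ι F) {D : Matrix ι ι F}, D.IsSymm →
      (Q * D * Q.transpose).IsSymm := fun Q D hD => by
    rw [Matrix.IsSymm, Matrix.transpose_mul, Matrix.transpose_mul, hD.eq,
      Matrix.transpose_transpose, Matrix.mul_assoc]
  symm
  refine Nat.card_congr (Equiv.subtypeEquiv
    { toFun := fun D => ⟨P * D.1 * P.transpose, hsymm P D.2⟩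
      invFun := fun D => ⟨P⁻¹ * D.1 * P⁻¹.transpose, hsymm _ D.2⟩
      left_inv := fun D => Subtype.ext ?_
      right_inv := fun D => Subtype.ext ?_ } fun D => ?_)
  · simp only [Matrix.mul_assoc, Matrix.transpose_nonsing_inv, Matrix.mul_nonsing_inv _ hPt,
      Matrix.mul_one, Matrix.nonsing_inv_mul_cancel_left _ _ hPu]
  · simp only [Matrix.mul_assoc, Matrix.transpose_nonsing_inv, Matrix.nonsing_inv_mul _ hPt,
      Matrix.mul_one, Matrix.mul_nonsing_inv_cancel_left _ _ hPu]
  · change _ ↔ (bordered 0 (P.mulVec v) (P * D.1 * P.transpose)).det ≠ 0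
    rw [bordered_zero_congr]
    simp [hP]

theorem completionCount_zero_single (κ : Type*) [Fintype κ] [DecidableEq κ] :
    completionCount (0 : F) (Pi.single (Sum.inl ()) 1 : Unit ⊕ κ → F) =
      Nat.card F * (Nat.card F ^ Nat.card κ * Nat.card (SymInv κ F)) := by
  have e : {D : SymMat (Unit ⊕ κ) F // (bordered 0 (Pi.single (Sum.inl ()) 1) D.1).det ≠ 0} ≃
      F × (κ → F) × {D : SymMat κ F // D.1.det ≠ 0} :=
    (Equiv.subtypeEquiv (symMatEquivBordered κ) (q := fun p => p.2.2.1.det ≠ 0) (by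
      intro D
      rw [← bordered_zero_single_det_ne_zero (symMatEquivBordered κ D).1
        (symMatEquivBordered κ D).2.1]
      have := congrArg Subtype.val ((symMatEquivBordered κ).symm_apply_apply D)
      change bordered _ _ _ = _ at this
      rw [this])).trans
    { toFun := fun p => (p.1.1, p.1.2.1, ⟨p.1.2.2, p.2⟩)
      invFun := fun p => ⟨(p.1, p.2.1, p.2.2.1), p.2.2.2⟩
      left_inv := fun p => rfl
      right_inv := fun p => rfl }
  rw [completionCount, Nat.card_congr e, Nat.card_prod, Nat.card_prod, Nat.card_fun,
    Nat.card_congr (Equiv.subtypeSubtypeEquivSubtypeInter (fun A : Matrix κ κ F => A.IsSymm)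
      fun A => A.det ≠ 0)]

theorem completionCount_zero_of_ne_zero {κ : Type*} [Fintype κ] [DecidableEq κ]
    {v : Unit ⊕ κ → F} (hv : v ≠ 0) : completionCount (0 : F) v =
      Nat.card F * (Nat.card F ^ Nat.card κ * Nat.card (SymInv κ F)) := by
  obtain ⟨P, hP, rfl⟩ := exists_mulVec_eq hv (Sum.inl ())
  rw [completionCount_mulVec hP, completionCount_zero_single]

/-- A nonzero corner reduces the size by one through the Schur complement; a zero corner with
nonzero border reduces it by two; a zero corner with zero border admits no invertible completion. -/
theorem card_symInv_unit_sum_unit_sum (κ : Type*) [Fintype κ] [DecidableEq κ] :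
    Nat.card (SymInv (Unit ⊕ Unit ⊕ κ) F) =
      (Nat.card F - 1) * (Nat.card F ^ (Nat.card κ + 1) * Nat.card (SymInv (Unit ⊕ κ) F)) +
      (Nat.card F ^ (Nat.card κ + 1) - 1) *
        (Nat.card F * (Nat.card F ^ Nat.card κ * Nat.card (SymInv κ F))) := by
  classical
  have := Fintype.ofFinite F
  have hcard : Fintype.card (Unit ⊕ κ → F) = Nat.card F ^ (Nat.card κ + 1) := by
    simp [add_comm]
  rw [card_symInv_eq_sum, ← Finset.add_sum_erase _ _ (Finset.mem_univ (0 : F)),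
    ← Finset.add_sum_erase _ _ (Finset.mem_univ (0 : Unit ⊕ κ → F)), completionCount_zero_zero,
    zero_add, add_comm]
  congr 1
  · rw [Finset.sum_congr rfl (g := fun _ => Nat.card F ^ (Nat.card κ + 1) *
      Nat.card (SymInv (Unit ⊕ κ) F))]
    · rw [Finset.sum_const, Finset.card_erase_of_mem (Finset.mem_univ _), Finset.card_univ,
        smul_eq_mul, Nat.card_eq_fintype_card (α := F)]
    · intro a ha
      rw [Finset.sum_congr rfl fun v _ => completionCount_of_ne_zero (Finset.ne_of_mem_erase ha) v,
        Finset.sum_const, Finset.card_univ, hcard, smul_eq_mul]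
  · rw [Finset.sum_congr rfl fun v hv =>
      completionCount_zero_of_ne_zero (Finset.ne_of_mem_erase hv),
      Finset.sum_const, Finset.card_erase_of_mem (Finset.mem_univ _), Finset.card_univ, hcard,
      smul_eq_mul]

end

end SymmetricCount

/-! ### The probability that a symmetric matrix is invertible -/

/-- The probability that a random symmetric `m × m` matrix over a finite field is invertible. -/
noncomputable def symInvProb (F : Type*) [Field F] (m : ℕ) : ℝ :=
  Nat.card (SymInv (Fin m) F) / Nat.card (SymMat (Fin m) F)

section SymInvProb

variable (F : Type*) [Field F]

/-- Reindexing symmetric matrices. -/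
def symMatReindex {ι κ : Type*} (e : ι ≃ κ) : SymMat ι F ≃ SymMat κ F :=
  Equiv.subtypeEquiv (Matrix.reindex e e) fun A => by
    refine ⟨fun h => h.submatrix _, fun h => ?_⟩
    have := h.submatrix e
    simpa using this

theorem card_symInv_congr {ι κ : Type*} [Fintype ι] [DecidableEq ι] [Fintype κ] [DecidableEq κ]
    (e : ι ≃ κ) : Nat.card (SymInv ι F) = Nat.card (SymInv κ F) := by
  refine Nat.card_congr (Equiv.subtypeEquiv (Matrix.reindex e e) fun A => ?_)
  rw [Matrix.det_reindex_self]
  refine and_congr_left fun _ => ⟨fun h => h.submatrix _, fun h => ?_⟩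
  have := h.submatrix e
  simpa using this

/-- `Fin (m + 1)` is `Fin m` with a point added. -/
def unitSumFinEquiv (m : ℕ) : Unit ⊕ Fin m ≃ Fin (m + 1) :=
  (Equiv.sumComm _ _).trans (Equiv.optionEquivSumPUnit _).symm |>.trans (finSuccEquiv m).symm

variable [Finite F]

theorem card_symMat_fin_succ (m : ℕ) : Nat.card (SymMat (Fin (m + 1)) F) =
    Nat.card F ^ (m + 1) * Nat.card (SymMat (Fin m) F) := by
  rw [← Nat.card_congr (symMatReindex F (unitSumFinEquiv m)), card_symMat_unit_sum]
  simp [pow_succ]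
  ring

theorem card_symMat_pos (m : ℕ) : 0 < Nat.card (SymMat (Fin m) F) := by
  have : Nonempty (SymMat (Fin m) F) := ⟨⟨0, Matrix.isSymm_zero⟩⟩
  exact Nat.card_pos

theorem symInvProb_zero : symInvProb F 0 = 1 := by
  have : Unique (SymInv (Fin 0) F) :=
    { default := ⟨0, Matrix.isSymm_zero, by simp⟩, uniq := fun A => Subsingleton.elim _ _ }
  have : Unique (SymMat (Fin 0) F) :=
    { default := ⟨0, Matrix.isSymm_zero⟩, uniq := fun A => Subsingleton.elim _ _ }
  simp [symInvProb]

theorem symInvProb_one : symInvProb F 1 = 1 - (Nat.card F : ℝ)⁻¹ := by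
  have e : SymInv (Fin 1) F ≃ Fˣ :=
    { toFun := fun A => Units.mk0 (A.1 0 0) (by simpa using A.2.2)
      invFun := fun a => ⟨Matrix.of fun _ _ => a, by ext i j; rfl, by simp⟩
      left_inv := fun A => by
        ext i j
        rw [Subsingleton.elim i 0, Subsingleton.elim j 0]
        rfl
      right_inv := fun a => by ext; rfl }
  have h := card_symMat_fin_succ F 0
  have h0 : Nat.card (SymMat (Fin 0) F) = 1 := by
    have : Unique (SymMat (Fin 0) F) :=
      { default := ⟨0, Matrix.isSymm_zero⟩, uniq := fun A => Subsingleton.elim _ _ }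
    simp
  have hF : 1 ≤ Nat.card F := Nat.card_pos
  have hF' : (Nat.card F : ℝ) ≠ 0 := by positivity
  rw [symInvProb, h, h0, Nat.card_congr e, Nat.card_units, Nat.cast_sub hF]
  push_cast
  field_simp

theorem symInvProb_add_two (m : ℕ) : symInvProb F (m + 2) =
    (1 - (Nat.card F : ℝ)⁻¹) * symInvProb F (m + 1) +
      (Nat.card F : ℝ)⁻¹ * (1 - (Nat.card F : ℝ)⁻¹ ^ (m + 1)) * symInvProb F m := by
  have hF : 1 ≤ Nat.card F := Nat.card_pos
  have hF' : (Nat.card F : ℝ) ≠ 0 := by positivity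
  have hS : (Nat.card (SymMat (Fin m) F) : ℝ) ≠ 0 := by
    exact_mod_cast (card_symMat_pos F m).ne'
  have e1 := card_symInv_congr F (unitSumFinEquiv m)
  have e2 := card_symInv_congr F ((Equiv.sumCongr (Equiv.refl Unit) (unitSumFinEquiv m)).trans
    (unitSumFinEquiv (m + 1)))
  rw [symInvProb, symInvProb, symInvProb, ← e2, card_symInv_unit_sum_unit_sum, e1,
    card_symMat_fin_succ, card_symMat_fin_succ]
  have h1 : 1 ≤ Nat.card F ^ (m + 1) := Nat.one_le_pow _ _ hF
  rw [Nat.card_fin]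
  push_cast [Nat.cast_sub hF, Nat.cast_sub h1]
  rw [inv_pow]
  field_simp
  ring

/-- The recursion has order two, so both parities are carried through the induction. Sizes 2k - 1
and 2k turn out to have the same probability. -/
theorem symInvProb_even_odd (k : ℕ) :
    symInvProb F (2 * k) = ∏ i ∈ Finset.range k, (1 - (Nat.card F : ℝ)⁻¹ ^ (2 * i + 1)) ∧
    symInvProb F (2 * k + 1) =
      ∏ i ∈ Finset.range (k + 1), (1 - (Nat.card F : ℝ)⁻¹ ^ (2 * i + 1)) := by
  induction k with
  | zero => simp [symInvProb_zero, symInvProb_one]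
  | succ k ih =>
    have h1 : symInvProb F (2 * (k + 1)) =
        ∏ i ∈ Finset.range (k + 1), (1 - (Nat.card F : ℝ)⁻¹ ^ (2 * i + 1)) := by
      rw [show 2 * (k + 1) = 2 * k + 2 by ring, symInvProb_add_two, ih.1, ih.2,
        Finset.prod_range_succ]
      ring
    refine ⟨h1, ?_⟩
    rw [show 2 * (k + 1) + 1 = 2 * k + 1 + 2 by ring, symInvProb_add_two,
      show 2 * k + 1 + 1 = 2 * (k + 1) by ring, h1, ih.2,
      Finset.prod_range_succ _ (k + 1)]
    ring

end SymInvProb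

/-! ### Euler's identity and the limiting constant -/

section EulerProduct

open Filter Topology

/-- The infinite product `∏_{i > t} (1 + q^i)⁻¹`. -/
noncomputable def malleConst (q : ℝ) (t : ℕ) : ℝ := ∏' i : ℕ, (1 + q ^ (t + 1 + i))⁻¹

variable {q : ℝ}

theorem summable_pow_shift (h0 : 0 ≤ q) (h1 : q < 1) (t : ℕ) :
    Summable fun i : ℕ => q ^ (t + i) := by
  simp_rw [pow_add]
  exact (summable_geometric_of_lt_one h0 h1).mul_left _

theorem tprod_one_add_pow_ne_zero (h0 : 0 ≤ q) (h1 : q < 1) (t : ℕ) :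
    ∏' i : ℕ, (1 + q ^ (t + i)) ≠ 0 := by
  refine tprod_one_add_ne_zero_of_summable (fun i => ?_) ?_
  · positivity
  · simpa [abs_of_nonneg h0] using summable_pow_shift h0 h1 t

theorem hasProd_one_add_pow (h0 : 0 ≤ q) (h1 : q < 1) (t : ℕ) :
    HasProd (fun i : ℕ => 1 + q ^ (t + i)) (∏' i : ℕ, (1 + q ^ (t + i))) :=
  (Real.multipliable_one_add_of_summable (summable_pow_shift h0 h1 t)).hasProd

theorem hasProd_malleConst (h0 : 0 ≤ q) (h1 : q < 1) (t : ℕ) :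
    HasProd (fun i : ℕ => (1 + q ^ (t + 1 + i))⁻¹) (∏' i : ℕ, (1 + q ^ (t + 1 + i)))⁻¹ :=
  (hasProd_one_add_pow h0 h1 (t + 1)).inv₀ (tprod_one_add_pow_ne_zero h0 h1 _)

theorem malleConst_nonneg (h0 : 0 ≤ q) (h1 : q < 1) (t : ℕ) : 0 ≤ malleConst q t := by
  refine ge_of_tendsto' (hasProd_malleConst h0 h1 t).multipliable.hasProd fun s => ?_
  exact Finset.prod_nonneg fun i _ => by positivity

theorem malleConst_succ (h0 : 0 ≤ q) (h1 : q < 1) (t : ℕ) :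
    malleConst q (t + 1) = (1 + q ^ (t + 1)) * malleConst q t := by
  have h := tprod_eq_zero_mul' (f := fun i : ℕ => (1 + q ^ (t + 1 + i))⁻¹) (by
    have := (hasProd_malleConst h0 h1 (t + 1)).multipliable
    convert this using 5 with i
    ring)
  have hp : 0 < 1 + q ^ (t + 1) := by positivity
  rw [malleConst, malleConst, h, add_zero, mul_inv_cancel_left₀ hp.ne']
  refine tprod_congr fun i => ?_
  congr 3
  ring

/-- Euler's identity between partitions into odd parts and partitions into distinct parts, read as a
statement about products. -/
theorem tendsto_prod_one_sub_odd (h0 : 0 ≤ q) (h1 : q < 1) :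
    Tendsto (fun k => ∏ i ∈ Finset.range k, (1 - q ^ (2 * i + 1))) atTop (𝓝 (malleConst q 0)) := by
  have hsum : Summable fun i : ℕ => -q ^ (1 + i) := (summable_pow_shift h0 h1 1).neg
  have hP : Tendsto (fun k => ∏ i ∈ Finset.range k, (1 + -q ^ (1 + i))) atTop
      (𝓝 (∏' i : ℕ, (1 + -q ^ (1 + i)))) :=
    (Real.multipliable_one_add_of_summable hsum).hasProd.tendsto_prod_nat
  have hlt : ∀ i : ℕ, q ^ (1 + i) < 1 := fun i => pow_lt_one₀ h0 h1 (by omega)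
  have hP0 : ∏' i : ℕ, (1 + -q ^ (1 + i)) ≠ 0 := by
    refine tprod_one_add_ne_zero_of_summable (fun i => ?_) ?_
    · have := hlt i
      linarith
    · simpa [abs_of_nonneg h0] using summable_pow_shift h0 h1 1
  -- Since (1 + q^i)(1 - q^i) = 1 - q^(2i), the left side is the product of 1 - q^j over odd and
  -- over even j up to 2k.
  have hfin : ∀ k, (∏ i ∈ Finset.range k, (1 - q ^ (2 * i + 1))) *
      ((∏ i ∈ Finset.range k, (1 + q ^ (1 + i))) * ∏ i ∈ Finset.range k, (1 + -q ^ (1 + i))) =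
        ∏ i ∈ Finset.range (2 * k), (1 + -q ^ (1 + i)) := by
    intro k
    induction k with
    | zero => simp
    | succ k ih =>
      rw [show 2 * (k + 1) = 2 * k + 1 + 1 by ring, Finset.prod_range_succ, Finset.prod_range_succ,
        Finset.prod_range_succ, Finset.prod_range_succ, Finset.prod_range_succ, ← ih]
      ring
  have hne : ∀ k, (∏ i ∈ Finset.range k, (1 + q ^ (1 + i))) *
      ∏ i ∈ Finset.range k, (1 + -q ^ (1 + i)) ≠ 0 := fun k => mul_ne_zero
    (Finset.prod_ne_zero_iff.2 fun i _ => by positivity)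
    (Finset.prod_ne_zero_iff.2 fun i _ => by have := hlt i; linarith)
  have hP2 := hP.comp (tendsto_id.const_mul_atTop' (show 0 < 2 by norm_num))
  have hQ := (hasProd_one_add_pow h0 h1 1).tendsto_prod_nat
  have hQ0 := tprod_one_add_pow_ne_zero h0 h1 1
  have hlim := hP2.div (hQ.mul hP) (mul_ne_zero hQ0 hP0)
  have hval : (∏' i : ℕ, (1 + -q ^ (1 + i))) /
      ((∏' i : ℕ, (1 + q ^ (1 + i))) * ∏' i : ℕ, (1 + -q ^ (1 + i))) = malleConst q 0 := by
    have h2 : malleConst q 0 = (∏' i : ℕ, (1 + q ^ (1 + i)))⁻¹ := (hasProd_malleConst h0 h1 0).tprod_eq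
    rw [h2]
    field_simp
  rw [hval] at hlim
  refine hlim.congr fun k => ?_
  rw [Pi.div_apply, div_eq_iff (hne k), hfin]
  rfl

theorem tendsto_of_even_odd {α : Type*} {f : ℕ → α} {l : Filter α}
    (he : Tendsto (fun k => f (2 * k)) atTop l) (ho : Tendsto (fun k => f (2 * k + 1)) atTop l) :
    Tendsto f atTop l := by
  intro s hs
  obtain ⟨a, ha⟩ := eventually_atTop.1 (he hs)
  obtain ⟨b, hb⟩ := eventually_atTop.1 (ho hs)
  refine eventually_atTop.2 ⟨2 * (a + b), fun n hn => ?_⟩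
  rcases Nat.even_or_odd' n with ⟨k, rfl | rfl⟩
  · exact ha k (by omega)
  · exact hb k (by omega)

theorem tendsto_symInvProb (F : Type*) [Field F] [Finite F] :
    Tendsto (symInvProb F) atTop (𝓝 (malleConst (Nat.card F : ℝ)⁻¹ 0)) := by
  have hF : 1 < Nat.card F := Finite.one_lt_card
  have hF' : (1 : ℝ) < Nat.card F := by exact_mod_cast hF
  have h0 : 0 ≤ (Nat.card F : ℝ)⁻¹ := by positivity
  have h1 : (Nat.card F : ℝ)⁻¹ < 1 := inv_lt_one_of_one_lt₀ hF'
  have h := tendsto_prod_one_sub_odd h0 h1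
  refine tendsto_of_even_odd ?_ ?_
  · exact h.congr fun k => (symInvProb_even_odd F k).1.symm
  · exact (h.comp (tendsto_add_atTop_nat 1)).congr fun k => (symInvProb_even_odd F k).2.symm

end EulerProduct

/-! ### Equidistribution of random walks on finite abelian groups -/

section RandomWalk

open Filter Topology

/-- Two distinct unit vectors are not on the same ray, so already their sum is strictly shorter than
2. -/
theorem norm_sum_lt_of_ne {Ω : Type*} [Fintype Ω] (z : Ω → ℂ) (hz : ∀ i, ‖z i‖ = 1) {i j : Ω}
    (hij : z i ≠ z j) : ‖∑ k, z k‖ < Fintype.card Ω := by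
  classical
  have hne : i ≠ j := fun h => hij (h ▸ rfl)
  have hj : j ∈ Finset.univ.erase i := by simp [hne.symm]
  rw [← Finset.add_sum_erase _ _ (Finset.mem_univ i), ← Finset.add_sum_erase _ _ hj, ← add_assoc]
  have h1 : ‖z i + z j‖ < 2 := by
    have := norm_add_lt_of_not_sameRay (x := z i) (y := z j) (by
      rwa [sameRay_iff_of_norm_eq ((hz i).trans (hz j).symm)])
    rw [hz, hz] at this
    linarith
  have h2 : ‖∑ k ∈ (Finset.univ.erase i).erase j, z k‖ ≤
      (((Finset.univ.erase i).erase j).card : ℝ) := by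
    refine (norm_sum_le _ _).trans ?_
    simp [hz]
  have h3 : ((Finset.univ.erase i).erase j).card + 2 = Fintype.card Ω := by
    rw [Finset.card_erase_of_mem hj, Finset.card_erase_of_mem (Finset.mem_univ i),
      Finset.card_univ]
    have : 1 < Fintype.card Ω := Fintype.one_lt_card_iff.2 ⟨i, j, hne⟩
    omega
  have h4 := norm_add_le (z i + z j) (∑ k ∈ (Finset.univ.erase i).erase j, z k)
  have h5 : (((Finset.univ.erase i).erase j).card : ℝ) + 2 = Fintype.card Ω := by exact_mod_cast h3
  linarith

theorem AddChar.map_sum_eq_prod' {A ι : Type*} [AddCommGroup A] (χ : AddChar A ℂ) (s : Finset ι)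
    (f : ι → A) : χ (∑ k ∈ s, f k) = ∏ k ∈ s, χ (f k) := by
  classical
  induction s using Finset.induction_on with
  | empty => simp
  | insert a s ha ih => rw [Finset.sum_insert ha, Finset.prod_insert ha, AddChar.map_add_eq_mul, ih]

/-- A random walk on a finite abelian group whose steps include `0` and generate the group
equidistributes. -/
theorem tendsto_card_sum_eq {Ω A : Type*} [Finite Ω] [AddCommGroup A] [Finite A] (T : Ω → A)
    (h0 : ∃ x, T x = 0) (hgen : AddSubgroup.closure (Set.range T) = ⊤) (w : A) :
    Tendsto (fun g : ℕ => (Nat.card {x : Fin g → Ω // ∑ k, T (x k) = w} : ℝ) / Nat.card Ω ^ g)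
      atTop (𝓝 (1 / Nat.card A)) := by
  classical
  have := Fintype.ofFinite Ω
  have := Fintype.ofFinite A
  obtain ⟨x0, hx0⟩ := h0
  have : Nonempty Ω := ⟨x0⟩
  have hΩ : (Fintype.card Ω : ℂ) ≠ 0 := by exact_mod_cast Fintype.card_ne_zero
  have hA : (Fintype.card A : ℂ) ≠ 0 := by exact_mod_cast Fintype.card_ne_zero
  -- Fourier inversion: the indicator of a sum being w is the average of χ(sum - w) over all
  -- characters, and summing χ over Ω^g yields a g-th power.
  have key : ∀ g : ℕ, ((Nat.card {x : Fin g → Ω // ∑ k, T (x k) = w} : ℂ)) / Nat.card Ω ^ g =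
      (1 / Fintype.card A) * ∑ χ : AddChar A ℂ,
        χ (-w) * ((∑ x, χ (T x)) / Fintype.card Ω) ^ g := by
    intro g
    have h1 : ∀ x : Fin g → Ω, (if ∑ k, T (x k) = w then (1 : ℂ) else 0) =
        (1 / Fintype.card A) * ∑ χ : AddChar A ℂ, χ (-w) * ∏ k, χ (T (x k)) := by
      intro x
      have h2 : ∀ χ : AddChar A ℂ, χ (-w) * ∏ k, χ (T (x k)) = χ (∑ k, T (x k) - w) := by
        intro χ
        rw [sub_eq_neg_add, AddChar.map_add_eq_mul, AddChar.map_sum_eq_prod']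
      rw [Finset.sum_congr rfl fun χ _ => h2 χ, AddChar.sum_apply_eq_ite]
      simp only [sub_eq_zero]
      split_ifs
      · field_simp
      · simp
    rw [Nat.card_eq_fintype_card, Fintype.card_subtype, Finset.card_filter, Nat.cast_sum]
    simp only [Nat.cast_ite, Nat.cast_one, Nat.cast_zero, h1]
    rw [← Finset.mul_sum, Finset.sum_comm, mul_div_assoc, Finset.sum_div]
    congr 1
    refine Finset.sum_congr rfl fun χ _ => ?_
    rw [← Finset.mul_sum, div_pow, Fintype.sum_pow, Nat.card_eq_fintype_card, mul_div_assoc]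
  have hlim : Tendsto (fun g : ℕ => (1 / (Fintype.card A : ℂ)) * ∑ χ : AddChar A ℂ,
      χ (-w) * ((∑ x, χ (T x)) / Fintype.card Ω) ^ g) atTop
      (𝓝 ((1 / (Fintype.card A : ℂ)) * ∑ χ : AddChar A ℂ, if χ = 0 then 1 else 0)) := by
    refine Tendsto.const_mul _ (tendsto_finsetSum _ fun χ _ => ?_)
    split_ifs with hχ
    · subst hχ
      simp [hΩ]
    · rw [show (𝓝 (0 : ℂ)) = 𝓝 (χ (-w) * 0) by rw [mul_zero]]
      refine Tendsto.const_mul _ (tendsto_pow_atTop_nhds_zero_of_norm_lt_one ?_)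
      -- A nontrivial character cannot be 1 on all the steps, as these generate A. It is 1 at the
      -- step 0, so its values on the steps are not all equal and their mean has norm below 1.
      have hex : ∃ x, χ (T x) ≠ 1 := by
        by_contra! hall
        refine hχ (DFunLike.ext _ _ fun a => ?_)
        change χ a = 1
        have ha : a ∈ AddSubgroup.closure (Set.range T) := by rw [hgen]; trivial
        induction ha using AddSubgroup.closure_induction with
        | mem y hy => obtain ⟨x, rfl⟩ := hy; exact hall x
        | zero => simp
        | add y z _ _ hy hz => rw [AddChar.map_add_eq_mul, hy, hz]; simp
        | neg y _ hy => rw [AddChar.map_neg_eq_inv, hy]; simp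
      obtain ⟨x1, hx1⟩ := hex
      have hlt := norm_sum_lt_of_ne (fun x => χ (T x)) (fun x => AddChar.norm_apply _ _)
        (i := x1) (j := x0) (by rwa [hx0, AddChar.map_zero_eq_one])
      rw [norm_div, Complex.norm_natCast, div_lt_one (by exact_mod_cast Fintype.card_pos)]
      exact hlt
  have hfin := hlim.congr fun g => (key g).symm
  rw [Finset.sum_ite_eq' Finset.univ (0 : AddChar A ℂ) fun _ => (1 : ℂ)] at hfin
  simp only [Finset.mem_univ, if_true, mul_one] at hfin
  rw [← Nat.card_eq_fintype_card] at hfin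
  have h3 := (Complex.continuous_re.tendsto _).comp hfin
  convert h3 using 1
  · ext g
    simp only [Function.comp]
    rw [show ((Nat.card {x : Fin g → Ω // ∑ k, T (x k) = w} : ℂ)) / Nat.card Ω ^ g =
      (((Nat.card {x : Fin g → Ω // ∑ k, T (x k) = w} : ℝ) / Nat.card Ω ^ g : ℝ) : ℂ) by push_cast; rfl,
      Complex.ofReal_re]
  · rw [show (1 / (Nat.card A : ℂ)) = ((1 / Nat.card A : ℝ) : ℂ) by push_cast; rfl,
      Complex.ofReal_re]

end RandomWalk

/-! ### Finite abelian ℓ-groups as products of cyclic groups -/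

section CyclicProducts

/-- The finite abelian `ℓ`-group `∏ i, ℤ/ℓ^(lam i + 1)`, of rank `r`. -/
abbrev CycProd (ℓ : ℕ) {r : ℕ} (lam : Fin r → ℕ) := ∀ i : Fin r, ZMod (ℓ ^ (lam i + 1))

instance neZeroPow (ℓ k : ℕ) [Fact ℓ.Prime] : NeZero (ℓ ^ k) := ⟨ell_pow_ne_zero k⟩

theorem exists_equiv_cycProd (ℓ : ℕ) [Fact ℓ.Prime] (G : Type*) [AddCommGroup G] [Finite G]
    (hG : ∀ x : G, ∃ k : ℕ, ℓ ^ k • x = 0) :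
    ∃ (r : ℕ) (lam : Fin r → ℕ), Nonempty (G ≃+ CycProd ℓ lam) := by
  classical
  obtain ⟨ι, hι, n, hn, ⟨e⟩⟩ := AddCommGroup.equiv_directSum_zmod_of_finite' G
  have e' : G ≃+ ∀ i, ZMod (n i) := e.trans (DirectSum.addEquivProd _)
  have hpow : ∀ i, ∃ k, n i = ℓ ^ (k + 1) := by
    intro i
    obtain ⟨k, hk⟩ := hG (e'.symm (Pi.single i 1))
    have h1 : ℓ ^ k • (Pi.single i 1 : ∀ i, ZMod (n i)) = 0 := by
      rw [← e'.apply_symm_apply (Pi.single i 1), ← map_nsmul, hk, map_zero]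
    have h2 : ((ℓ ^ k : ℕ) : ZMod (n i)) = 0 := by
      have := congrFun h1 i
      simpa using this
    rw [ZMod.natCast_eq_zero_iff, Nat.dvd_prime_pow Fact.out] at h2
    obtain ⟨m, -, hm⟩ := h2
    cases m with
    | zero => have := hn i; simp [hm] at this
    | succ m => exact ⟨m, hm⟩
  choose k hk using hpow
  obtain rfl : n = fun i => ℓ ^ (k i + 1) := funext hk
  let s := (Fintype.equivFin ι).symm
  exact ⟨Fintype.card ι, fun j => k (s j),
    ⟨e'.trans (RingEquiv.piCongrLeft (fun i => ZMod (ℓ ^ (k i + 1))) s).symm.toAddEquiv⟩⟩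

/-- Homomorphisms to ℤ/ℓ factor through G/ℓG, so their number determines the rank. Ranks are
computed below by counting them. -/
theorem card_hom_zmod (ℓ : ℕ) [Fact ℓ.Prime] (G : Type*) [AddCommGroup G] [Finite G] :
    Nat.card (G →+ ZMod ℓ) = ℓ ^ ellRank ℓ G := by
  have hfin : Finite (ModN G ℓ) := Quotient.finite _
  have e : (ModN G ℓ →ₗ[ZMod ℓ] ZMod ℓ) ≃ (G →+ ZMod ℓ) :=
    ModN.liftEquiv'.trans (Equiv.subtypeUnivEquiv fun φ g => by simp)
  rw [← Nat.card_congr e, ellRank, ← Subspace.dual_finrank_eq,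
    Module.natCard_eq_pow_finrank (K := ZMod ℓ), Nat.card_zmod]

theorem ellRank_congr (ℓ : ℕ) [hl : Fact ℓ.Prime] {G H : Type*} [AddCommGroup G] [AddCommGroup H]
    [Finite G] [Finite H] (e : G ≃+ H) : ellRank ℓ G = ellRank ℓ H := by
  have h : Nat.card (G →+ ZMod ℓ) = Nat.card (H →+ ZMod ℓ) :=
    Nat.card_congr (AddEquiv.addMonoidHomCongrLeft e).toEquiv
  rw [card_hom_zmod, card_hom_zmod] at h
  exact Nat.pow_right_injective hl.out.two_le h

variable {ℓ : ℕ} {r : ℕ} {lam : Fin r → ℕ}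

theorem cycProd_hom_ext [Fact ℓ.Prime] {A : Type*} [AddCommMonoid A] {f f' : CycProd ℓ lam →+ A}
    (h : ∀ i, f (Pi.single i 1) = f' (Pi.single i 1)) : f = f' := by
  refine AddMonoidHom.functions_ext _ _ _ fun i x => ?_
  have h1 : (f.comp (AddMonoidHom.single _ i)) = f'.comp (AddMonoidHom.single _ i) := by
    ext c
    obtain ⟨n, rfl⟩ := ZMod.natCast_zmod_surjective c
    rw [← nsmul_one, map_nsmul, map_nsmul]
    exact congrArg _ (h i)
  exact DFunLike.congr_fun h1 x

theorem card_hom_cycProd [Fact ℓ.Prime] (lam : Fin r → ℕ) :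
    Nat.card (CycProd ℓ lam →+ ZMod ℓ) = ℓ ^ r := by
  have hd : ∀ i, ℓ ∣ ℓ ^ (lam i + 1) := fun i => dvd_pow_self _ (by omega)
  let e : (CycProd ℓ lam →+ ZMod ℓ) ≃ (Fin r → ZMod ℓ) :=
    { toFun := fun f i => f (Pi.single i 1)
      invFun := fun c =>
        ∑ i, (AddMonoidHom.mulLeft (c i)).comp
          ((ZMod.castHom (hd i) (ZMod ℓ)).toAddMonoidHom.comp (Pi.evalAddMonoidHom _ i))
      left_inv := fun f => by
        refine cycProd_hom_ext fun i => ?_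
        rw [AddMonoidHom.finsetSum_apply, Finset.sum_eq_single i]
        · simp
        · intro j _ hj
          simp [hj]
        · simp
      right_inv := fun c => by
        ext i
        change (∑ i, _ : CycProd ℓ lam →+ ZMod ℓ) _ = _
        rw [AddMonoidHom.finsetSum_apply, Finset.sum_eq_single i]
        · simp
        · intro j _ hj
          simp [hj]
        · simp }
  rw [Nat.card_congr e]
  simp

theorem ellRank_cycProd [hl : Fact ℓ.Prime] (lam : Fin r → ℕ) : ellRank ℓ (CycProd ℓ lam) = r := by
  have h := card_hom_zmod ℓ (CycProd ℓ lam)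
  rw [card_hom_cycProd] at h
  exact (Nat.pow_right_injective hl.out.two_le h).symm

theorem card_cycProd [Fact ℓ.Prime] (lam : Fin r → ℕ) :
    Nat.card (CycProd ℓ lam) = ∏ i, ℓ ^ (lam i + 1) := by
  simp

end CyclicProducts

/-! ### Homomorphisms from ℤ_ℓ and its powers -/

section PadicHoms

variable {ℓ : ℕ} [Fact ℓ.Prime]

/-- No continuity is needed: an additive map into a group killed by ℓ^k kills ℓ^k ℤ_ℓ, and modulo
ℓ^k every element is an integer. -/
theorem padicInt_hom_apply {H : Type*} [AddCommGroup H] {k : ℕ} (hH : ∀ h : H, ℓ ^ k • h = 0)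
    (f : ℤ_[ℓ] →+ H) (c : ℤ_[ℓ]) : f c = c.appr k • f 1 := by
  obtain ⟨y, hy⟩ := toZModPow_eq_zero.1 (show PadicInt.toZModPow k (c - (c.appr k : ℤ_[ℓ])) = 0 by
    rw [← RingHom.mem_ker, PadicInt.ker_toZModPow]; exact PadicInt.appr_spec k c)
  have hc : c = c.appr k • (1 : ℤ_[ℓ]) + ℓ ^ k • y := by
    rw [nsmul_eq_mul, nsmul_eq_mul, mul_one, Nat.cast_pow, ← hy]
    ring
  conv_lhs => rw [hc, map_add, map_nsmul, map_nsmul, hH, add_zero]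

theorem padicInt_hom_ext {H : Type*} [AddCommGroup H] (hH : ∃ k, ∀ h : H, ℓ ^ k • h = 0)
    {f f' : ℤ_[ℓ] →+ H} (h : f 1 = f' 1) : f = f' := by
  obtain ⟨k, hk⟩ := hH
  ext c
  rw [padicInt_hom_apply hk, padicInt_hom_apply hk f', h]

theorem exists_pow_nsmul_eq_zero {H : Type*} [AddCommGroup H] [Finite H]
    (hH : ∀ x : H, ∃ k : ℕ, ℓ ^ k • x = 0) : ∃ k, ∀ h : H, ℓ ^ k • h = 0 := by
  classical
  have := Fintype.ofFinite H
  choose k hk using hH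
  refine ⟨∑ h, k h, fun h => ?_⟩
  rw [← Finset.sum_erase_add _ _ (Finset.mem_univ h), pow_add, mul_nsmul', hk, nsmul_zero]

/-- The homomorphism `ℤ_ℓ → H` with a given value at `1`. -/
theorem exists_padicInt_hom {H : Type*} [AddCommGroup H] (hH : ∃ k, ∀ h : H, ℓ ^ k • h = 0)
    (x : H) : ∃ f : ℤ_[ℓ] →+ H, f 1 = x := by
  obtain ⟨k, hk⟩ := hH
  refine ⟨(ZMod.lift (ℓ ^ k) ⟨zmultiplesHom H x, by
      rw [zmultiplesHom_apply, natCast_zsmul]; exact hk x⟩).comp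
    (PadicInt.toZModPow k).toAddMonoidHom, ?_⟩
  have : ((1 : ℤ) : ZMod (ℓ ^ k)) = 1 := by simp
  simp only [AddMonoidHom.comp_apply, RingHom.toAddMonoidHom_eq_coe, AddMonoidHom.coe_coe, map_one]
  rw [← this, ZMod.lift_coe]
  simp

theorem range_padicInt_hom {H : Type*} [AddCommGroup H] (hH : ∃ k, ∀ h : H, ℓ ^ k • h = 0)
    (f : ℤ_[ℓ] →+ H) : f.range = AddSubgroup.zmultiples (f 1) := by
  obtain ⟨k, hk⟩ := hH
  apply le_antisymm
  · rintro _ ⟨c, rfl⟩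
    rw [padicInt_hom_apply hk f c]
    exact ⟨(c.appr k : ℤ), natCast_zsmul (f 1) _⟩
  · rintro _ ⟨n, rfl⟩
    exact ⟨n • 1, map_zsmul f n 1⟩

variable {r : ℕ} {lam : Fin r → ℕ} {I : Type*} [Fintype I]

theorem cycProd_torsion (lam : Fin r → ℕ) : ∃ k, ∀ h : CycProd ℓ lam, ℓ ^ k • h = 0 := by
  refine ⟨∑ i, (lam i + 1), fun h => ?_⟩
  ext i
  have h1 := Finset.sum_erase_add Finset.univ (fun i => lam i + 1) (Finset.mem_univ i)
  change ℓ ^ (∑ i, (lam i + 1)) • h i = 0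
  have h2 : ℓ ^ (lam i + 1) • h i = 0 := by simp
  have h3 : ℓ ^ (∑ i, (lam i + 1)) =
      ℓ ^ (∑ i ∈ Finset.univ.erase i, (lam i + 1)) * ℓ ^ (lam i + 1) := by rw [← pow_add, h1]
  simp only [h3, mul_nsmul', h2, nsmul_zero]

/-- The homomorphism `ℤ_ℓ^I → G` given by a tuple of elements of `G`. -/
noncomputable def tupleHom (x : I → CycProd ℓ lam) : (I → ℤ_[ℓ]) →+ CycProd ℓ lam where
  toFun v i := ∑ k, PadicInt.toZModPow (lam i + 1) (v k) * x k i
  map_zero' := by ext; simp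
  map_add' v w := by ext; simp [add_mul, Finset.sum_add_distrib]

theorem tupleHom_apply (x : I → CycProd ℓ lam) (v : I → ℤ_[ℓ]) (i : Fin r) :
    tupleHom x v i = ∑ k, PadicInt.toZModPow (lam i + 1) (v k) * x k i := rfl

variable [DecidableEq I]

theorem tupleHom_single (x : I → CycProd ℓ lam) (k : I) : tupleHom x (Pi.single k 1) = x k := by
  ext i
  rw [tupleHom_apply, Finset.sum_eq_single k]
  · simp
  · intro j _ hj
    simp [Pi.single_eq_of_ne hj]
  · simp

theorem pi_padicInt_hom_ext {H : Type*} [AddCommGroup H] (hH : ∃ k, ∀ h : H, ℓ ^ k • h = 0)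
    {f f' : (I → ℤ_[ℓ]) →+ H} (h : ∀ k, f (Pi.single k 1) = f' (Pi.single k 1)) : f = f' := by
  refine AddMonoidHom.functions_ext _ _ _ fun k c => ?_
  exact DFunLike.congr_fun (padicInt_hom_ext hH
    (f := f.comp (AddMonoidHom.single (fun _ : I => ℤ_[ℓ]) k))
    (f' := f'.comp (AddMonoidHom.single (fun _ : I => ℤ_[ℓ]) k)) (h k)) c

theorem eq_tupleHom (f : (I → ℤ_[ℓ]) →+ CycProd ℓ lam) :
    f = tupleHom fun k => f (Pi.single k 1) :=
  pi_padicInt_hom_ext (cycProd_torsion lam) fun k => by rw [tupleHom_single]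

end PadicHoms

/-! ### Elements with prescribed quotient and lifts of generators -/

section CyclicExtensions

variable {ℓ : ℕ} {r : ℕ}

/-- `x` has order `ℓ^k`, and `h` induces an isomorphism from `∏ i, ℤ/ℓ^(lam i + 1)` to the
quotient by `x`. -/
structure IsExtData (ℓ : ℕ) {r : ℕ} (lam : Fin r → ℕ) (k : ℕ) {H : Type*} [AddCommGroup H]
    (x : H) (h : Fin r → H) : Prop where
  order : addOrderOf x = ℓ ^ k
  mem_iff : ∀ n : Fin r → ℤ, ∑ i, n i • h i ∈ AddSubgroup.zmultiples x ↔
    ∀ i, ((ℓ ^ (lam i + 1) : ℕ) : ℤ) ∣ n i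
  gen : ∀ y : H, ∃ n : Fin r → ℤ, y - ∑ i, n i • h i ∈ AddSubgroup.zmultiples x

/-- The elements of `K` that form a standard basis of `K ≃ ∏ i, ℤ/ℓ^(lam i + 1)`. -/
structure IsCycBasis (ℓ : ℕ) {r : ℕ} (lam : Fin r → ℕ) {K : Type*} [AddCommGroup K]
    (h : Fin r → K) : Prop where
  eq_zero_iff : ∀ n : Fin r → ℤ, ∑ i, n i • h i = 0 ↔ ∀ i, ((ℓ ^ (lam i + 1) : ℕ) : ℤ) ∣ n i
  gen : ∀ y : K, ∃ n : Fin r → ℤ, y = ∑ i, n i • h i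

theorem cycProd_eq_sum {lam : Fin r → ℕ} (n : Fin r → ℤ) :
    (∑ i, n i • Pi.single i 1 : CycProd ℓ lam) = fun i => (n i : ZMod (ℓ ^ (lam i + 1))) := by
  ext i
  rw [Finset.sum_apply, Finset.sum_eq_single i]
  · simp
  · intro j _ hj
    simp [Pi.single_eq_of_ne hj.symm]
  · simp

theorem isCycBasis_single (lam : Fin r → ℕ) :
    IsCycBasis ℓ lam (fun i => (Pi.single i 1 : CycProd ℓ lam)) where
  eq_zero_iff n := by
    rw [cycProd_eq_sum, funext_iff]
    exact forall_congr' fun i => ZMod.intCast_zmod_eq_zero_iff_dvd _ _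
  gen y := by
    choose n hn using fun i => ZMod.intCast_surjective (y i)
    exact ⟨n, by rw [cycProd_eq_sum]; exact (funext hn).symm⟩

theorem IsCycBasis.map {lam : Fin r → ℕ} {K K' : Type*} [AddCommGroup K] [AddCommGroup K']
    {h : Fin r → K} (hh : IsCycBasis ℓ lam h) (e : K ≃+ K') :
    IsCycBasis ℓ lam (fun i => e (h i)) where
  eq_zero_iff n := by
    rw [← hh.eq_zero_iff, ← map_eq_zero_iff e e.injective, map_sum]
    simp only [map_zsmul]
  gen y := by
    obtain ⟨n, hn⟩ := hh.gen (e.symm y)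
    refine ⟨n, ?_⟩
    rw [← e.apply_symm_apply y, hn, map_sum]
    simp only [map_zsmul]

theorem IsCycBasis.exists_equiv {lam : Fin r → ℕ} {K : Type*} [AddCommGroup K]
    {h : Fin r → K} (hh : IsCycBasis ℓ lam h) :
    ∃ e : CycProd ℓ lam ≃+ K, ∀ i, e (Pi.single i 1) = h i := by
  have hz : ∀ i, zmultiplesHom K (h i) ((ℓ ^ (lam i + 1) : ℕ) : ℤ) = 0 := by
    intro i
    have := (hh.eq_zero_iff (Pi.single i ((ℓ ^ (lam i + 1) : ℕ) : ℤ))).2 (by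
      intro j
      by_cases hj : j = i
      · subst hj; simp
      · simp [hj])
    rw [Finset.sum_eq_single i] at this
    · simpa using this
    · intro j _ hj
      simp [hj]
    · simp
  let f : CycProd ℓ lam →+ K :=
    ∑ i, (ZMod.lift _ ⟨zmultiplesHom K (h i), hz i⟩).comp (Pi.evalAddMonoidHom _ i)
  have hf : ∀ n : Fin r → ℤ, f (fun i => (n i : ZMod (ℓ ^ (lam i + 1)))) = ∑ i, n i • h i := by
    intro n
    rw [AddMonoidHom.finsetSum_apply]
    refine Finset.sum_congr rfl fun i _ => ?_
    simp [ZMod.lift_coe]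
  have hinj : Function.Injective f := by
    rw [injective_iff_map_eq_zero]
    intro y hy
    choose n hn using fun i => ZMod.intCast_surjective (y i)
    obtain rfl : (fun i => (n i : ZMod (ℓ ^ (lam i + 1)))) = y := funext hn
    rw [hf, hh.eq_zero_iff] at hy
    ext i
    exact (ZMod.intCast_zmod_eq_zero_iff_dvd _ _).2 (hy i)
  have hsurj : Function.Surjective f := fun y => by
    obtain ⟨n, hn⟩ := hh.gen y
    exact ⟨_, (hf n).trans hn.symm⟩
  refine ⟨AddEquiv.ofBijective f ⟨hinj, hsurj⟩, fun i => ?_⟩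
  change f _ = _
  have h1 : (Pi.single i 1 : CycProd ℓ lam) =
      fun j => (((Pi.single i 1 : Fin r → ℤ) j : ℤ) : ZMod (ℓ ^ (lam j + 1))) := by
    ext j
    by_cases hj : j = i
    · subst hj; simp
    · simp [Pi.single_eq_of_ne hj]
  rw [h1, hf, Finset.sum_eq_single i]
  · simp
  · intro j _ hj
    simp [hj]
  · simp

variable [Fact ℓ.Prime]

theorem card_isCycBasis (lam : Fin r → ℕ) (K : Type*) [AddCommGroup K] :
    Nat.card {h : Fin r → K // IsCycBasis ℓ lam h} = Nat.card (CycProd ℓ lam ≃+ K) := by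
  symm
  refine Nat.card_congr (Equiv.ofBijective
    (fun e => ⟨fun i => e (Pi.single i 1), (isCycBasis_single lam).map e⟩) ⟨?_, ?_⟩)
  · intro e e' h
    have : e.toAddMonoidHom = e'.toAddMonoidHom :=
      cycProd_hom_ext fun i => congrFun (congrArg Subtype.val h) i
    ext y
    exact DFunLike.congr_fun this y
  · rintro ⟨h, hh⟩
    obtain ⟨e, he⟩ := hh.exists_equiv
    exact ⟨e, Subtype.ext (funext he)⟩

variable {lam : Fin r → ℕ} {k : ℕ}

theorem isExtData_iff {H : Type*} [AddCommGroup H] {x : H} (hx : addOrderOf x = ℓ ^ k)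
    (h : Fin r → H) : IsExtData ℓ lam k x h ↔
      IsCycBasis ℓ lam (fun i => (h i : H ⧸ AddSubgroup.zmultiples x)) := by
  have hs : ∀ n : Fin r → ℤ, (∑ i, n i • (h i : H ⧸ AddSubgroup.zmultiples x)) =
      ((∑ i, n i • h i : H) : H ⧸ AddSubgroup.zmultiples x) := fun n => by
    rw [← QuotientAddGroup.mk'_apply, map_sum]
    rfl
  constructor
  · intro hh
    refine ⟨fun n => ?_, fun y => ?_⟩
    · rw [hs, QuotientAddGroup.eq_zero_iff]
      exact hh.mem_iff n
    · obtain ⟨y, rfl⟩ := QuotientAddGroup.mk_surjective y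
      obtain ⟨n, hn⟩ := hh.gen y
      refine ⟨n, ?_⟩
      rw [hs, ← sub_eq_zero, ← QuotientAddGroup.mk_sub, QuotientAddGroup.eq_zero_iff]
      exact hn
  · intro hh
    refine ⟨hx, fun n => ?_, fun y => ?_⟩
    · rw [← hh.eq_zero_iff, hs, QuotientAddGroup.eq_zero_iff]
    · obtain ⟨n, hn⟩ := hh.gen y
      refine ⟨n, ?_⟩
      rwa [hs, ← sub_eq_zero, ← QuotientAddGroup.mk_sub, QuotientAddGroup.eq_zero_iff] at hn

/-- Given x, extension data are a standard basis of H/⟨x⟩, that is an isomorphism from the product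
of cyclic groups, with a choice of one of ℓ^k lifts for each of the r basis elements. -/
theorem card_isExtData_fiber {H : Type*} [AddCommGroup H] {x : H} (hx : addOrderOf x = ℓ ^ k)
    (lam : Fin r → ℕ) : Nat.card {h : Fin r → H // IsExtData ℓ lam k x h} =
      Nat.card (CycProd ℓ lam ≃+ H ⧸ AddSubgroup.zmultiples x) * ℓ ^ (k * r) := by
  let N := AddSubgroup.zmultiples x
  -- Only a bijection of sets; all that matters is that its first component is the quotient map.
  let s : H ≃ (H ⧸ N) × N := AddSubgroup.addGroupEquivQuotientProdAddSubgroup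
  have hs : ∀ y, (s y).1 = (y : H ⧸ N) := fun y => rfl
  let E : (Fin r → H) ≃ (Fin r → H ⧸ N) × (Fin r → N) :=
    (Equiv.arrowCongr (Equiv.refl _) s).trans (Equiv.arrowProdEquivProdArrow _ _ _)
  have e : {h : Fin r → H // IsExtData ℓ lam k x h} ≃
      {h : Fin r → H ⧸ N // IsCycBasis ℓ lam h} × (Fin r → N) :=
    (Equiv.subtypeEquiv E (q := fun p => IsCycBasis ℓ lam p.1) fun h => isExtData_iff hx h).trans
    { toFun := fun p => (⟨p.1.1, p.2⟩, p.1.2)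
      invFun := fun p => ⟨(p.1.1, p.2), p.1.2⟩
      left_inv := fun p => rfl
      right_inv := fun p => rfl }
  have hN : Nat.card N = ℓ ^ k := by rw [Nat.card_zmultiples, hx]
  rw [Nat.card_congr e, Nat.card_prod, card_isCycBasis, Nat.card_fun, hN, Nat.card_fin, pow_mul]

end CyclicExtensions

/-! ### Models of the extensions by a cyclic group -/

section CyclicExtensionModels

variable {ℓ : ℕ} {r : ℕ}

/-- The relations `ℓ^(lam i + 1) e_i = a_i x`. -/
def extRel (ℓ : ℕ) {r : ℕ} (lam : Fin r → ℕ) {k : ℕ} (a : Fin r → ZMod (ℓ ^ k)) :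
    (Fin r → ℤ) →+ (Fin r → ℤ) × ZMod (ℓ ^ k) where
  toFun n := (fun i => ((ℓ ^ (lam i + 1) : ℕ) : ℤ) * n i, -∑ i, n i • a i)
  map_zero' := by ext <;> simp
  map_add' n m := by
    ext
    · simp [mul_add]
    · simp [add_mul, Finset.sum_add_distrib, add_comm]

/-- The extension of `∏ i, ℤ/ℓ^(lam i + 1)` by a cyclic group of order `ℓ^k` with parameters
`a`. -/
abbrev CycExt (ℓ : ℕ) {r : ℕ} (lam : Fin r → ℕ) {k : ℕ} (a : Fin r → ZMod (ℓ ^ k)) :=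
  ((Fin r → ℤ) × ZMod (ℓ ^ k)) ⧸ (extRel ℓ lam a).range

/-- The generator of the cyclic subgroup of `CycExt`. -/
def cycExtGen (ℓ : ℕ) {r : ℕ} (lam : Fin r → ℕ) {k : ℕ} (a : Fin r → ZMod (ℓ ^ k)) :
    CycExt ℓ lam a := QuotientAddGroup.mk (0, 1)

/-- The lifts of the standard generators to `CycExt`. -/
def cycExtBasis (ℓ : ℕ) {r : ℕ} (lam : Fin r → ℕ) {k : ℕ} (a : Fin r → ZMod (ℓ ^ k))
    (i : Fin r) : CycExt ℓ lam a := QuotientAddGroup.mk (Pi.single i 1, 0)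

variable [hl : Fact ℓ.Prime] {lam : Fin r → ℕ} {k : ℕ} {a : Fin r → ZMod (ℓ ^ k)}

theorem cycExt_mk_eq (n : Fin r → ℤ) (m : ℤ) :
    (QuotientAddGroup.mk (n, (m : ZMod (ℓ ^ k))) : CycExt ℓ lam a) =
      ∑ i, n i • cycExtBasis ℓ lam a i + m • cycExtGen ℓ lam a := by
  have h : ((n, (m : ZMod (ℓ ^ k))) : (Fin r → ℤ) × ZMod (ℓ ^ k)) =
      ∑ i, n i • (Pi.single i 1, 0) + m • (0, 1) := by
    ext
    · simp [Prod.fst_sum, Finset.sum_apply, Pi.single_apply]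
    · simp [Prod.snd_sum]
  rw [h, QuotientAddGroup.mk_add, ← QuotientAddGroup.mk'_apply, map_sum]
  rfl

theorem cycExt_induction {P : CycExt ℓ lam a → Prop}
    (h : ∀ (n : Fin r → ℤ) (m : ℤ), P (∑ i, n i • cycExtBasis ℓ lam a i + m • cycExtGen ℓ lam a))
    (y : CycExt ℓ lam a) : P y := by
  obtain ⟨⟨n, c⟩, rfl⟩ := QuotientAddGroup.mk_surjective y
  obtain ⟨m, rfl⟩ := ZMod.intCast_surjective c
  rw [cycExt_mk_eq]
  exact h n m

theorem cycExt_eq_zero_iff (n : Fin r → ℤ) (m : ℤ) :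
    ∑ i, n i • cycExtBasis ℓ lam a i + m • cycExtGen ℓ lam a = 0 ↔
      ∃ d : Fin r → ℤ, (∀ i, n i = ((ℓ ^ (lam i + 1) : ℕ) : ℤ) * d i) ∧
        (m : ZMod (ℓ ^ k)) = -∑ i, d i • a i := by
  rw [← cycExt_mk_eq, QuotientAddGroup.eq_zero_iff]
  constructor
  · rintro ⟨d, hd⟩
    exact ⟨d, fun i => (congrFun (congrArg Prod.fst hd) i).symm, (congrArg Prod.snd hd).symm⟩
  · rintro ⟨d, h1, h2⟩
    exact ⟨d, Prod.ext (funext fun i => (h1 i).symm) h2.symm⟩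

/-- A relation with vanishing integer part comes from d = 0, because ℤ has no torsion; hence the
relations impose nothing new on the cyclic subgroup. -/
theorem zsmul_cycExtGen_eq_zero_iff (m : ℤ) :
    m • cycExtGen ℓ lam a = 0 ↔ ((ℓ ^ k : ℕ) : ℤ) ∣ m := by
  have h := cycExt_eq_zero_iff (lam := lam) (a := a) 0 m
  simp only [Pi.zero_apply, zero_smul, Finset.sum_const_zero, zero_add] at h
  rw [h, ← ZMod.intCast_zmod_eq_zero_iff_dvd]
  constructor
  · rintro ⟨d, h1, h2⟩
    have hd : ∀ i, d i = 0 := fun i => by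
      have hne : ((ℓ ^ (lam i + 1) : ℕ) : ℤ) ≠ 0 := by exact_mod_cast ell_pow_ne_zero (ℓ := ℓ) _
      exact (mul_eq_zero.1 (h1 i).symm).resolve_left hne
    rw [h2]
    simp [hd]
  · intro h0
    exact ⟨0, by simp, by simp [h0]⟩

theorem isExtData_cycExt (a : Fin r → ZMod (ℓ ^ k)) :
    IsExtData ℓ lam k (cycExtGen ℓ lam a) (cycExtBasis ℓ lam a) where
  order := by
    refine Nat.dvd_antisymm ?_ ?_
    · rw [addOrderOf_dvd_iff_nsmul_eq_zero, ← natCast_zsmul, zsmul_cycExtGen_eq_zero_iff]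
    · have h := addOrderOf_nsmul_eq_zero (cycExtGen ℓ lam a)
      rw [← natCast_zsmul, zsmul_cycExtGen_eq_zero_iff] at h
      exact_mod_cast h
  mem_iff n := by
    constructor
    · rintro ⟨m, hm⟩
      have h : ∑ i, n i • cycExtBasis ℓ lam a i + (-m) • cycExtGen ℓ lam a = 0 := by
        rw [← hm]; simp
      obtain ⟨d, h1, -⟩ := (cycExt_eq_zero_iff _ _).1 h
      exact fun i => ⟨d i, h1 i⟩
    · intro h
      choose d hd using h
      obtain ⟨m, hm⟩ := ZMod.intCast_surjective (-∑ i, d i • a i)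
      have h0 := (cycExt_eq_zero_iff (lam := lam) (a := a) n m).2 ⟨d, hd, hm⟩
      refine ⟨-m, ?_⟩
      change (-m) • cycExtGen ℓ lam a = _
      rw [eq_neg_of_add_eq_zero_left h0, neg_smul]
  gen y := by
    induction y using cycExt_induction with
    | h n m => exact ⟨n, m, by simp⟩

theorem IsExtData.map {H H' : Type*} [AddCommGroup H] [AddCommGroup H'] {x : H} {h : Fin r → H}
    (hh : IsExtData ℓ lam k x h) (e : H ≃+ H') : IsExtData ℓ lam k (e x) (fun i => e (h i)) where
  order := by rw [← hh.order]; exact addOrderOf_injective e.toAddMonoidHom e.injective x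
  mem_iff n := by
    rw [← hh.mem_iff]
    have hs : ∑ i, n i • e (h i) = e (∑ i, n i • h i) := by simp [map_sum]
    rw [hs]
    constructor
    · rintro ⟨m, hm⟩
      exact ⟨m, e.injective (by rw [← hm]; exact map_zsmul e m x)⟩
    · rintro ⟨m, hm⟩
      exact ⟨m, by rw [← hm]; exact (map_zsmul e m x).symm⟩
  gen y := by
    obtain ⟨n, m, hm⟩ := hh.gen (e.symm y)
    refine ⟨n, m, ?_⟩
    have h1 := congrArg e hm
    rw [map_sub, map_sum, e.apply_symm_apply] at h1
    simp only [map_zsmul] at h1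
    exact h1

theorem pow_smul_cycExtBasis (m : Fin r → ℤ) (hm : ∀ i, (m i : ZMod (ℓ ^ k)) = a i) (i : Fin r) :
    ((ℓ ^ (lam i + 1) : ℕ) : ℤ) • cycExtBasis ℓ lam a i = m i • cycExtGen ℓ lam a := by
  have h := (cycExt_eq_zero_iff (lam := lam) (a := a)
    (Pi.single i ((ℓ ^ (lam i + 1) : ℕ) : ℤ)) (-(m i))).2 ⟨Pi.single i 1, fun j => ?_, ?_⟩
  · rw [Finset.sum_eq_single i] at h
    · rw [Pi.single_eq_same, neg_smul] at h
      exact add_neg_eq_zero.1 h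
    · intro j _ hj
      simp [hj]
    · simp
  · by_cases hj : j = i
    · subst hj; simp
    · simp [hj]
  · rw [Finset.sum_eq_single i]
    · simp [hm]
    · intro j _ hj
      simp [hj]
    · simp

theorem cycExt_equiv_ext {H : Type*} [AddCommGroup H] {e e' : CycExt ℓ lam a ≃+ H}
    (h1 : e (cycExtGen ℓ lam a) = e' (cycExtGen ℓ lam a))
    (h2 : ∀ i, e (cycExtBasis ℓ lam a i) = e' (cycExtBasis ℓ lam a i)) : e = e' := by
  ext y
  induction y using cycExt_induction with
  | h n m => simp only [map_add, map_sum, map_zsmul, h1, h2]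

theorem zsmul_eq_of_cast_eq {H : Type*} [AddCommGroup H] {x : H} (hx : addOrderOf x = ℓ ^ k)
    {m m' : ℤ} : m • x = m' • x ↔ (m : ZMod (ℓ ^ k)) = m' := by
  rw [← sub_eq_zero, ← sub_smul, ← addOrderOf_dvd_iff_zsmul_eq_zero, hx,
    ← ZMod.intCast_zmod_eq_zero_iff_dvd, Int.cast_sub, sub_eq_zero]

/-- The parameter a is read off from ℓ^(lam i + 1) h_i, which lies in the subgroup generated by x.
-/
theorem IsExtData.exists_equiv {H : Type*} [AddCommGroup H] {x : H} {h : Fin r → H}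
    (hh : IsExtData ℓ lam k x h) : ∃ (a : Fin r → ZMod (ℓ ^ k)) (e : CycExt ℓ lam a ≃+ H),
      e (cycExtGen ℓ lam a) = x ∧ ∀ i, e (cycExtBasis ℓ lam a i) = h i := by
  have hm : ∀ i, ∃ m : ℤ, m • x = ((ℓ ^ (lam i + 1) : ℕ) : ℤ) • h i := by
    intro i
    have := (hh.mem_iff (Pi.single i ((ℓ ^ (lam i + 1) : ℕ) : ℤ))).2 (by
      intro j
      by_cases hj : j = i
      · subst hj; simp
      · simp [hj])
    rw [Finset.sum_eq_single i] at this
    · simpa using AddSubgroup.mem_zmultiples_iff.1 this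
    · intro j _ hj
      simp [hj]
    · simp
  choose m hm using hm
  let a : Fin r → ZMod (ℓ ^ k) := fun i => m i
  have hx0 : zmultiplesHom H x ((ℓ ^ k : ℕ) : ℤ) = 0 := by
    rw [zmultiplesHom_apply, natCast_zsmul, ← hh.order, addOrderOf_nsmul_eq_zero]
  let F : (Fin r → ℤ) × ZMod (ℓ ^ k) →+ H :=
    AddMonoidHom.coprod (∑ i, (zmultiplesHom H (h i)).comp (Pi.evalAddMonoidHom _ i))
      (ZMod.lift _ ⟨zmultiplesHom H x, hx0⟩)
  have hF : ∀ (n : Fin r → ℤ) (c : ℤ), F (n, (c : ZMod (ℓ ^ k))) = ∑ i, n i • h i + c • x := by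
    intro n c
    rw [AddMonoidHom.coprod_apply, AddMonoidHom.finsetSum_apply]
    simp [ZMod.lift_coe]
  let f : CycExt ℓ lam a →+ H := QuotientAddGroup.lift _ F (by
    rintro _ ⟨d, rfl⟩
    have : extRel ℓ lam a d = (fun i => ((ℓ ^ (lam i + 1) : ℕ) : ℤ) * d i,
        ((-∑ i, d i * m i : ℤ) : ZMod (ℓ ^ k))) := by
      ext
      · rfl
      · simp [extRel, a]
    rw [this, AddMonoidHom.mem_ker, hF, neg_smul, Finset.sum_smul, ← sub_eq_add_neg, ← Finset.sum_sub_distrib]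
    refine Finset.sum_eq_zero fun i _ => ?_
    rw [mul_comm, mul_smul, ← hm, mul_smul, sub_self])
  have hf : ∀ (n : Fin r → ℤ) (c : ℤ),
      f (∑ i, n i • cycExtBasis ℓ lam a i + c • cycExtGen ℓ lam a) = ∑ i, n i • h i + c • x := by
    intro n c
    rw [← cycExt_mk_eq]
    exact hF n c
  have hinj : Function.Injective f := by
    rw [injective_iff_map_eq_zero]
    intro y
    induction y using cycExt_induction with
    | h n c =>
      intro hy
      rw [hf] at hy
      have h1 := (hh.mem_iff n).1 ⟨-c, by
        change (-c) • x = _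
        rw [eq_neg_of_add_eq_zero_left hy, neg_smul]⟩
      choose d hd using h1
      rw [cycExt_eq_zero_iff]
      refine ⟨d, hd, ?_⟩
      have h2 : ∑ i, n i • h i = (∑ i, d i * m i) • x := by
        rw [Finset.sum_smul]
        refine Finset.sum_congr rfl fun i _ => ?_
        rw [hd i, mul_comm, mul_smul, ← hm, mul_smul]
      rw [h2, ← eq_neg_iff_add_eq_zero, ← neg_smul, zsmul_eq_of_cast_eq hh.order] at hy
      have h3 : ((∑ i, d i * m i : ℤ) : ZMod (ℓ ^ k)) = ∑ i, d i • a i := by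
        simp [a]
      rw [← h3, hy]
      simp
  have hsurj : Function.Surjective f := fun y => by
    obtain ⟨n, c, hc⟩ := hh.gen y
    refine ⟨_, (hf n c).trans ?_⟩
    change c • x = _ at hc
    rw [hc]
    abel
  refine ⟨a, AddEquiv.ofBijective f ⟨hinj, hsurj⟩, ?_, fun i => ?_⟩
  · have := hf 0 1
    simp only [Pi.zero_apply, zero_smul, Finset.sum_const_zero, zero_add, one_smul] at this
    exact this
  · have := hf (Pi.single i 1) 0
    rw [Finset.sum_eq_single i, Finset.sum_eq_single i] at this
    · simp only [Pi.single_eq_same, zero_smul, add_zero, one_smul] at this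
      exact this
    all_goals simp +contextual

/-- An isomorphism from a model transports its standard extension data to H, and every extension
data arises from exactly one parameter and one isomorphism. This replaces the sum over isomorphism
types of extensions by a sum over parameters. -/
theorem card_sigma_cycExt_equiv (lam : Fin r → ℕ) (k : ℕ) (H : Type*) [AddCommGroup H] :
    Nat.card (Σ a : Fin r → ZMod (ℓ ^ k), CycExt ℓ lam a ≃+ H) =
      Nat.card {p : H × (Fin r → H) // IsExtData ℓ lam k p.1 p.2} := by
  refine Nat.card_congr (Equiv.ofBijective
    (fun p => ⟨(p.2 (cycExtGen ℓ lam p.1), fun i => p.2 (cycExtBasis ℓ lam p.1 i)),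
      (isExtData_cycExt p.1).map p.2⟩) ⟨?_, ?_⟩)
  · rintro ⟨a, e⟩ ⟨a', e'⟩ h
    have h1 : e (cycExtGen ℓ lam a) = e' (cycExtGen ℓ lam a') :=
      congrArg (fun p => p.1.1) h
    have h2 : ∀ i, e (cycExtBasis ℓ lam a i) = e' (cycExtBasis ℓ lam a' i) := fun i =>
      congrFun (congrArg (fun p => p.1.2) h) i
    -- The element ℓ^(lam i + 1) h_i is the multiple a i of x, and x has order ℓ^k, so a i is
    -- determined.
    have haa : a = a' := by
      choose m hm using fun i => ZMod.intCast_surjective (a i)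
      choose m' hm' using fun i => ZMod.intCast_surjective (a' i)
      ext i
      have e1 := congrArg e (pow_smul_cycExtBasis (lam := lam) m hm i)
      have e2 := congrArg e' (pow_smul_cycExtBasis (lam := lam) m' hm' i)
      rw [map_zsmul, map_zsmul] at e1 e2
      rw [h2, e2, ← h1, zsmul_eq_of_cast_eq ((isExtData_cycExt a).map e).order, hm, hm'] at e1
      exact e1.symm
    subst haa
    rw [cycExt_equiv_ext h1 h2]
  · rintro ⟨⟨x, h⟩, hh⟩
    obtain ⟨a, e, h1, h2⟩ := hh.exists_equiv
    exact ⟨⟨a, e⟩, Subtype.ext (Prod.ext h1 (funext h2))⟩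

/-- The number of lifts and bases over an admissible x is the same for all x, so counting extension
data counts the admissible x. -/
theorem card_isExtData_eq (lam : Fin r → ℕ) (k : ℕ) (H : Type*) [AddCommGroup H] [Finite H] :
    Nat.card {p : H × (Fin r → H) // IsExtData ℓ lam k p.1 p.2} =
      Nat.card {x : H // addOrderOf x = ℓ ^ k ∧
        Nonempty (CycProd ℓ lam ≃+ H ⧸ AddSubgroup.zmultiples x)} *
        (Nat.card (CycProd ℓ lam ≃+ CycProd ℓ lam) * ℓ ^ (k * r)) := by
  let P : H → Prop := fun x => addOrderOf x = ℓ ^ k ∧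
        Nonempty (CycProd ℓ lam ≃+ H ⧸ AddSubgroup.zmultiples x)
  have hP : ∀ {x : H} {h : Fin r → H}, IsExtData ℓ lam k x h → P x := fun {x h} hh => by
    obtain ⟨e, -⟩ := ((isExtData_iff hh.order h).1 hh).exists_equiv
    exact ⟨hh.order, ⟨e⟩⟩
  have e : {p : H × (Fin r → H) // IsExtData ℓ lam k p.1 p.2} ≃
      Σ x : {x // P x}, {h : Fin r → H // IsExtData ℓ lam k x.1 h} :=
    { toFun := fun p => ⟨⟨p.1.1, hP p.2⟩, p.1.2, p.2⟩
      invFun := fun p => ⟨(p.1.1, p.2.1), p.2.2⟩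
      left_inv := fun p => rfl
      right_inv := fun p => rfl }
  have := Fintype.ofFinite {x // P x}
  rw [Nat.card_congr e, Nat.card_sigma, Finset.sum_congr rfl (g := fun _ =>
    Nat.card (CycProd ℓ lam ≃+ CycProd ℓ lam) * ℓ ^ (k * r))]
  · rw [Finset.sum_const, smul_eq_mul, Finset.card_univ, ← Nat.card_eq_fintype_card]
  · rintro ⟨x, hx, ⟨e⟩⟩ -
    rw [card_isExtData_fiber hx]
    congr 1
    exact Nat.card_congr
      { toFun := fun f => f.trans e.symm
        invFun := fun f => f.trans e
        left_inv := fun f => by ext; simp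
        right_inv := fun f => by ext; simp }

end CyclicExtensionModels

/-! ### Order and rank of the extensions -/

section CyclicExtensionInvariants

variable {ℓ : ℕ} {r : ℕ} [hl : Fact ℓ.Prime] {lam : Fin r → ℕ} {k : ℕ}

theorem IsExtData.card_eq {H : Type*} [AddCommGroup H] {x : H} {h : Fin r → H}
    (hh : IsExtData ℓ lam k x h) : Nat.card H = ℓ ^ k * Nat.card (CycProd ℓ lam) := by
  obtain ⟨e, -⟩ := ((isExtData_iff hh.order h).1 hh).exists_equiv
  rw [AddSubgroup.card_eq_card_quotient_mul_card_addSubgroup (AddSubgroup.zmultiples x),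
    Nat.card_zmultiples, hh.order, ← Nat.card_congr e.toEquiv, mul_comm]

theorem card_cycExt (a : Fin r → ZMod (ℓ ^ k)) :
    Nat.card (CycExt ℓ lam a) = ℓ ^ k * Nat.card (CycProd ℓ lam) :=
  (isExtData_cycExt a).card_eq

theorem card_cycProd_eq_pow (lam : Fin r → ℕ) :
    Nat.card (CycProd ℓ lam) = ℓ ^ ∑ i, (lam i + 1) := by
  rw [card_cycProd, Finset.prod_pow_eq_pow_sum]

instance finite_cycExt (a : Fin r → ZMod (ℓ ^ k)) : Finite (CycExt ℓ lam a) := by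
  refine Nat.finite_of_card_ne_zero ?_
  rw [card_cycExt, card_cycProd_eq_pow, ← pow_add]
  exact ell_pow_ne_zero _

theorem cycExt_torsion (a : Fin r → ZMod (ℓ ^ k)) (y : CycExt ℓ lam a) :
    ∃ m : ℕ, ℓ ^ m • y = 0 := by
  refine ⟨k + ∑ i, (lam i + 1), ?_⟩
  rw [pow_add, ← card_cycProd_eq_pow, ← card_cycExt (lam := lam) a]
  exact card_nsmul_eq_zero'

/-- A homomorphism from `CycExt` is given by the images of the standard generators and of the
cyclic subgroup. -/
noncomputable def cycExtHomEquiv (a : Fin r → ZMod (ℓ ^ k)) (A : Type*) [AddCommGroup A]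
    (hA : ∀ y : A, ℓ • y = 0) :
    (CycExt ℓ lam a →+ A) ≃ (Fin r → A) × {d : ZMod (ℓ ^ k) →+ A // ∀ i, d (a i) = 0} where
  toFun f := (fun i => f (cycExtBasis ℓ lam a i),
    ⟨(f.comp (QuotientAddGroup.mk' _)).comp (AddMonoidHom.inr _ _), fun i => by
      obtain ⟨m, hm⟩ := ZMod.intCast_surjective (a i)
      have hd : ∀ i, ∃ m : ℤ, (m : ZMod (ℓ ^ k)) = a i := fun i => ZMod.intCast_surjective (a i)
      choose m hm using hd
      have h1 := pow_smul_cycExtBasis (lam := lam) m hm i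
      have h2 := congrArg f h1
      rw [map_zsmul, natCast_zsmul, pow_succ, mul_nsmul', hA, nsmul_zero] at h2
      rw [← hm, ← zsmul_one, map_zsmul]
      rw [map_zsmul] at h2
      exact h2.symm⟩)
  invFun p := QuotientAddGroup.lift _ (AddMonoidHom.coprod
    (∑ i, (zmultiplesHom A (p.1 i)).comp (Pi.evalAddMonoidHom _ i)) p.2.1) (by
    rintro _ ⟨d, rfl⟩
    rw [AddMonoidHom.mem_ker, AddMonoidHom.coprod_apply, AddMonoidHom.finsetSum_apply]
    have h1 : p.2.1 (extRel ℓ lam a d).2 = 0 := by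
      simp only [extRel, AddMonoidHom.coe_mk, ZeroHom.coe_mk, map_neg, map_sum, map_zsmul, p.2.2,
        smul_zero, Finset.sum_const_zero, neg_zero]
    rw [h1, add_zero]
    refine Finset.sum_eq_zero fun i _ => ?_
    simp only [extRel, AddMonoidHom.coe_mk, ZeroHom.coe_mk, AddMonoidHom.comp_apply,
      Pi.evalAddMonoidHom_apply, zmultiplesHom_apply]
    rw [mul_comm, mul_smul, natCast_zsmul, pow_succ, mul_nsmul', hA, nsmul_zero, smul_zero])
  left_inv f := by
    refine DFunLike.ext _ _ fun y => ?_
    induction y using cycExt_induction with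
    | h n m =>
      rw [← cycExt_mk_eq, QuotientAddGroup.lift_mk, AddMonoidHom.coprod_apply,
        AddMonoidHom.finsetSum_apply, cycExt_mk_eq, map_add, map_sum, map_zsmul]
      congr 1
      · simp
      · rw [← zsmul_one, map_zsmul]
        rfl
  right_inv p := by
    ext i
    · change QuotientAddGroup.lift _ _ _ (QuotientAddGroup.mk (Pi.single i 1, 0)) = p.1 i
      rw [QuotientAddGroup.lift_mk, AddMonoidHom.coprod_apply, AddMonoidHom.finsetSum_apply,
        Finset.sum_eq_single i]
      · simp
      all_goals simp +contextual
    · change (AddMonoidHom.coprod (∑ i, (zmultiplesHom A (p.1 i)).comp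
        (Pi.evalAddMonoidHom (fun _ => ℤ) i)) p.2.1) (0, i) = p.2.1 i
      rw [AddMonoidHom.coprod_apply, map_zero, zero_add]

/-- A character of order ℓ may take any values on the r lifted generators; its restriction to the
cyclic subgroup only has to kill the a i, since ℓ^(lam i + 1) acts as zero on the target. -/
theorem card_cycExt_hom (a : Fin r → ZMod (ℓ ^ k)) :
    ℓ ^ ellRank ℓ (CycExt ℓ lam a) =
      ℓ ^ r * Nat.card {d : ZMod (ℓ ^ k) →+ ZMod ℓ // ∀ i, d (a i) = 0} := by
  rw [← card_hom_zmod, Nat.card_congr (cycExtHomEquiv a (ZMod ℓ) fun y => by simp), Nat.card_prod]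
  simp

theorem ellRank_cycExt_zero (a : Fin r → ZMod (ℓ ^ 0)) : ellRank ℓ (CycExt ℓ lam a) = r := by
  have h := card_cycExt_hom (lam := lam) a
  have : Unique {d : ZMod (ℓ ^ 0) →+ ZMod ℓ // ∀ i, d (a i) = 0} :=
    { default := ⟨0, fun _ => rfl⟩
      uniq := fun d => by
        ext y
        have : Subsingleton (ZMod (ℓ ^ 0)) := by rw [pow_zero]; infer_instance
        rw [Subsingleton.elim y 0, map_zero, map_zero] }
  rw [Nat.card_unique, mul_one] at h
  exact Nat.pow_right_injective hl.out.two_le h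

theorem zmod_pow_hom_apply (d : ZMod (ℓ ^ (k + 1)) →+ ZMod ℓ) (y : ZMod (ℓ ^ (k + 1))) :
    d y = ZMod.castHom (dvd_pow_self ℓ k.succ_ne_zero) (ZMod ℓ) y * d 1 := by
  obtain ⟨m, rfl⟩ := ZMod.intCast_surjective y
  rw [← zsmul_one, map_zsmul, map_zsmul]
  simp

/-- A character of the cyclic subgroup is its value d at the generator, subject to a_i d = 0. A
nonzero d is possible exactly when every a_i vanishes modulo ℓ. -/
theorem ellRank_cycExt_succ [DecidableEq (Fin r → ZMod ℓ)] (a : Fin r → ZMod (ℓ ^ (k + 1))) :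
    ellRank ℓ (CycExt ℓ lam a) =
      if (fun i => ZMod.castHom (dvd_pow_self ℓ k.succ_ne_zero) (ZMod ℓ) (a i)) = 0
      then r + 1 else r := by
  have h := card_cycExt_hom (lam := lam) a
  let c := ZMod.castHom (dvd_pow_self ℓ k.succ_ne_zero) (ZMod ℓ)
  have e : {d : ZMod (ℓ ^ (k + 1)) →+ ZMod ℓ // ∀ i, d (a i) = 0} ≃
      {d : ZMod ℓ // ∀ i, c (a i) * d = 0} :=
    { toFun := fun d => ⟨d.1 1, fun i => by rw [← zmod_pow_hom_apply]; exact d.2 i⟩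
      invFun := fun d => ⟨(AddMonoidHom.mulRight d.1).comp c.toAddMonoidHom, d.2⟩
      left_inv := fun d => by
        ext y
        exact (zmod_pow_hom_apply d.1 y).symm
      right_inv := fun d => by
        ext
        change c 1 * d.1 = d.1
        rw [map_one, one_mul] }
  rw [Nat.card_congr e] at h
  split_ifs with h0
  · have : Nat.card {d : ZMod ℓ // ∀ i, c (a i) * d = 0} = ℓ := by
      rw [Nat.card_congr (Equiv.subtypeUnivEquiv fun d i => by
        have : c (a i) = 0 := congrFun h0 i
        rw [this, zero_mul]), Nat.card_zmod]
    rw [this, ← pow_succ] at h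
    exact Nat.pow_right_injective hl.out.two_le h
  · obtain ⟨i, hi⟩ := Function.ne_iff.1 h0
    have : Unique {d : ZMod ℓ // ∀ i, c (a i) * d = 0} :=
      { default := ⟨0, by simp⟩
        uniq := fun d => Subtype.ext ((mul_eq_zero.1 (d.2 i)).resolve_left hi) }
    rw [Nat.card_unique, mul_one] at h
    exact Nat.pow_right_injective hl.out.two_le h

theorem card_castHom_eq_zero (ℓ r k : ℕ) [Fact ℓ.Prime] :
    Nat.card {a : Fin r → ZMod (ℓ ^ (k + 1)) //
      (fun i => ZMod.castHom (dvd_pow_self ℓ k.succ_ne_zero) (ZMod ℓ) (a i)) = 0} =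
      ℓ ^ (k * r) := by
  let c := (ZMod.castHom (dvd_pow_self ℓ k.succ_ne_zero) (ZMod ℓ)).toAddMonoidHom
  have hc : Function.Surjective c :=
    ZMod.castHom_surjective (dvd_pow_self ℓ k.succ_ne_zero)
  have hker : Nat.card c.ker = ℓ ^ k := by
    have h1 := AddSubgroup.card_eq_card_quotient_mul_card_addSubgroup c.ker
    rw [Nat.card_congr (QuotientAddGroup.quotientKerEquivOfSurjective c hc).toEquiv, Nat.card_zmod,
      Nat.card_zmod] at h1
    exact (Nat.eq_of_mul_eq_mul_left (Fact.out : ℓ.Prime).pos ((pow_succ' ℓ k).symm.trans h1)).symm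
  have e : {a : Fin r → ZMod (ℓ ^ (k + 1)) //
      (fun i => ZMod.castHom (dvd_pow_self ℓ k.succ_ne_zero) (ZMod ℓ) (a i)) = 0} ≃
      (Fin r → c.ker) :=
    { toFun := fun a i => ⟨a.1 i, congrFun a.2 i⟩
      invFun := fun a => ⟨fun i => (a i).1, funext fun i => (a i).2⟩
      left_inv := fun a => rfl
      right_inv := fun a => rfl }
  rw [Nat.card_congr e, Nat.card_fun, hker, Nat.card_fin, pow_mul]

theorem sum_ellRank_cycExt (lam : Fin r → ℕ) (k : ℕ) (g : ℕ → ℝ) :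
    ∑ a : Fin r → ZMod (ℓ ^ (k + 1)), g (ellRank ℓ (CycExt ℓ lam a)) =
      ℓ ^ (k * r) * g (r + 1) + (ℓ ^ ((k + 1) * r) - ℓ ^ (k * r)) * g r := by
  classical
  let P : (Fin r → ZMod (ℓ ^ (k + 1))) → Prop := fun a =>
    (fun i => ZMod.castHom (dvd_pow_self ℓ k.succ_ne_zero) (ZMod ℓ) (a i)) = 0
  have h1 : ∀ a : Fin r → ZMod (ℓ ^ (k + 1)), g (ellRank ℓ (CycExt ℓ lam a)) =
      g r + if P a then g (r + 1) - g r else 0 := by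
    intro a
    rw [ellRank_cycExt_succ]
    change g (if P a then _ else _) = _
    split_ifs <;> ring
  rw [Finset.sum_congr rfl fun a _ => h1 a, Finset.sum_add_distrib, Finset.sum_const,
    ← Finset.sum_filter, Finset.sum_const, ← Fintype.card_subtype, ← Nat.card_eq_fintype_card,
    card_castHom_eq_zero, Finset.card_univ]
  simp only [Fintype.card_fun, ZMod.card, Fintype.card_fin, nsmul_eq_mul, ← pow_mul]
  push_cast
  ring

end CyclicExtensionInvariants

/-! ### The group masses of Qν -/

section QuotientMeasure

variable {ℓ n : ℕ}

/-- The underlying group of a class is well defined up to isomorphism. -/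
theorem exists_beg_iff (c : BEGClass ℓ n) (G : Type*) [AddCommGroup G] :
    (∃ X : BEG ℓ n, ⟦X⟧ = c ∧ Nonempty (X.carrier ≃+ G)) ↔ Nonempty (c.out.carrier ≃+ G) := by
  constructor
  · rintro ⟨X, rfl, ⟨e⟩⟩
    obtain ⟨f, -⟩ : BEG.Iso (⟦X⟧ : BEGClass ℓ n).out X :=
      Quotient.exact (s := BEG.setoid ℓ n) (Quotient.out_eq (⟦X⟧ : BEGClass ℓ n))
    exact ⟨f.trans e⟩
  · exact fun h => ⟨_, Quotient.out_eq _, h⟩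

open Classical in
theorem groupMass_eq_tsum (ν : BEGClass ℓ n → ℝ≥0∞) (G : Type*) [AddCommGroup G] :
    groupMass ν G = ∑' c, if Nonempty (c.out.carrier ≃+ G) then ν c else 0 := by
  have hset : {c : BEGClass ℓ n | ∃ X : BEG ℓ n, ⟦X⟧ = c ∧ Nonempty (X.carrier ≃+ G)} =
      {c | Nonempty (c.out.carrier ≃+ G)} := Set.ext fun c => exists_beg_iff c G
  change ∑' c : ({c : BEGClass ℓ n | ∃ X : BEG ℓ n, ⟦X⟧ = c ∧ Nonempty (X.carrier ≃+ G)} :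
    Set (BEGClass ℓ n)), ν c = _
  rw [tsum_subtype, hset]
  refine tsum_congr fun c => ?_
  simp only [Set.indicator, Set.mem_ofPred_eq]

theorem groupMass_congr (ν : BEGClass ℓ n → ℝ≥0∞) {G H : Type*} [AddCommGroup G] [AddCommGroup H]
    (e : G ≃+ H) : groupMass ν G = groupMass ν H := by
  rw [groupMass_eq_tsum, groupMass_eq_tsum]
  refine tsum_congr fun c => ?_
  have : Nonempty (c.out.carrier ≃+ G) ↔ Nonempty (c.out.carrier ≃+ H) :=
    ⟨fun ⟨f⟩ => ⟨f.trans e⟩, fun ⟨f⟩ => ⟨f.trans e.symm⟩⟩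
  by_cases h : Nonempty (c.out.carrier ≃+ G)
  · rw [if_pos h, if_pos (this.1 h)]
  · rw [if_neg h, if_neg (fun h' => h (this.2 h'))]

variable [Fact ℓ.Prime]

/-- Homomorphisms from `ℤ_ℓ` to a finite abelian `ℓ`-group are given by elements. -/
noncomputable def padicHomEquiv {H : Type*} [AddCommGroup H] (hH : ∃ k, ∀ h : H, ℓ ^ k • h = 0) :
    (ℤ_[ℓ] →+ H) ≃ H :=
  Equiv.ofBijective (fun f => f 1)
    ⟨fun _ _ h => padicInt_hom_ext hH h, fun x => exists_padicInt_hom hH x⟩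

theorem BEG.torsion (X : BEG ℓ n) : ∃ k, ∀ h : X.carrier, ℓ ^ k • h = 0 :=
  exists_pow_nsmul_eq_zero X.ellGroup

-- Every homomorphism f belongs to exactly one class, and the group underlying that class is the
-- quotient by the subgroup that f(1) generates.
open Classical in
theorem tsum_card_quot (X : BEG ℓ n) (G : Type*) [AddCommGroup G] :
    ∑' c : BEGClass ℓ n, (if Nonempty (c.out.carrier ≃+ G) then
      (Nat.card {f : ℤ_[ℓ] →+ X.carrier // (⟦X.quot f.range⟧ : BEGClass ℓ n) = c} : ℝ≥0∞) else 0) =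
    Nat.card {x : X.carrier // Nonempty (G ≃+ X.carrier ⧸ AddSubgroup.zmultiples x)} := by
  have := Finite.of_equiv _ (padicHomEquiv X.torsion).symm
  have := Fintype.ofFinite (ℤ_[ℓ] →+ X.carrier)
  have h1 : ∀ c : BEGClass ℓ n, (if Nonempty (c.out.carrier ≃+ G) then
      (Nat.card {f : ℤ_[ℓ] →+ X.carrier // (⟦X.quot f.range⟧ : BEGClass ℓ n) = c} : ℝ≥0∞) else 0) =
      ∑ f : ℤ_[ℓ] →+ X.carrier, if c = ⟦X.quot f.range⟧ then
        (if Nonempty (c.out.carrier ≃+ G) then 1 else 0) else 0 := by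
    intro c
    split_ifs with h
    · rw [Nat.card_eq_fintype_card, Fintype.card_subtype, Finset.card_filter, Nat.cast_sum]
      refine Finset.sum_congr rfl fun f _ => ?_
      rw [Nat.cast_ite]
      simp only [Nat.cast_one, Nat.cast_zero, eq_comm]
    · simp
  have h2 : ∀ f : ℤ_[ℓ] →+ X.carrier,
      Nonempty ((⟦X.quot f.range⟧ : BEGClass ℓ n).out.carrier ≃+ G) ↔
        Nonempty (G ≃+ X.carrier ⧸ AddSubgroup.zmultiples (f 1)) := by
    intro f
    rw [← exists_beg_iff]
    have hr := range_padicInt_hom X.torsion f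
    constructor
    · rintro ⟨Y, hY, ⟨e⟩⟩
      obtain ⟨e', -⟩ : BEG.Iso Y (X.quot f.range) := Quotient.exact hY
      exact ⟨(e.symm.trans e').trans (QuotientAddGroup.quotientAddEquivOfEq hr)⟩
    · rintro ⟨e⟩
      exact ⟨_, rfl, ⟨(QuotientAddGroup.quotientAddEquivOfEq hr).trans e.symm⟩⟩
  simp only [h1]
  rw [Summable.tsum_finsetSum fun _ _ => ENNReal.summable]
  simp only [tsum_ite_eq, h2]
  rw [← Nat.card_congr (Equiv.subtypeEquiv (padicHomEquiv X.torsion)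
    (p := fun f => Nonempty (G ≃+ X.carrier ⧸ AddSubgroup.zmultiples (f 1))) fun f => Iff.rfl),
    Nat.card_eq_fintype_card, Fintype.card_subtype, Finset.card_filter, Nat.cast_sum]
  refine Finset.sum_congr rfl fun f _ => ?_
  rw [Nat.cast_ite, Nat.cast_one, Nat.cast_zero]

/-- Interchanging the nonnegative sums removes the enhancement of the quotient: only the group
underlying H/⟨x⟩ matters. -/
theorem groupMass_quotMeasure (ν : BEGClass ℓ n → ℝ≥0∞) (G : Type*) [AddCommGroup G] :
    groupMass (quotMeasure ν) G = ∑' h : BEGClass ℓ n,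
      (Nat.card {x : h.out.carrier // Nonempty (G ≃+ h.out.carrier ⧸ AddSubgroup.zmultiples x)} :
        ℝ≥0∞) / Nat.card h.out.carrier * ν h := by
  classical
  rw [groupMass_eq_tsum]
  have h1 : ∀ c : BEGClass ℓ n, (if Nonempty (c.out.carrier ≃+ G) then quotMeasure ν c else 0) =
      ∑' h : BEGClass ℓ n, (if Nonempty (c.out.carrier ≃+ G) then
        (Nat.card {f : ℤ_[ℓ] →+ h.out.carrier // (⟦h.out.quot f.range⟧ : BEGClass ℓ n) = c} : ℝ≥0∞)
          else 0) / Nat.card h.out.carrier * ν h := by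
    intro c
    split_ifs
    · rfl
    · simp
  simp only [h1]
  rw [ENNReal.tsum_comm]
  refine tsum_congr fun h => ?_
  simp only [div_eq_mul_inv]
  rw [ENNReal.tsum_mul_right, ENNReal.tsum_mul_right, tsum_card_quot]

/-- The elements x are sorted by their order ℓ^k, and those of a given order are counted through
extension data. -/
theorem card_quot_eq_tsum (X : BEG ℓ n) {r : ℕ} (lam : Fin r → ℕ) :
    (Nat.card {x : X.carrier // Nonempty (CycProd ℓ lam ≃+
      X.carrier ⧸ AddSubgroup.zmultiples x)} : ℝ≥0∞) =
    ∑' k : ℕ, (∑ a : Fin r → ZMod (ℓ ^ k), (Nat.card (CycExt ℓ lam a ≃+ X.carrier) : ℝ≥0∞)) /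
      (Nat.card (CycProd ℓ lam ≃+ CycProd ℓ lam) * ℓ ^ (k * r)) := by
  classical
  have hA : Nat.card (CycProd ℓ lam ≃+ CycProd ℓ lam) ≠ 0 := by
    have : Finite (CycProd ℓ lam ≃+ CycProd ℓ lam) :=
      Finite.of_injective (fun e => (e : CycProd ℓ lam → CycProd ℓ lam)) DFunLike.coe_injective
    have : Nonempty (CycProd ℓ lam ≃+ CycProd ℓ lam) := ⟨AddEquiv.refl _⟩
    exact Nat.card_pos.ne'
  have hk : ∀ k : ℕ, (∑ a : Fin r → ZMod (ℓ ^ k),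
      (Nat.card (CycExt ℓ lam a ≃+ X.carrier) : ℝ≥0∞)) /
      (Nat.card (CycProd ℓ lam ≃+ CycProd ℓ lam) * ℓ ^ (k * r)) =
      Nat.card {x : X.carrier // addOrderOf x = ℓ ^ k ∧
        Nonempty (CycProd ℓ lam ≃+ X.carrier ⧸ AddSubgroup.zmultiples x)} := by
    intro k
    have hfin : ∀ a : Fin r → ZMod (ℓ ^ k), Finite (CycExt ℓ lam a ≃+ X.carrier) := fun a =>
      Finite.of_injective (fun e => (e : CycExt ℓ lam a → X.carrier)) DFunLike.coe_injective
    have h1 := card_isExtData_eq (ℓ := ℓ) lam k X.carrier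
    rw [← card_sigma_cycExt_equiv, Nat.card_sigma] at h1
    rw [← Nat.cast_sum, h1]
    push_cast
    have hp := ell_pow_ne_zero (ℓ := ℓ) (k * r)
    refine ENNReal.mul_div_cancel_right ?_ ?_
    · exact mul_ne_zero (by exact_mod_cast hA) (by exact_mod_cast hp)
    · exact ENNReal.mul_ne_top (by simp) (by simp)
  simp only [hk]
  have := Fintype.ofFinite X.carrier
  have hcard : ∀ P : X.carrier → Prop, (Nat.card {x // P x} : ℝ≥0∞) = ∑ x, if P x then 1 else 0 := by
    intro P
    rw [Nat.card_eq_fintype_card, Fintype.card_subtype, Finset.card_filter, Nat.cast_sum]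
    refine Finset.sum_congr rfl fun x _ => ?_
    rw [Nat.cast_ite, Nat.cast_one, Nat.cast_zero]
  simp only [hcard]
  rw [Summable.tsum_finsetSum fun _ _ => ENNReal.summable]
  refine Finset.sum_congr rfl fun x _ => ?_
  obtain ⟨m, hm⟩ := X.ellGroup x
  obtain ⟨j, -, hj⟩ := (Nat.dvd_prime_pow (Fact.out : ℓ.Prime)).1
    (addOrderOf_dvd_iff_nsmul_eq_zero.2 hm)
  rw [tsum_eq_single j]
  · simp [hj]
  · intro k hkj
    rw [if_neg]
    rintro ⟨h, -⟩
    exact hkj (Nat.pow_right_injective (Fact.out : ℓ.Prime).two_le (h.symm.trans hj))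

theorem card_equiv_eq_ite {H K : Type*} [AddCommGroup H] [AddCommGroup K]
    [Decidable (Nonempty (K ≃+ H))] :
    Nat.card (H ≃+ K) = if Nonempty (K ≃+ H) then Nat.card (H ≃+ H) else 0 := by
  split_ifs with h
  · obtain ⟨e⟩ := h
    exact Nat.card_congr
      { toFun := fun f => f.trans e
        invFun := fun f => f.trans e.symm
        left_inv := fun f => by ext; simp
        right_inv := fun f => by ext; simp }
  · rw [Nat.card_eq_zero]
    exact Or.inl ⟨fun f => h ⟨f.symm⟩⟩

/-- For a fixed parameter a, only the classes whose group is isomorphic to the extension contribute,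
each through the number of automorphisms of that extension. Thus Q acts on group masses alone. -/
theorem groupMass_quotMeasure_cycProd (ν : BEGClass ℓ n → ℝ≥0∞) {r : ℕ} (lam : Fin r → ℕ) :
    groupMass (quotMeasure ν) (CycProd ℓ lam) =
      ∑' k : ℕ, ∑ a : Fin r → ZMod (ℓ ^ k),
        (Nat.card (CycExt ℓ lam a ≃+ CycExt ℓ lam a) : ℝ≥0∞) /
          (Nat.card (CycProd ℓ lam ≃+ CycProd ℓ lam) * ℓ ^ (k * r)) /
            Nat.card (CycExt ℓ lam a) * groupMass ν (CycExt ℓ lam a) := by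
  classical
  rw [groupMass_quotMeasure]
  simp only [card_quot_eq_tsum]
  have h1 : ∀ h : BEGClass ℓ n, (∑' k : ℕ, (∑ a : Fin r → ZMod (ℓ ^ k),
      (Nat.card (CycExt ℓ lam a ≃+ h.out.carrier) : ℝ≥0∞)) /
      (Nat.card (CycProd ℓ lam ≃+ CycProd ℓ lam) * ℓ ^ (k * r))) / Nat.card h.out.carrier * ν h =
      ∑' k : ℕ, ∑ a : Fin r → ZMod (ℓ ^ k),
        (Nat.card (CycExt ℓ lam a ≃+ h.out.carrier) : ℝ≥0∞) /
          (Nat.card (CycProd ℓ lam ≃+ CycProd ℓ lam) * ℓ ^ (k * r)) /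
            Nat.card h.out.carrier * ν h := by
    intro h
    simp only [div_eq_mul_inv]
    rw [← ENNReal.tsum_mul_right, ← ENNReal.tsum_mul_right]
    refine tsum_congr fun k => ?_
    rw [Finset.sum_mul, Finset.sum_mul, Finset.sum_mul]
  simp only [h1]
  rw [ENNReal.tsum_comm]
  refine tsum_congr fun k => ?_
  rw [Summable.tsum_finsetSum fun _ _ => ENNReal.summable]
  refine Finset.sum_congr rfl fun a _ => ?_
  rw [groupMass_eq_tsum, ← ENNReal.tsum_mul_left]
  refine tsum_congr fun h => ?_
  rw [card_equiv_eq_ite]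
  split_ifs with hne
  · obtain ⟨e⟩ := hne
    rw [Nat.card_congr e.toEquiv]
  · simp

end QuotientMeasure

/-! ### Malle's masses satisfy the recursion -/

section MalleRecursion

/-- Malle's probability for a group of rank `r`, with `A` automorphisms and `N` elements. -/
noncomputable def malleMass (ℓ t r A N : ℕ) : ℝ :=
  malleConst (ℓ : ℝ)⁻¹ t * ((ℓ : ℝ) ^ r.choose 2 * qPoch (ℓ : ℝ)⁻¹ (r + t)) /
    (qPoch (ℓ : ℝ)⁻¹ t * A * (N : ℝ) ^ t)

theorem qPoch_succ (x : ℝ) (j : ℕ) : qPoch x (j + 1) = qPoch x j * (1 - x ^ (j + 1)) := by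
  rw [qPoch, qPoch, Finset.prod_Icc_succ_top (by omega)]

theorem qPoch_pos {x : ℝ} (h0 : 0 ≤ x) (h1 : x < 1) (j : ℕ) : 0 < qPoch x j := by
  refine Finset.prod_pos fun i hi => ?_
  rw [Finset.mem_Icc] at hi
  have := pow_lt_one₀ h0 h1 (show i ≠ 0 by omega)
  linarith

theorem prime_inv_nonneg_lt_one (ℓ : ℕ) [hl : Fact ℓ.Prime] :
    0 < (ℓ : ℝ)⁻¹ ∧ (ℓ : ℝ)⁻¹ < 1 := by
  have h : (1 : ℝ) < ℓ := by exact_mod_cast hl.out.one_lt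
  exact ⟨by positivity, inv_lt_one_of_one_lt₀ h⟩

theorem malleMass_nonneg (ℓ t r A N : ℕ) [Fact ℓ.Prime] : 0 ≤ malleMass ℓ t r A N := by
  obtain ⟨h0, h1⟩ := prime_inv_nonneg_lt_one ℓ
  have := malleConst_nonneg h0.le h1 t
  have := (qPoch_pos h0.le h1 t).le
  have := (qPoch_pos h0.le h1 (r + t)).le
  rw [malleMass]
  positivity

/-- The summand of the recursion for the extensions by a cyclic group of order `ℓ^k`. -/
noncomputable def malleSummand (ℓ : ℕ) [Fact ℓ.Prime] {r : ℕ} (lam : Fin r → ℕ) (A t k : ℕ) : ℝ :=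
  ∑ a : Fin r → ZMod (ℓ ^ k),
    malleMass ℓ t (ellRank ℓ (CycExt ℓ lam a)) A (ℓ ^ k * Nat.card (CycProd ℓ lam)) /
      (ℓ ^ (k * r) * (ℓ ^ k * Nat.card (CycProd ℓ lam)))

/-- The summand depends on k and on the rank only. Its dependence on k beyond k = 0 is the power
(q^(t+1))^k with q = ℓ⁻¹, so a geometric series remains. -/
theorem hasSum_malleSummand (ℓ : ℕ) {r : ℕ} (lam : Fin r → ℕ) {A : ℕ} (hA : A ≠ 0) (t : ℕ)
    [hl : Fact ℓ.Prime] : HasSum (malleSummand ℓ lam A t)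
      (malleMass ℓ (t + 1) r A (Nat.card (CycProd ℓ lam))) := by
  obtain ⟨h0, h1⟩ := prime_inv_nonneg_lt_one ℓ
  set N := Nat.card (CycProd ℓ lam) with hN
  have hNpos : (0 : ℝ) < N := by
    rw [hN, card_cycProd_eq_pow]
    exact_mod_cast pow_pos hl.out.pos _
  have hlpos : (0 : ℝ) < ℓ := by exact_mod_cast hl.out.pos
  have hApos : (0 : ℝ) < A := by exact_mod_cast Nat.pos_of_ne_zero hA
  set q := (ℓ : ℝ)⁻¹ with hq
  have hlq : (ℓ : ℝ) = q⁻¹ := by rw [hq, inv_inv]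
  have hql : q * ℓ = 1 := by rw [hq, inv_mul_cancel₀ hlpos.ne']
  have hqx : ∀ x, q ^ x = ((ℓ : ℝ) ^ x)⁻¹ := fun x => by rw [hq, inv_pow]
  have hQlt : q ^ (t + 1) < 1 := pow_lt_one₀ h0.le h1 (by omega)
  let g : ℕ → ℝ := fun s => (ℓ : ℝ) ^ s.choose 2 * qPoch q (s + t)
  let K : ℝ := malleConst q t / (qPoch q t * A * N ^ (t + 1))
  have hP := qPoch_pos h0.le h1 t
  have hterm : ∀ s k : ℕ, malleMass ℓ t s A (ℓ ^ k * N) / (ℓ ^ (k * r) * (ℓ ^ k * N)) =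
      K * (q ^ (t + 1)) ^ k * q ^ (k * r) * g s := by
    intro s k
    simp only [malleMass, K, g]
    push_cast
    rw [← hq, ← pow_mul, hqx, hqx]
    field_simp
    ring
  have hzero : malleSummand ℓ lam A t 0 = K * g r := by
    rw [malleSummand]
    have : Unique (Fin r → ZMod (ℓ ^ 0)) := by
      rw [pow_zero]; infer_instance
    rw [Fintype.sum_unique, ellRank_cycExt_zero, hterm]
    simp
  -- Of the ℓ^((k+1)r) parameters, the proportion q^r gives rank r + 1, independently of k.
  have hsucc : ∀ k, malleSummand ℓ lam A t (k + 1) =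
      K * (q ^ r * g (r + 1) + (1 - q ^ r) * g r) * (q ^ (t + 1)) ^ (k + 1) := by
    intro k
    rw [malleSummand]
    simp only [← hN, hterm]
    rw [← Finset.mul_sum, sum_ellRank_cycExt]
    have e1 : q ^ ((k + 1) * r) * (ℓ : ℝ) ^ (k * r) = q ^ r := by
      rw [add_mul, one_mul, pow_add, mul_right_comm, ← mul_pow, hql, one_pow, one_mul]
    have e2 : q ^ ((k + 1) * r) * (ℓ : ℝ) ^ ((k + 1) * r) = 1 := by
      rw [← mul_pow, hql, one_pow]
    linear_combination (K * (q ^ (t + 1)) ^ (k + 1) * (g (r + 1) - g r)) * e1 +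
      K * (q ^ (t + 1)) ^ (k + 1) * g r * e2
  -- The trivial extension k = 0 is set apart, since it always has rank r.
  rw [← hasSum_nat_add_iff' 1]
  have hgeo := (hasSum_geometric_of_lt_one (pow_nonneg h0.le (t + 1)) hQlt).mul_left
    (K * (q ^ r * g (r + 1) + (1 - q ^ r) * g r) * q ^ (t + 1))
  have hfun : (fun k => malleSummand ℓ lam A t (k + 1)) = fun k =>
      K * (q ^ r * g (r + 1) + (1 - q ^ r) * g r) * q ^ (t + 1) * (q ^ (t + 1)) ^ k := by
    funext k
    rw [hsucc]
    ring
  have hval : malleMass ℓ (t + 1) r A N - ∑ i ∈ Finset.range 1, malleSummand ℓ lam A t i =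
      K * (q ^ r * g (r + 1) + (1 - q ^ r) * g r) * q ^ (t + 1) * (1 - q ^ (t + 1))⁻¹ := by
    rw [Finset.sum_range_one, hzero]
    -- The factor ℓ^r from binom(r+1,2) - binom(r,2) cancels q^r and leaves the new factor of the
    -- q-Pochhammer symbol.
    have hg : q ^ r * g (r + 1) = g r * (1 - q ^ (r + t + 1)) := by
      simp only [g]
      rw [show r + 1 + t = r + t + 1 by ring, qPoch_succ, Nat.choose_succ_succ' r 1,
        Nat.choose_one_right, pow_add]
      have e3 : q ^ r * (ℓ : ℝ) ^ r = 1 := by rw [← mul_pow, hql, one_pow]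
      linear_combination ((ℓ : ℝ) ^ r.choose 2 * qPoch q (r + t) * (1 - q ^ (r + t + 1))) * e3
    have hne : 1 - q ^ (t + 1) ≠ 0 := by linarith
    have hg2 : g (r + 1) = g r * (1 - q ^ (r + t + 1)) / q ^ r := by
      rw [← hg]
      field_simp
    have hmm : malleMass ℓ (t + 1) r A N =
        K * (1 + q ^ (t + 1)) * (g r * (1 - q ^ (r + t + 1))) / (1 - q ^ (t + 1)) := by
      simp only [malleMass, K, g]
      rw [← hq, malleConst_succ h0.le h1, qPoch_succ, ← add_assoc, qPoch_succ]
      field_simp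
    -- With Q = q^(t+1), the claim is (1 - Q) + Q (2 - q^r - q^r Q) = (1 + Q)(1 - q^r Q).
    rw [hmm, hg]
    field_simp
    ring
  rw [hfun, hval]
  exact hgeo

/-- The automorphisms of the extension in the recursion cancel those in the denominator of Malle's
mass, which leaves `malleSummand`. -/
theorem groupMass_quotMeasure_of_malle {ℓ n : ℕ} [hl : Fact ℓ.Prime] (ν : BEGClass ℓ n → ℝ≥0∞)
    (t : ℕ)
    (hν : ∀ (G : Type) [AddCommGroup G] [Finite G], (∀ x : G, ∃ k : ℕ, ℓ ^ k • x = 0) →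
      groupMass ν G = ENNReal.ofReal (malleMass ℓ t (ellRank ℓ G) (Nat.card (G ≃+ G)) (Nat.card G)))
    {r : ℕ} (lam : Fin r → ℕ) :
    groupMass (quotMeasure ν) (CycProd ℓ lam) = ENNReal.ofReal (malleMass ℓ (t + 1) r
      (Nat.card (CycProd ℓ lam ≃+ CycProd ℓ lam)) (Nat.card (CycProd ℓ lam))) := by
  have haut : ∀ (G : Type) [AddCommGroup G] [Finite G], 0 < Nat.card (G ≃+ G) := by
    intro G _ _
    have : Finite (G ≃+ G) := Finite.of_injective (fun e => (e : G → G)) DFunLike.coe_injective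
    have : Nonempty (G ≃+ G) := ⟨AddEquiv.refl _⟩
    exact Nat.card_pos
  set A := Nat.card (CycProd ℓ lam ≃+ CycProd ℓ lam)
  have hA : 0 < A := haut _
  have hA' : (0 : ℝ) < A := by exact_mod_cast hA
  have hlpos : (0 : ℝ) < ℓ := by exact_mod_cast hl.out.pos
  obtain ⟨h0, h1⟩ := prime_inv_nonneg_lt_one ℓ
  have hsum := hasSum_malleSummand ℓ lam hA.ne' t
  have hnn : ∀ k, 0 ≤ malleSummand ℓ lam A t k := fun k =>
    Finset.sum_nonneg fun a _ => div_nonneg (malleMass_nonneg _ _ _ _ _) (by positivity)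
  rw [groupMass_quotMeasure_cycProd, ← hsum.tsum_eq, ENNReal.ofReal_tsum_of_nonneg hnn hsum.summable]
  refine tsum_congr fun k => ?_
  rw [malleSummand, ENNReal.ofReal_sum_of_nonneg fun a _ =>
    div_nonneg (malleMass_nonneg _ _ _ _ _) (by positivity)]
  refine Finset.sum_congr rfl fun a _ => ?_
  have hB := haut (CycExt ℓ lam a)
  have hB' : (0 : ℝ) < Nat.card (CycExt ℓ lam a ≃+ CycExt ℓ lam a) := by exact_mod_cast hB
  have hC : 0 < Nat.card (CycExt ℓ lam a) := Nat.card_pos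
  have hC' : (0 : ℝ) < Nat.card (CycExt ℓ lam a) := by exact_mod_cast hC
  rw [hν _ (cycExt_torsion a), ← card_cycExt a]
  have e1 : (Nat.card (CycExt ℓ lam a ≃+ CycExt ℓ lam a) : ℝ≥0∞) / (A * ℓ ^ (k * r)) /
      Nat.card (CycExt ℓ lam a) = ENNReal.ofReal
        ((Nat.card (CycExt ℓ lam a ≃+ CycExt ℓ lam a) : ℝ) / (A * ℓ ^ (k * r)) /
          Nat.card (CycExt ℓ lam a)) := by
    rw [ENNReal.ofReal_div_of_pos hC', ENNReal.ofReal_div_of_pos (by positivity),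
      ENNReal.ofReal_mul hA'.le, ENNReal.ofReal_pow hlpos.le]
    simp only [ENNReal.ofReal_natCast]
  rw [e1, ← ENNReal.ofReal_mul (by positivity)]
  congr 1
  have hP := qPoch_pos h0.le h1 t
  have hcard : (Nat.card (CycExt ℓ lam a) : ℝ) = ℓ ^ k * Nat.card (CycProd ℓ lam) := by
    exact_mod_cast card_cycExt a
  have hD : (0 : ℝ) < Nat.card (CycProd ℓ lam) := by exact_mod_cast Nat.card_pos
  rw [← hcard]
  simp only [malleMass]
  generalize (ℓ : ℝ)⁻¹ = q at *
  field_simp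

end MalleRecursion

/-! ### The form ψ determines ω -/

section EnhancementUniqueness

variable {ℓ : ℕ} {r : ℕ} {lam : Fin r → ℕ}

theorem exists_tensor_eq_sum (z : CycProd ℓ lam ⊗[ℤ] CycProd ℓ lam) :
    ∃ c : Fin r → Fin r → ℤ, z = ∑ i, ∑ j, c i j •
      ((Pi.single i 1 : CycProd ℓ lam) ⊗ₜ[ℤ] (Pi.single j 1 : CycProd ℓ lam)) := by
  induction z with
  | zero => exact ⟨0, by simp⟩
  | tmul x y =>
    obtain ⟨n, rfl⟩ := (isCycBasis_single lam).gen x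
    obtain ⟨m, rfl⟩ := (isCycBasis_single lam).gen y
    refine ⟨fun i j => n i * m j, ?_⟩
    rw [TensorProduct.sum_tmul]
    refine Finset.sum_congr rfl fun i _ => ?_
    rw [TensorProduct.tmul_sum]
    refine Finset.sum_congr rfl fun j _ => ?_
    rw [← TensorProduct.smul_tmul', TensorProduct.tmul_smul, mul_smul]
  | add x y hx hy =>
    obtain ⟨c, rfl⟩ := hx
    obtain ⟨d, rfl⟩ := hy
    refine ⟨fun i j => c i j + d i j, ?_⟩
    simp only [add_smul, Finset.sum_add_distrib]

/-- Reducing coordinates i and j modulo ℓ^(1 + min(lam i, lam j)) reads off the coefficient of e_i ⊗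
e_j modulo a power of ℓ that kills this tensor. Because n = 1, no cyclic factor is too small for
these moduli. -/
theorem tensor_eq_zero_of_tensorEval (z : CycProd ℓ lam ⊗[ℤ] CycProd ℓ lam)
    (h : ∀ (s : ℕ) (a b : CycProd ℓ lam →+ ZMod (ℓ ^ (1 + s))), tensorEval a b z = 0) : z = 0 := by
  obtain ⟨c, rfl⟩ := exists_tensor_eq_sum z
  refine Finset.sum_eq_zero fun i _ => Finset.sum_eq_zero fun j _ => ?_
  have hd : ∀ k, (lam i ⊓ lam j ≤ lam k) → ℓ ^ (1 + lam i ⊓ lam j) ∣ ℓ ^ (lam k + 1) := fun k hk =>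
    pow_dvd_pow _ (by omega)
  let a (k : Fin r) (hk : lam i ⊓ lam j ≤ lam k) :
      CycProd ℓ lam →+ ZMod (ℓ ^ (1 + lam i ⊓ lam j)) :=
    (ZMod.castHom (hd k hk) _).toAddMonoidHom.comp (Pi.evalAddMonoidHom _ k)
  have ha : ∀ k hk m, a k hk (Pi.single m 1) = if m = k then 1 else 0 := by
    intro k hk m
    change ZMod.castHom (hd k hk) _ ((Pi.single m 1 : CycProd ℓ lam) k) = _
    by_cases hm : m = k
    · subst hm; rw [Pi.single_eq_same, map_one, if_pos rfl]
    · rw [Pi.single_eq_of_ne (Ne.symm hm), map_zero, if_neg hm]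
  have h1 := h _ (a i inf_le_left) (a j inf_le_right)
  have h2 : ∀ i' j', tensorEval (a i inf_le_left) (a j inf_le_right) (c i' j' •
      ((Pi.single i' 1 : CycProd ℓ lam) ⊗ₜ[ℤ] (Pi.single j' 1 : CycProd ℓ lam))) =
      c i' j' • ((if i' = i then 1 else 0) * if j' = j then 1 else 0) := by
    intro i' j'
    rw [map_smul, ← ha i inf_le_left, ← ha j inf_le_right]
    rfl
  simp only [map_sum, h2] at h1
  rw [Finset.sum_eq_single i, Finset.sum_eq_single j] at h1
  · simp only [if_true, mul_one, zsmul_one] at h1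
    rw [ZMod.intCast_zmod_eq_zero_iff_dvd] at h1
    have hk : ∀ k, lam k = lam i ⊓ lam j → c i j • (Pi.single k 1 : CycProd ℓ lam) = 0 := by
      intro k hk
      obtain ⟨d, hd⟩ := h1
      ext m
      by_cases hm : m = k
      · subst hm
        simp only [Pi.smul_apply, Pi.single_eq_same, zsmul_one, Pi.zero_apply]
        rw [ZMod.intCast_zmod_eq_zero_iff_dvd, hk, add_comm]
        exact ⟨d, hd⟩
      · simp [Pi.single_eq_of_ne hm]
    rcases le_total (lam i) (lam j) with hle | hle
    · rw [TensorProduct.smul_tmul', hk i (by simp [hle]), TensorProduct.zero_tmul]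
    · rw [← TensorProduct.tmul_smul, hk j (by simp [hle]), TensorProduct.tmul_zero]
  · intro j' _ hj'
    simp [hj']
  · simp
  · intro i' _ hi'
    simp [hi']
  · simp

theorem eq_zero_of_two_nsmul {A : Type*} [AddCommGroup A] (hl : ℓ.Prime) (hodd : ℓ ≠ 2) {N : ℕ}
    {x : A} (hx : ℓ ^ N • x = 0) (h2 : 2 • x = 0) : x = 0 := by
  have hc : Nat.Coprime (ℓ ^ N) 2 :=
    Nat.Coprime.pow_left N ((Nat.coprime_primes hl Nat.prime_two).2 hodd)
  rw [← AddMonoid.addOrderOf_eq_one_iff]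
  exact Nat.eq_one_of_dvd_coprimes hc (addOrderOf_dvd_of_nsmul_eq_zero hx)
    (addOrderOf_dvd_of_nsmul_eq_zero h2)

/-- The compatibility identity expresses 2 ω(α, β) through ψ; 2 is invertible, and the values ω(α,
β) detect ω. -/
theorem EnhData.IsBEG.ext_psi [hl : Fact ℓ.Prime] (hodd : ℓ ≠ 2) {d d' : EnhData ℓ 1 (CycProd ℓ lam)}
    (hd : d.IsBEG) (hd' : d'.IsBEG) (h : d.psi = d'.psi) : d = d' := by
  refine EnhData.ext ?_ h
  rw [← sub_eq_zero]
  refine tensor_eq_zero_of_tensorEval _ fun s a b => ?_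
  rw [map_sub]
  refine eq_zero_of_two_nsmul hl.out hodd (N := 1 + s) (by simp) ?_
  have h1 := hd.compat s a b
  have h2 := hd'.compat s a b
  rw [h, h2, add_right_inj] at h1
  have h3 := zmodToCircle_injective (ell_pow_ne_zero _)
    ((map_nsmul _ 2 _).trans (h1.trans (map_nsmul _ 2 _).symm))
  rw [nsmul_sub, ← h3, sub_self]

end EnhancementUniqueness

/-! ### The linear model produces BEGs -/

section LinearModelEnhanced

variable {ℓ : ℕ} [hl : Fact ℓ.Prime] {g : ℕ}

theorem sympForm_swap (v w : Fin g ⊕ Fin g → ℤ_[ℓ]) : sympForm v w = -sympForm w v := by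
  rw [sympForm, sympForm, ← Finset.sum_neg_distrib]
  exact Finset.sum_congr rfl fun i _ => by ring

/-- Every character of `ℤ_ℓ^{2g}` with values in `ℤ/ℓ^N` is a symplectic pairing. -/
theorem exists_sympForm_eq {N : ℕ} (χ : (Fin g ⊕ Fin g → ℤ_[ℓ]) →+ ZMod (ℓ ^ N)) :
    ∃ u, ∀ v, χ v = PadicInt.toZModPow N (sympForm v u) := by
  have hc : ∀ j, ∃ d : ℤ_[ℓ], PadicInt.toZModPow N d = χ (Pi.single j 1) := fun j =>
    ZMod.ringHom_surjective (PadicInt.toZModPow N) _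
  choose d hd using hc
  let u : Fin g ⊕ Fin g → ℤ_[ℓ] :=
    Sum.elim (fun i => -d (Sum.inr i)) (fun i => d (Sum.inl i))
  let B : (Fin g ⊕ Fin g → ℤ_[ℓ]) →+ ZMod (ℓ ^ N) :=
    { toFun := fun v => PadicInt.toZModPow N (sympForm v u)
      map_zero' := by simp [sympForm]
      map_add' := fun v w => by rw [sympForm_add_left, map_add] }
  have hB : χ = B := by
    refine pi_padicInt_hom_ext ⟨N, fun h => by simp⟩ ?_
    rintro (i | i)
    · change _ = PadicInt.toZModPow N (sympForm _ u)
      rw [sympForm_inl, ← hd]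
      rfl
    · change _ = PadicInt.toZModPow N (sympForm _ u)
      rw [sympForm_inr, ← hd]
      simp [u]
  exact ⟨u, fun v => DFunLike.congr_fun hB v⟩

theorem pow_nsmul_zmodToCircle (s : ℕ) (c : ℤ_[ℓ]) :
    ℓ ^ s • zmodToCircle (ℓ ^ (1 + s)) (PadicInt.toZModPow (1 + s) c) =
      zmodToCircle (ℓ ^ 1) (PadicInt.toZModPow 1 c) := by
  obtain ⟨k, hk⟩ := ZMod.intCast_surjective (PadicInt.toZModPow (1 + s) c)
  have h1 : PadicInt.toZModPow 1 c = (k : ZMod (ℓ ^ 1)) := by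
    have := congrArg (ZMod.castHom (pow_dvd_pow ℓ (show 1 ≤ 1 + s by omega)) (ZMod (ℓ ^ 1))) hk
    rw [map_intCast, ← RingHom.comp_apply, PadicInt.zmod_cast_comp_toZModPow _ _ (by omega)] at this
    exact this.symm
  rw [← hk, h1, zmodToCircle_intCast, zmodToCircle_intCast, ← AddCircle.coe_nsmul]
  congr 1
  have hne : (ℓ : ℚ) ≠ 0 := Nat.cast_ne_zero.2 hl.out.ne_zero
  rw [nsmul_eq_mul]
  push_cast
  rw [pow_add]
  field_simp

theorem shiftMap_apply (n : ℕ) (M : SkewSymp ℓ g) (v : Fin g ⊕ Fin g → ℤ_[ℓ]) :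
    shiftMap n M v = M.1.mulVec v + (ℓ : ℤ_[ℓ]) ^ n • v := rfl

theorem sympForm_shiftMap (n : ℕ) (M : SkewSymp ℓ g) (v w : Fin g ⊕ Fin g → ℤ_[ℓ]) :
    sympForm (shiftMap n M v) w = -sympForm v (shiftMap n M w) +
      2 * (ℓ : ℤ_[ℓ]) ^ n * sympForm v w := by
  rw [shiftMap_apply, shiftMap_apply, sympForm_add_left, sympForm_add_right, sympForm_smul_left,
    sympForm_smul_right, SkewSymp.skew]
  ring

/-- If `⟨•, u⟩` is a character of the cokernel modulo `ℓ^(1+s)`, then `u` is an eigenvector of `M`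
modulo `ℓ^(1+s)`. -/
theorem exists_shiftMap_eq {s : ℕ} {M : SkewSymp ℓ g} {u : Fin g ⊕ Fin g → ℤ_[ℓ]}
    (h : ∀ v, PadicInt.toZModPow (1 + s) (sympForm (shiftMap 1 M v) u) = 0) :
    ∃ k, shiftMap 1 M u = (ℓ : ℤ_[ℓ]) ^ 1 • ((2 : ℤ_[ℓ]) • u + (ℓ : ℤ_[ℓ]) ^ s • k) := by
  have h2 : ∀ v, PadicInt.toZModPow (1 + s)
      (sympForm v (shiftMap 1 M u + (-(2 * (ℓ : ℤ_[ℓ]) ^ 1)) • u)) = 0 := by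
    intro v
    rw [← neg_eq_zero, ← map_neg, ← h v, sympForm_shiftMap, sympForm_add_right, sympForm_smul_right]
    congr 1
    ring
  obtain ⟨k, hk⟩ := exists_smul_of_sympForm h2
  refine ⟨k, ?_⟩
  ext j
  have hj := congrFun hk j
  simp only [Pi.add_apply, Pi.smul_apply, smul_eq_mul] at hj ⊢
  linear_combination hj

/-- The composition of a homomorphism from the cokernel with the projection. -/
noncomputable def cokerComp {n : ℕ} {M : SkewSymp ℓ g} {G : Type*} [AddCommGroup G]
    (f : LinCoker n M →+ G) : (Fin g ⊕ Fin g → ℤ_[ℓ]) →+ G :=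
  f.comp (LinearMap.range (shiftMap n M)).mkQ.toAddMonoidHom

theorem cokerComp_apply {n : ℕ} {M : SkewSymp ℓ g} {G : Type*} [AddCommGroup G]
    (f : LinCoker n M →+ G) (v : Fin g ⊕ Fin g → ℤ_[ℓ]) :
    cokerComp f v = f (toCoker n M v) := rfl

theorem cokerComp_shiftMap {n : ℕ} {M : SkewSymp ℓ g} {G : Type*} [AddCommGroup G]
    (f : LinCoker n M →+ G) (v : Fin g ⊕ Fin g → ℤ_[ℓ]) : cokerComp f (shiftMap n M v) = 0 := by
  rw [cokerComp_apply, toCoker_shiftMap, map_zero]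

/-- The element ∑ e_i ∧ f_i is dual to the symplectic form, so evaluating it at the characters ⟨•,
u⟩ and ⟨•, w⟩ returns ⟨u, w⟩. -/
theorem tensorEval_push_linOmega {N n : ℕ} {M : SkewSymp ℓ g} {G : Type*} [AddCommGroup G]
    (f : LinCoker n M →+ G) (a b : G →+ ZMod (ℓ ^ N)) {u w : Fin g ⊕ Fin g → ℤ_[ℓ]}
    (hu : ∀ v, a (cokerComp f v) = PadicInt.toZModPow N (sympForm v u))
    (hw : ∀ v, b (cokerComp f v) = PadicInt.toZModPow N (sympForm v w)) :
    tensorEval a b (tensorSq f (linOmega n M)) = PadicInt.toZModPow N (sympForm u w) := by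
  rw [linOmega, map_sum, map_sum, sympForm, map_sum]
  refine Finset.sum_congr rfl fun i _ => ?_
  rw [map_sub, map_sub]
  change a (cokerComp f _) * b (cokerComp f _) - a (cokerComp f _) * b (cokerComp f _) = _
  rw [hu, hu, hw, hw, sympForm_inl, sympForm_inr, sympForm_inl, sympForm_inr]
  simp only [map_neg, map_sub, map_mul]
  ring

/-- If characters α and β are represented by u and w, then ψ sends a multiple ℓ^s α to the class of
(M + ℓ)u/ℓ. The compatibility identity is ⟨(M + ℓ)u, w⟩ + ⟨u, (M + ℓ)w⟩ = 2ℓ⟨u, w⟩ divided by ℓ. The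
data are pushed to G because the cokernel itself may be infinite. -/
theorem isBEG_push_linData (hodd : ℓ ≠ 2) {r : ℕ} {lam : Fin r → ℕ} {M : SkewSymp ℓ g}
    (f : LinCoker 1 M →+ CycProd ℓ lam) : ((linData 1 M).push f).IsBEG where
  omega_mem := by
    change tensorSq f (linOmega 1 M) ∈ _
    rw [linOmega, map_sum]
    refine sum_mem fun i _ => ?_
    rw [map_sub]
    exact AddSubgroup.subset_closure ⟨_, _, rfl⟩
  omega_torsion := by
    refine tensor_eq_zero_of_tensorEval _ fun s a b => ?_
    obtain ⟨u, hu⟩ := exists_sympForm_eq (a.comp (cokerComp f))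
    obtain ⟨w, hw⟩ := exists_sympForm_eq (b.comp (cokerComp f))
    have hu0 : ∀ v, PadicInt.toZModPow (1 + s) (sympForm (shiftMap 1 M v) u) = 0 := fun v => by
      rw [← hu, AddMonoidHom.comp_apply, cokerComp_shiftMap, map_zero]
    have hw0 : ∀ v, PadicInt.toZModPow (1 + s) (sympForm (shiftMap 1 M v) w) = 0 := fun v => by
      rw [← hw, AddMonoidHom.comp_apply, cokerComp_shiftMap, map_zero]
    rw [map_nsmul]
    change ℓ ^ 1 • tensorEval a b (tensorSq f (linOmega 1 M)) = 0
    rw [tensorEval_push_linOmega f a b hu hw]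
    obtain ⟨k, hk⟩ := exists_shiftMap_eq hu0
    -- The vector w pairs to zero with the image of M + ℓ. At (M + ℓ)u, which is 2ℓu modulo ℓ^(1+s),
    -- this says that 2ℓ⟨u, w⟩ vanishes.
    have h1 := hw0 u
    rw [hk, sympForm_smul_left, sympForm_add_left, sympForm_smul_left, sympForm_smul_left] at h1
    refine eq_zero_of_two_nsmul hl.out hodd (N := 1 + s) (by simp) ?_
    rw [← map_nsmul, ← map_nsmul]
    have h2 : 2 • ℓ ^ 1 • sympForm u w = (ℓ : ℤ_[ℓ]) ^ 1 * (2 * sympForm u w +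
        (ℓ : ℤ_[ℓ]) ^ s * sympForm k w) - (ℓ : ℤ_[ℓ]) ^ (1 + s) * sympForm k w := by
      simp only [nsmul_eq_mul]
      push_cast
      ring
    rw [h2, map_sub, h1, zero_sub, neg_eq_zero]
    exact toZModPow_eq_zero.2 ⟨_, rfl⟩
  compat s a b := by
    obtain ⟨u, hu⟩ := exists_sympForm_eq (a.comp (cokerComp f))
    obtain ⟨w, hw⟩ := exists_sympForm_eq (b.comp (cokerComp f))
    have hu0 : ∀ v, PadicInt.toZModPow (1 + s) (sympForm (shiftMap 1 M v) u) = 0 := fun v => by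
      rw [← hu, AddMonoidHom.comp_apply, cokerComp_shiftMap, map_zero]
    have hw0 : ∀ v, PadicInt.toZModPow (1 + s) (sympForm (shiftMap 1 M v) w) = 0 := fun v => by
      rw [← hw, AddMonoidHom.comp_apply, cokerComp_shiftMap, map_zero]
    obtain ⟨k, hk⟩ := exists_shiftMap_eq hu0
    obtain ⟨m, hm⟩ := exists_shiftMap_eq hw0
    -- If c is ⟨•, v⟩/ℓ^(1+s), then its multiple by ℓ^s is ⟨•, v⟩/ℓ, so v is the numerator of a lift
    -- as required by ψ.
    have hlift : ∀ (c : CycProd ℓ lam →+ ZMod (ℓ ^ (1 + s))) (v k : Fin g ⊕ Fin g → ℤ_[ℓ]),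
        (∀ y, c.comp (cokerComp f) y = PadicInt.toZModPow (1 + s) (sympForm y v)) →
        shiftMap 1 M v = (ℓ : ℤ_[ℓ]) ^ 1 • ((2 : ℤ_[ℓ]) • v + (ℓ : ℤ_[ℓ]) ^ s • k) →
        (((linData 1 M).push f).psi (scaledChar c) : CycProd ℓ lam) =
          cokerComp f ((2 : ℤ_[ℓ]) • v + (ℓ : ℤ_[ℓ]) ^ s • k) := by
      intro c v k hv hk
      have hsn : IsSnakeLift 1 M (torsDual (ℓ ^ 1) f (scaledChar c)).1 v
          ((2 : ℤ_[ℓ]) • v + (ℓ : ℤ_[ℓ]) ^ s • k) := by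
        refine ⟨fun y => ?_, hk⟩
        rw [← pow_nsmul_zmodToCircle, ← hv]
        rfl
      change f (linPsi 1 M (torsDual (ℓ ^ 1) f (scaledChar c))) = _
      rw [linPsi_eq _ hsn]
      rfl
    rw [hlift a u k hu hk, hlift b w m hw hm]
    change zmodToCircle _ ((b.comp (cokerComp f)) _) = zmodToCircle _ ((a.comp (cokerComp f)) _) +
      2 • zmodToCircle _ (tensorEval a b (tensorSq f (linOmega 1 M)))
    rw [tensorEval_push_linOmega f a b hu hw, hu, hw, ← map_nsmul, ← map_add]
    congr 1
    rw [← map_nsmul, ← map_add]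
    congr 1
    have hp : (ℓ : ℤ_[ℓ]) ^ 1 ≠ 0 := by exact_mod_cast ell_pow_ne_zero (ℓ := ℓ) 1
    have h1 := sympForm_shiftMap 1 M u w
    rw [hk, hm, sympForm_smul_left, sympForm_smul_right] at h1
    -- Division by ℓ takes place in ℤ_ℓ, before reducing modulo ℓ^(1+s), so no precision is lost.
    have h2 := mul_left_cancel₀ hp (h1.trans (b := _) (c := (ℓ : ℤ_[ℓ]) ^ 1 *
      (-sympForm u ((2 : ℤ_[ℓ]) • w + (ℓ : ℤ_[ℓ]) ^ s • m) + 2 * sympForm u w)) (by ring))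
    rw [h2, sympForm_swap u]
    simp

end LinearModelEnhanced

/-! ### Haar measure and finite quotients -/

section HaarOnFiniteQuotients

open MeasureTheory

/-- A surjection from a compact group onto a finite group, with open fibres, pushes an invariant
probability measure to the uniform distribution. -/
theorem measure_preimage_finite {X A : Type*} [AddGroup X] [MeasurableSpace X] [MeasurableAdd X]
    [AddGroup A] [Finite A] (μ : Measure X) [μ.IsAddLeftInvariant] (hμ : μ Set.univ = 1)
    (Φ : X →+ A) (hmeas : ∀ a, MeasurableSet (Φ ⁻¹' {a})) (hsurj : Function.Surjective Φ)
    (T : Set A) : μ (Φ ⁻¹' T) = (Nat.card T : ℝ≥0∞) / Nat.card A := by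
  have hfin : Fintype A := Fintype.ofFinite A
  have hpt : ∀ a, μ (Φ ⁻¹' {a}) = μ (Φ ⁻¹' {0}) := by
    intro a
    obtain ⟨x, rfl⟩ := hsurj a
    rw [← measure_preimage_add μ x (Φ ⁻¹' {Φ x})]
    congr 1
    ext y
    simp
  have hset : ∀ S : Set A, μ (Φ ⁻¹' S) = Nat.card S * μ (Φ ⁻¹' {0}) := by
    intro S
    have hS : Φ ⁻¹' S = ⋃ a ∈ S.toFinite.toFinset, Φ ⁻¹' {a} := by
      ext y
      simp
    rw [hS, measure_biUnion_finset _ fun a _ => hmeas a]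
    · rw [Finset.sum_congr rfl fun a _ => hpt a, Finset.sum_const, nsmul_eq_mul,
        Nat.card_coe_set_eq, Set.ncard_eq_toFinset_card S S.toFinite]
    · intro a _ b _ hab
      exact (Set.disjoint_singleton.2 hab).preimage Φ
  have hone : (Nat.card A : ℝ≥0∞) * μ (Φ ⁻¹' {0}) = 1 := by
    rw [← hμ, ← Set.preimage_univ (f := Φ), hset Set.univ, Nat.card_univ]
  rw [hset, div_eq_mul_inv]
  congr 1
  exact ENNReal.eq_inv_of_mul_eq_one_left ((mul_comm _ _).trans hone)

/-- Double counting for measures: if every point of `S` lies in exactly `N` of the sets `E j`, and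
every other point in none, then `N μ(S) = ∑ μ(E j)`. -/
theorem card_mul_measure_eq_sum {X ι : Type*} [Fintype ι] [MeasurableSpace X] (μ : Measure X)
    (E : ι → Set X) (hE : ∀ j, MeasurableSet (E j)) (S : Set X) (N : ℕ) (hN : N ≠ 0)
    (hin : ∀ x ∈ S, Nat.card {j // x ∈ E j} = N) (hout : ∀ j, E j ⊆ S) :
    (N : ℝ≥0∞) * μ S = ∑ j, μ (E j) := by
  classical
  have hS : S = ⋃ j, E j := by
    refine Set.Subset.antisymm (fun x hx => ?_) (Set.iUnion_subset hout)
    have : Nat.card {j // x ∈ E j} ≠ 0 := by rw [hin x hx]; exact hN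
    obtain ⟨⟨j, hj⟩⟩ := (Nat.card_ne_zero.1 this).1
    exact Set.mem_iUnion.2 ⟨j, hj⟩
  have hSm : MeasurableSet S := hS ▸ MeasurableSet.iUnion hE
  rw [← lintegral_indicator_const hSm, Finset.sum_congr rfl fun j _ =>
    (lintegral_indicator_one (hE j)).symm, ← lintegral_finsetSum]
  · refine lintegral_congr fun x => ?_
    have h1 : ∑ j, (E j).indicator (1 : X → ℝ≥0∞) x = (Nat.card {j // x ∈ E j} : ℝ≥0∞) := by
      rw [Nat.card_eq_fintype_card, Fintype.card_subtype, ← Finset.sum_boole]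
      exact Finset.sum_congr rfl fun j _ => by simp [Set.indicator_apply]
    rw [h1]
    by_cases hx : x ∈ S
    · rw [Set.indicator_of_mem hx, hin x hx]
    · rw [Set.indicator_of_notMem hx]
      have : IsEmpty {j // x ∈ E j} := ⟨fun j => hx (hout _ j.2)⟩
      simp
  · exact fun j _ => measurable_one.indicator (hE j)

theorem isOpen_toZModPow_fiber {ℓ : ℕ} [Fact ℓ.Prime] (n : ℕ) (a : ZMod (ℓ ^ n)) :
    IsOpen {x : ℤ_[ℓ] | PadicInt.toZModPow n x = a} := by
  rw [Metric.isOpen_iff]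
  intro x hx
  refine ⟨(ℓ : ℝ) ^ (-n : ℤ), zpow_pos (by exact_mod_cast (Fact.out : ℓ.Prime).pos) _, fun y hy => ?_⟩
  rw [Metric.mem_ball, dist_eq_norm] at hy
  have h := (PadicInt.norm_le_pow_iff_mem_span_pow _ n).1 hy.le
  rw [← PadicInt.ker_toZModPow, RingHom.mem_ker, map_sub, sub_eq_zero] at h
  exact h.trans hx

theorem isOpen_toZModPow_comp {ℓ : ℕ} [Fact ℓ.Prime] {X : Type*} [TopologicalSpace X] (n : ℕ)
    {f : X → ℤ_[ℓ]} (hf : Continuous f) (S : Set (ZMod (ℓ ^ n))) :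
    IsOpen {x | PadicInt.toZModPow n (f x) ∈ S} := by
  have : {x | PadicInt.toZModPow n (f x) ∈ S} =
      ⋃ a ∈ S, f ⁻¹' {x : ℤ_[ℓ] | PadicInt.toZModPow n x = a} := by
    ext x
    simp
  rw [this]
  exact isOpen_biUnion fun a _ => (isOpen_toZModPow_fiber n a).preimage hf

end HaarOnFiniteQuotients

/-! ### Matrices with a given column span -/

section ElementaryDivisors

variable {ℓ : ℕ} [hl : Fact ℓ.Prime]

theorem toZMod_eq_zero_iff {a : ℤ_[ℓ]} : PadicInt.toZMod a = 0 ↔ (ℓ : ℤ_[ℓ]) ∣ a := by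
  rw [← RingHom.mem_ker, PadicInt.ker_toZMod, PadicInt.maximalIdeal_eq_span_p,
    Ideal.mem_span_singleton]

theorem isUnit_iff_toZMod_ne_zero {a : ℤ_[ℓ]} : IsUnit a ↔ PadicInt.toZMod a ≠ 0 := by
  rw [Ne, ← RingHom.mem_ker, PadicInt.ker_toZMod, IsLocalRing.mem_maximalIdeal, mem_nonunits_iff,
    not_not]

theorem toZModPow_eq_iff_dvd {n : ℕ} {a b : ℤ_[ℓ]} :
    PadicInt.toZModPow n a = PadicInt.toZModPow n b ↔ (ℓ : ℤ_[ℓ]) ^ n ∣ a - b := by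
  rw [← sub_eq_zero, ← map_sub, toZModPow_eq_zero]
  rfl

theorem toZMod_eq_iff_dvd {a b : ℤ_[ℓ]} :
    PadicInt.toZMod a = PadicInt.toZMod b ↔ (ℓ : ℤ_[ℓ]) ∣ a - b := by
  rw [← sub_eq_zero, ← map_sub, toZMod_eq_zero_iff]

theorem toZMod_natCast_val (c : ZMod ℓ) : PadicInt.toZMod ((c.val : ℕ) : ℤ_[ℓ]) = c := by
  rw [map_natCast, ZMod.natCast_zmod_val]

theorem padicInt_pow_ne_zero (n : ℕ) : (ℓ : ℤ_[ℓ]) ^ n ≠ 0 := by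
  exact_mod_cast ell_pow_ne_zero (ℓ := ℓ) n

variable {r : ℕ} {lam : Fin r → ℕ} {κ : Type*} [Fintype κ] [DecidableEq κ]

/-- The diagonal entries `ℓ^(λ_i)` on the first block, and `1` on the second. -/
noncomputable def elemDiv (ℓ : ℕ) [Fact ℓ.Prime] {r : ℕ} (lam : Fin r → ℕ) (κ : Type*) :
    Fin r ⊕ κ → ℤ_[ℓ] :=
  Sum.elim (fun i => (ℓ : ℤ_[ℓ]) ^ (lam i + 1)) fun _ => 1

theorem elemDiv_ne_zero (p : Fin r ⊕ κ) : elemDiv ℓ lam κ p ≠ 0 := by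
  rcases p with i | k
  · exact padicInt_pow_ne_zero _
  · exact one_ne_zero

theorem exists_eq_diagonal_mul (B : Matrix (Fin r ⊕ κ) (Fin r ⊕ κ) ℤ_[ℓ])
    (h : ∀ p q, elemDiv ℓ lam κ p ∣ B p q) :
    ∃ E, B = Matrix.diagonal (elemDiv ℓ lam κ) * E := by
  choose E hE using h
  exact ⟨Matrix.of E, by ext p q; rw [Matrix.diagonal_mul]; exact hE p q⟩

theorem diagonal_elemDiv_mul_cancel {E E' : Matrix (Fin r ⊕ κ) (Fin r ⊕ κ) ℤ_[ℓ]}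
    (h : Matrix.diagonal (elemDiv ℓ lam κ) * E = Matrix.diagonal (elemDiv ℓ lam κ) * E') :
    E = E' := by
  ext p q
  have h1 := congrFun (congrFun h p) q
  rw [Matrix.diagonal_mul, Matrix.diagonal_mul] at h1
  exact mul_left_cancel₀ (elemDiv_ne_zero p) h1

/-- `D E` has the same column span as `D` exactly if `E` is invertible. -/
theorem range_diagonal_mul_iff (E : Matrix (Fin r ⊕ κ) (Fin r ⊕ κ) ℤ_[ℓ]) :
    (∀ y, (∀ p, elemDiv ℓ lam κ p ∣ y p) ↔
      ∃ w, (Matrix.diagonal (elemDiv ℓ lam κ) * E).mulVec w = y) ↔ IsUnit E.det := by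
  constructor
  · intro h
    have h1 : ∀ q, ∃ w, (Matrix.diagonal (elemDiv ℓ lam κ) * E).mulVec w =
        Pi.single q (elemDiv ℓ lam κ q) := by
      intro q
      refine (h _).1 fun p => ?_
      by_cases hp : p = q
      · subst hp; simp
      · simp [Pi.single_eq_of_ne hp]
    choose w hw using h1
    have h2 : E * (Matrix.of w).transpose = 1 := by
      refine diagonal_elemDiv_mul_cancel (lam := lam) ?_
      rw [mul_one, ← mul_assoc]
      ext p q
      have h3 := congrFun (hw q) p
      rw [Matrix.mul_apply']
      refine Eq.trans h3 ?_
      by_cases hp : p = q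
      · subst hp; simp
      · simp [Pi.single_eq_of_ne hp, Matrix.diagonal_apply_ne _ hp]
    exact Matrix.isUnit_det_of_right_inverse h2
  · intro hE y
    constructor
    · intro hy
      choose z hz using hy
      refine ⟨E⁻¹.mulVec z, ?_⟩
      rw [Matrix.mulVec_mulVec, mul_assoc, Matrix.mul_nonsing_inv _ hE, mul_one]
      ext p
      rw [Matrix.mulVec_diagonal, hz]
    · rintro ⟨w, rfl⟩ p
      rw [← Matrix.mulVec_mulVec, Matrix.mulVec_diagonal]
      exact dvd_mul_right _ _

variable (C : Matrix (Fin r) (Fin r) (ZMod ℓ)) (B : Matrix (Fin r ⊕ κ) (Fin r ⊕ κ) ℤ_[ℓ])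

/-- Modulo ℓ, the matrix E is block triangular. Its lower left block is that of B, which by symmetry
modulo ℓ agrees with the transposed upper right block, and the latter is divisible by ℓ. The leading
block of E is C. -/
theorem det_map_toZMod_of_eq_diagonal_mul {E : Matrix (Fin r ⊕ κ) (Fin r ⊕ κ) ℤ_[ℓ]}
    (hB : B = Matrix.diagonal (elemDiv ℓ lam κ) * E)
    (hsym : ∀ p q, (ℓ : ℤ_[ℓ]) ∣ B p q - B q p)
    (hC : ∀ i j, (ℓ : ℤ_[ℓ]) ^ (lam i + 2) ∣
      B (Sum.inl i) (Sum.inl j) - (ℓ : ℤ_[ℓ]) ^ (lam i + 1) * ((C i j).val : ℤ_[ℓ])) :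
    PadicInt.toZMod E.det = C.det * (B.toBlocks₂₂.map PadicInt.toZMod).det := by
  have h11 : (E.map PadicInt.toZMod).toBlocks₁₁ = C := by
    ext i j
    have h := hC i j
    rw [hB, Matrix.diagonal_mul] at h
    change _ ∣ (ℓ : ℤ_[ℓ]) ^ (lam i + 1) * _ - _ at h
    rw [← mul_sub, pow_succ _ (lam i + 1)] at h
    have h' := (mul_dvd_mul_iff_left (padicInt_pow_ne_zero _)).1 h
    change PadicInt.toZMod _ = _
    rw [toZMod_eq_iff_dvd.2 h', toZMod_natCast_val]
  have hbot : ∀ k q, B (Sum.inr k) q = E (Sum.inr k) q := by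
    intro k q
    rw [hB, Matrix.diagonal_mul]
    exact one_mul _
  have h21 : (E.map PadicInt.toZMod).toBlocks₂₁ = 0 := by
    ext k i
    change PadicInt.toZMod (E (Sum.inr k) (Sum.inl i)) = 0
    rw [toZMod_eq_zero_iff, ← hbot, ← dvd_sub_left (b := B (Sum.inr k) (Sum.inl i))
      (c := B (Sum.inl i) (Sum.inr k))]
    · exact hsym _ _
    · rw [hB, Matrix.diagonal_mul]
      exact Dvd.dvd.mul_right (dvd_pow_self _ (Nat.succ_ne_zero _)) _
  have h22 : (E.map PadicInt.toZMod).toBlocks₂₂ = B.toBlocks₂₂.map PadicInt.toZMod := by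
    ext k k'
    change PadicInt.toZMod _ = PadicInt.toZMod _
    rw [← hbot]
    rfl
  rw [RingHom.map_det, RingHom.mapMatrix_apply, ← Matrix.fromBlocks_toBlocks (E.map _), h21,
    Matrix.det_fromBlocks_zero₂₁, h11, h22]

/-- A matrix which is symmetric modulo `ℓ`, with leading block `≡ ℓ^(λ_i) C_ij`, has column span
`D ℤ_ℓ^N` exactly if its first rows are divisible by the `ℓ^(λ_i)`, and both `C` and its last
block are invertible modulo `ℓ`. -/
theorem range_eq_elemDiv_iff (hsym : ∀ p q, (ℓ : ℤ_[ℓ]) ∣ B p q - B q p)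
    (hC : ∀ i j, (ℓ : ℤ_[ℓ]) ^ (lam i + 2) ∣
      B (Sum.inl i) (Sum.inl j) - (ℓ : ℤ_[ℓ]) ^ (lam i + 1) * ((C i j).val : ℤ_[ℓ])) :
    (∀ y, (∀ p, elemDiv ℓ lam κ p ∣ y p) ↔ ∃ w, B.mulVec w = y) ↔
      C.det ≠ 0 ∧ (∀ i k, (ℓ : ℤ_[ℓ]) ^ (lam i + 1) ∣ B (Sum.inl i) (Sum.inr k)) ∧
        (B.toBlocks₂₂.map PadicInt.toZMod).det ≠ 0 := by
  constructor
  · intro h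
    have hdvd : ∀ p q, elemDiv ℓ lam κ p ∣ B p q := by
      intro p q
      have := (h (B.mulVec (Pi.single q 1))).2 ⟨_, rfl⟩ p
      rwa [Matrix.mulVec_single_one] at this
    obtain ⟨E, hE⟩ := exists_eq_diagonal_mul B hdvd
    have hu : IsUnit E.det := by rw [← range_diagonal_mul_iff (lam := lam), ← hE]; exact h
    rw [isUnit_iff_toZMod_ne_zero, det_map_toZMod_of_eq_diagonal_mul C B hE hsym hC] at hu
    exact ⟨left_ne_zero_of_mul hu, fun i k => hdvd _ _, right_ne_zero_of_mul hu⟩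
  · rintro ⟨h1, h2, h3⟩
    have hdvd : ∀ p q, elemDiv ℓ lam κ p ∣ B p q := by
      rintro (i | k) (j | k')
      · have := dvd_add ((pow_dvd_pow _ (Nat.le_succ (lam i + 1))).trans (hC i j))
          (dvd_mul_right ((ℓ : ℤ_[ℓ]) ^ (lam i + 1)) ((C i j).val : ℤ_[ℓ]))
        rwa [sub_add_cancel] at this
      · exact h2 i k'
      · exact one_dvd _
      · exact one_dvd _
    obtain ⟨E, hE⟩ := exists_eq_diagonal_mul B hdvd
    rw [hE, range_diagonal_mul_iff, isUnit_iff_toZMod_ne_zero,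
      det_map_toZMod_of_eq_diagonal_mul C B hE hsym hC]
    exact mul_ne_zero h1 h3

end ElementaryDivisors

/-! ### Completing a generating tuple to a basis -/

section RowCompletion

variable {ℓ : ℕ} [hl : Fact ℓ.Prime] {r : ℕ} {lam : Fin r → ℕ} {I : Type*} [Fintype I]

/-- A lift of `x : I → G` to an `r × I` matrix over `ℤ_ℓ`. -/
noncomputable def tupleLift (x : I → CycProd ℓ lam) : Matrix (Fin r) I ℤ_[ℓ] :=
  Matrix.of fun i k => ((x k i).val : ℤ_[ℓ])

theorem toZModPow_tupleLift (x : I → CycProd ℓ lam) (i : Fin r) (k : I) :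
    PadicInt.toZModPow (lam i + 1) (tupleLift x i k) = x k i := by
  rw [tupleLift, Matrix.of_apply, map_natCast, ZMod.natCast_zmod_val]

theorem tupleHom_eq_mulVec (x : I → CycProd ℓ lam) (v : I → ℤ_[ℓ]) (i : Fin r) :
    tupleHom x v i = PadicInt.toZModPow (lam i + 1) ((tupleLift x).mulVec v i) := by
  rw [tupleHom_apply, Matrix.mulVec, dotProduct, map_sum]
  exact Finset.sum_congr rfl fun k _ => by rw [map_mul, toZModPow_tupleLift, mul_comm]

theorem tupleHom_eq_zero_iff (x : I → CycProd ℓ lam) (v : I → ℤ_[ℓ]) :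
    tupleHom x v = 0 ↔ ∀ i, (ℓ : ℤ_[ℓ]) ^ (lam i + 1) ∣ (tupleLift x).mulVec v i := by
  rw [funext_iff]
  refine forall_congr' fun i => ?_
  rw [tupleHom_eq_mulVec]
  exact toZModPow_eq_zero

/-- Pairing a linear relation among the rows with the reduction of a preimage of e_i shows that its
i-th coefficient vanishes. -/
theorem linearIndependent_tupleLift (x : I → CycProd ℓ lam)
    (hx : Function.Surjective (tupleHom x)) :
    LinearIndependent (ZMod ℓ) ((tupleLift x).map PadicInt.toZMod).row := by
  rw [← Matrix.vecMul_injective_iff]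
  have h0 : ∀ w, Matrix.vecMul w ((tupleLift x).map PadicInt.toZMod) = 0 → w = 0 := by
    intro w hw
    ext i
    obtain ⟨v, hv⟩ := hx (Pi.single i 1)
    have h1 : ((tupleLift x).map PadicInt.toZMod).mulVec (fun k => PadicInt.toZMod (v k)) =
        Pi.single i 1 := by
      ext j
      have h2 : PadicInt.toZModPow (lam j + 1) ((tupleLift x).mulVec v j) =
          PadicInt.toZModPow (lam j + 1) ((Pi.single i 1 : Fin r → ℤ_[ℓ]) j) := by
        rw [← tupleHom_eq_mulVec, hv]
        by_cases hj : j = i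
        · subst hj; rw [Pi.single_eq_same, Pi.single_eq_same, map_one]
        · rw [Pi.single_eq_of_ne hj, Pi.single_eq_of_ne hj, map_zero]
      have h3 := toZMod_eq_iff_dvd.2 ((dvd_pow_self (ℓ : ℤ_[ℓ]) (Nat.succ_ne_zero (lam j))).trans
        (toZModPow_eq_iff_dvd.1 h2))
      have h4 : PadicInt.toZMod ((Pi.single i 1 : Fin r → ℤ_[ℓ]) j) =
          (Pi.single i 1 : Fin r → ZMod ℓ) j := by
        by_cases hj : j = i
        · subst hj; rw [Pi.single_eq_same, Pi.single_eq_same, map_one]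
        · rw [Pi.single_eq_of_ne hj, Pi.single_eq_of_ne hj, map_zero]
      rw [← h4, ← h3, Matrix.mulVec, dotProduct, Matrix.mulVec, dotProduct, map_sum]
      exact Finset.sum_congr rfl fun k _ => (map_mul PadicInt.toZMod (tupleLift x j k) (v k)).symm
    have h5 := Matrix.dotProduct_mulVec w ((tupleLift x).map PadicInt.toZMod)
      (fun k => PadicInt.toZMod (v k))
    rw [hw, h1, zero_dotProduct, dotProduct_single_one] at h5
    exact h5
  intro w w' h
  rw [← sub_eq_zero]
  exact h0 _ (by rw [Matrix.sub_vecMul, sub_eq_zero]; exact h)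

/-- A matrix whose rows are independent modulo `ℓ` can be completed to an invertible matrix. -/
theorem exists_row_completion (F : Matrix (Fin r) I ℤ_[ℓ])
    (hF : LinearIndependent (ZMod ℓ) (F.map PadicInt.toZMod).row) :
    ∃ (m : ℕ) (Q : Matrix (Fin m) I ℤ_[ℓ]) (R : Matrix I (Fin r ⊕ Fin m) ℤ_[ℓ]),
      r + m = Fintype.card I ∧ (∀ v, R.mulVec ((Matrix.fromRows F Q).mulVec v) = v) ∧
        ∀ w, (Matrix.fromRows F Q).mulVec (R.mulVec w) = w := by
  classical
  let b := Module.Basis.sumExtend hF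
  have hbF : ∀ i, b (Sum.inl i) = (F.map PadicInt.toZMod).row i := by
    intro i
    simp only [b, Module.Basis.sumExtend, Module.Basis.reindex_apply, Module.Basis.extend_apply_self]
    rfl
  have hfin : Finite (Fin r ⊕ (Module.Basis.sumExtendIndex hF)) :=
    Module.Finite.finite_basis b
  have hfin2 : Finite (Module.Basis.sumExtendIndex hF) :=
    Finite.of_injective (Sum.inr : _ → Fin r ⊕ _) Sum.inr_injective
  obtain ⟨m, ⟨em⟩⟩ := Finite.exists_equiv_fin (Module.Basis.sumExtendIndex hF)
  let b' := b.reindex (Equiv.sumCongr (Equiv.refl (Fin r)) em)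
  have hcard : Fintype.card (Fin r ⊕ Fin m) = Fintype.card I := by
    rw [← Module.finrank_eq_card_basis b', Module.finrank_fintype_fun_eq_card]
  let ec : Fin r ⊕ Fin m ≃ I := Fintype.equivOfCardEq hcard
  have hlift : ∀ c : ZMod ℓ, ∃ a : ℤ_[ℓ], PadicInt.toZMod a = c :=
    fun c => ⟨_, toZMod_natCast_val c⟩
  choose Q hQ using fun k j => hlift (b' (Sum.inr k) j)
  have hP : ((Matrix.fromRows F (Matrix.of Q)).map PadicInt.toZMod).row = b' := by
    ext (i | k) j
    · have : b' (Sum.inl i) = b (Sum.inl i) := by simp [b']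
      rw [this, hbF]
      rfl
    · exact hQ k j
  let P' := (Matrix.fromRows F (Matrix.of Q)).submatrix id ec
  have hu : IsUnit P'.det := by
    rw [isUnit_iff_toZMod_ne_zero, RingHom.map_det, RingHom.mapMatrix_apply, ← isUnit_iff_ne_zero,
      ← Matrix.isUnit_iff_isUnit_det, ← Matrix.linearIndependent_rows_iff_isUnit]
    have h1 : (P'.map PadicInt.toZMod).row =
        (LinearEquiv.funCongrLeft (ZMod ℓ) (ZMod ℓ) ec) ∘ b' := by
      rw [← hP]
      rfl
    rw [h1]
    exact b'.linearIndependent.map' _ (LinearEquiv.ker _)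
  have hP' : ∀ v : I → ℤ_[ℓ], (Matrix.fromRows F (Matrix.of Q)).mulVec v = P'.mulVec (v ∘ ec) := by
    intro v
    ext p
    exact (Equiv.sum_comp ec fun j => (Matrix.fromRows F (Matrix.of Q)) p j * v j).symm
  refine ⟨m, Matrix.of Q, (P'⁻¹).submatrix ec.symm id, by simpa using hcard, fun v => ?_,
    fun w => ?_⟩
  · rw [hP']
    ext j
    change (P'⁻¹.mulVec _) (ec.symm j) = _
    rw [Matrix.mulVec_mulVec, Matrix.nonsing_inv_mul _ hu, Matrix.one_mulVec]
    simp
  · rw [hP']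
    have : ((P'⁻¹).submatrix ec.symm id).mulVec w ∘ ec = P'⁻¹.mulVec w := by
      ext p
      simp [Matrix.mulVec, dotProduct]
    rw [this, Matrix.mulVec_mulVec, Matrix.mul_nonsing_inv _ hu, Matrix.one_mulVec]

end RowCompletion

/-! ### Presentations of the cokernel in adapted coordinates -/

section CokernelPresentation

variable {ℓ : ℕ} [hl : Fact ℓ.Prime] {g r m : ℕ} {lam : Fin r → ℕ}

theorem mul_eq_one_of_mulVec {α β : Type*} [Fintype α] [Fintype β] [DecidableEq α] {R : Type*}
    [CommRing R] {X : Matrix α β R} {Y : Matrix β α R} (h : ∀ v, X.mulVec (Y.mulVec v) = v) :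
    X * Y = 1 := by
  refine Matrix.ext_of_mulVec_single fun i => ?_
  rw [← Matrix.mulVec_mulVec, h, Matrix.one_mulVec]

/-- This trades skew-symplectic matrices for symmetric ones, whose entries on and above the diagonal
can be prescribed freely. -/
theorem SkewSymp.isSymm_mul_J (M : SkewSymp ℓ g) : (M.1 * Matrix.J (Fin g) ℤ_[ℓ]).IsSymm := by
  have h : M.1.transpose * Matrix.J (Fin g) ℤ_[ℓ] = Matrix.J (Fin g) ℤ_[ℓ] * (-M.1) :=
    (mem_skewAdjointMatricesSubmodule _ _).1 M.2
  have h2 : Matrix.J (Fin g) ℤ_[ℓ] * (M.1.transpose * Matrix.J (Fin g) ℤ_[ℓ]) *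
      Matrix.J (Fin g) ℤ_[ℓ] = Matrix.J (Fin g) ℤ_[ℓ] * (Matrix.J (Fin g) ℤ_[ℓ] * (-M.1)) *
      Matrix.J (Fin g) ℤ_[ℓ] := by rw [h]
  rw [mul_assoc, mul_assoc, Matrix.J_squared, ← mul_assoc (Matrix.J (Fin g) ℤ_[ℓ]) (Matrix.J _ _),
    Matrix.J_squared] at h2
  rw [Matrix.IsSymm, Matrix.transpose_mul, Matrix.J_transpose, neg_mul]
  simpa using h2

/-- The skew-symplectic matrix `M` with `M J = S`. -/
theorem SkewSymp.exists_mul_J_eq {S : Matrix (Fin g ⊕ Fin g) (Fin g ⊕ Fin g) ℤ_[ℓ]}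
    (hS : S.IsSymm) : ∃ M : SkewSymp ℓ g, M.1 * Matrix.J (Fin g) ℤ_[ℓ] = S := by
  refine ⟨⟨-(S * Matrix.J (Fin g) ℤ_[ℓ]), ?_⟩, ?_⟩
  · refine (mem_skewAdjointMatricesSubmodule _ _).2 ?_
    rw [Matrix.IsSkewAdjoint, Matrix.IsAdjointPair, neg_neg, Matrix.transpose_neg,
      Matrix.transpose_mul, Matrix.J_transpose, hS.eq, neg_mul, neg_mul, neg_mul, neg_neg,
      mul_assoc]
  · rw [neg_mul, mul_assoc, Matrix.J_squared, mul_neg, neg_neg, mul_one]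

/-- The Gram matrix of `M + ℓ`. -/
noncomputable def shiftForm (M : SkewSymp ℓ g) : Matrix (Fin g ⊕ Fin g) (Fin g ⊕ Fin g) ℤ_[ℓ] :=
  M.1 * Matrix.J (Fin g) ℤ_[ℓ] + (ℓ : ℤ_[ℓ]) • Matrix.J (Fin g) ℤ_[ℓ]

theorem shiftForm_mulVec (M : SkewSymp ℓ g) (q : Fin g ⊕ Fin g → ℤ_[ℓ]) :
    (shiftForm M).mulVec q = shiftMap 1 M ((Matrix.J (Fin g) ℤ_[ℓ]).mulVec q) := by
  rw [shiftForm, Matrix.add_mulVec, ← Matrix.mulVec_mulVec, Matrix.smul_mulVec, shiftMap_apply,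
    pow_one]

theorem mem_range_shiftMap_iff (M : SkewSymp ℓ g) (v : Fin g ⊕ Fin g → ℤ_[ℓ]) :
    v ∈ LinearMap.range (shiftMap 1 M) ↔ ∃ q, (shiftForm M).mulVec q = v := by
  constructor
  · rintro ⟨u, rfl⟩
    refine ⟨-(Matrix.J (Fin g) ℤ_[ℓ]).mulVec u, ?_⟩
    rw [shiftForm_mulVec, Matrix.mulVec_neg, Matrix.mulVec_mulVec, Matrix.J_squared,
      Matrix.neg_mulVec, neg_neg, Matrix.one_mulVec]
  · rintro ⟨q, rfl⟩
    exact ⟨_, (shiftForm_mulVec M q).symm⟩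

/-- The tuple `x` presents the cokernel of `M + ℓ` as `G`, and `C` is the matrix of the resulting
form. -/
def IsPresentation (x : Fin g ⊕ Fin g → CycProd ℓ lam) (C : Matrix (Fin r) (Fin r) (ZMod ℓ))
    (M : SkewSymp ℓ g) : Prop :=
  Function.Surjective (tupleHom x) ∧
    (∀ v, tupleHom x v = 0 ↔ v ∈ LinearMap.range (shiftMap 1 M)) ∧
    ∀ i j, (ℓ : ℤ_[ℓ]) ^ (lam i + 2) ∣ (tupleLift x * shiftForm M * (tupleLift x).transpose) i j -
      (ℓ : ℤ_[ℓ]) ^ (lam i + 1) * ((C i j).val : ℤ_[ℓ])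

theorem conj_fromRows_apply_inl {κ : Type*} [Fintype κ] {I : Type*} [Fintype I]
    (F : Matrix (Fin r) I ℤ_[ℓ]) (Q : Matrix κ I ℤ_[ℓ]) (S : Matrix I I ℤ_[ℓ]) (i j : Fin r) :
    (Matrix.fromRows F Q * S * (Matrix.fromRows F Q).transpose) (Sum.inl i) (Sum.inl j) =
      (F * S * F.transpose) i j := by
  rw [Matrix.transpose_fromRows, Matrix.fromRows_mul, Matrix.fromRows_mul_fromCols]
  rfl

/-- In the coordinates given by P, the kernel of x is the set of vectors divisible by the elementary
divisors, and the image of M + ℓ is the column span of B. The criterion for column spans then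
applies. -/
theorem isPresentation_iff_of_completion (x : Fin g ⊕ Fin g → CycProd ℓ lam)
    (C : Matrix (Fin r) (Fin r) (ZMod ℓ)) (M : SkewSymp ℓ g)
    (hx : Function.Surjective (tupleHom x)) {Q : Matrix (Fin m) (Fin g ⊕ Fin g) ℤ_[ℓ]}
    {R : Matrix (Fin g ⊕ Fin g) (Fin r ⊕ Fin m) ℤ_[ℓ]}
    (hRP : R * Matrix.fromRows (tupleLift x) Q = 1) (hPR : Matrix.fromRows (tupleLift x) Q * R = 1)
    {B : Matrix (Fin r ⊕ Fin m) (Fin r ⊕ Fin m) ℤ_[ℓ]}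
    (hB : B = Matrix.fromRows (tupleLift x) Q * shiftForm M *
      (Matrix.fromRows (tupleLift x) Q).transpose) :
    IsPresentation x C M ↔
      (∀ i j, (ℓ : ℤ_[ℓ]) ^ (lam i + 2) ∣
        B (Sum.inl i) (Sum.inl j) - (ℓ : ℤ_[ℓ]) ^ (lam i + 1) * ((C i j).val : ℤ_[ℓ])) ∧
      C.det ≠ 0 ∧ (∀ i k, (ℓ : ℤ_[ℓ]) ^ (lam i + 1) ∣ B (Sum.inl i) (Sum.inr k)) ∧
        (B.toBlocks₂₂.map PadicInt.toZMod).det ≠ 0 := by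
  -- The symmetric part MJ cancels in B - Bᵀ, leaving a multiple of 2ℓ.
  have hsym : ∀ p q, (ℓ : ℤ_[ℓ]) ∣ B p q - B q p := by
    intro p q
    have h1 : B - B.transpose = (ℓ : ℤ_[ℓ]) • (Matrix.fromRows (tupleLift x) Q *
        ((2 : ℤ_[ℓ]) • Matrix.J (Fin g) ℤ_[ℓ]) * (Matrix.fromRows (tupleLift x) Q).transpose) := by
      rw [hB, Matrix.transpose_mul, Matrix.transpose_mul, Matrix.transpose_transpose,
        ← Matrix.mul_assoc, ← Matrix.sub_mul, ← Matrix.mul_sub, shiftForm, Matrix.transpose_add, (SkewSymp.isSymm_mul_J M).eq,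
        Matrix.transpose_smul, Matrix.J_transpose, add_sub_add_left_eq_sub, ← smul_sub,
        sub_neg_eq_add, ← two_smul ℤ_[ℓ], Matrix.mul_smul, Matrix.smul_mul]
    refine ⟨_, congrFun (congrFun h1 p) q⟩
  -- The factor Pᵀ on the right of B is invertible and does not change the column span.
  have hker : (∀ v, tupleHom x v = 0 ↔ v ∈ LinearMap.range (shiftMap 1 M)) ↔
      ∀ y, (∀ p, elemDiv ℓ lam (Fin m) p ∣ y p) ↔ ∃ w, B.mulVec w = y := by
    have h1 : ∀ v, tupleHom x v = 0 ↔
        ∀ p, elemDiv ℓ lam (Fin m) p ∣ (Matrix.fromRows (tupleLift x) Q).mulVec v p := by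
      intro v
      rw [tupleHom_eq_zero_iff]
      constructor
      · rintro h (i | k)
        · exact h i
        · exact one_dvd _
      · exact fun h i => h (Sum.inl i)
    have h2 : ∀ v, v ∈ LinearMap.range (shiftMap 1 M) ↔
        ∃ w, B.mulVec w = (Matrix.fromRows (tupleLift x) Q).mulVec v := by
      intro v
      rw [mem_range_shiftMap_iff]
      have hPRt : (Matrix.fromRows (tupleLift x) Q).transpose * R.transpose = 1 := by
        rw [← Matrix.transpose_mul, hRP, Matrix.transpose_one]
      constructor
      · rintro ⟨q, rfl⟩
        refine ⟨R.transpose.mulVec q, ?_⟩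
        rw [hB, Matrix.mulVec_mulVec, Matrix.mulVec_mulVec, Matrix.mul_assoc _ _ R.transpose,
          hPRt, Matrix.mul_one]
      · rintro ⟨w, hw⟩
        refine ⟨(Matrix.fromRows (tupleLift x) Q).transpose.mulVec w, ?_⟩
        have := congrArg R.mulVec hw
        rwa [hB, Matrix.mulVec_mulVec, Matrix.mulVec_mulVec, Matrix.mul_assoc (Matrix.fromRows _ _),
          ← Matrix.mul_assoc, hRP, Matrix.one_mul, Matrix.one_mulVec, ← Matrix.mulVec_mulVec] at this
    constructor
    · intro h y
      have h3 := (h1 (R.mulVec y)).symm.trans ((h _).trans (h2 _))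
      rwa [Matrix.mulVec_mulVec, hPR, Matrix.one_mulVec] at h3
    · intro h v
      rw [h1, h2, h]
  have hform : ∀ i j, (tupleLift x * shiftForm M * (tupleLift x).transpose) i j =
      B (Sum.inl i) (Sum.inl j) := fun i j => by rw [hB, conj_fromRows_apply_inl]
  rw [IsPresentation, and_iff_right hx, and_comm]
  simp only [hform]
  refine and_congr_right fun hC => ?_
  rw [hker, range_eq_elemDiv_iff C B hsym hC]

end CokernelPresentation

/-! ### Congruences for the entries of a symmetric matrix -/

section SymmetricCongruences

variable {ℓ : ℕ} [hl : Fact ℓ.Prime] {r : ℕ} (lam : Fin r → ℕ)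

/-- Of `t i j` and `t j i`, the one with the larger modulus. -/
noncomputable def dominant (t : Fin r → Fin r → ℤ_[ℓ]) (i j : Fin r) : ℤ_[ℓ] :=
  if lam j ≤ lam i then t i j else t j i

/-- Congruences for the entries `s i j = s j i` amount to one congruence for each `i ≤ j`, provided
that the two prescribed values agree modulo the smaller modulus. -/
theorem symm_congruences_iff (s t : Fin r → Fin r → ℤ_[ℓ]) (hs : ∀ i j, s i j = s j i) :
    (∀ i j, (ℓ : ℤ_[ℓ]) ^ (lam i + 2) ∣ s i j - t i j) ↔
      (∀ i j, i < j → (ℓ : ℤ_[ℓ]) ^ (min (lam i) (lam j) + 2) ∣ t i j - t j i) ∧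
      ∀ i j, i ≤ j → (ℓ : ℤ_[ℓ]) ^ (max (lam i) (lam j) + 2) ∣ s i j - dominant lam t i j := by
  constructor
  · intro h
    constructor
    · intro i j _
      have h1 := (pow_dvd_pow _ (by omega : min (lam i) (lam j) + 2 ≤ lam i + 2)).trans (h i j)
      have h2 := (pow_dvd_pow _ (by omega : min (lam i) (lam j) + 2 ≤ lam j + 2)).trans (h j i)
      have h3 := dvd_sub h2 h1
      rwa [hs j i, sub_sub_sub_cancel_left] at h3
    · intro i j _
      rw [dominant]
      split_ifs with hle
      · rw [max_eq_left hle]; exact h i j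
      · rw [max_eq_right (by omega), hs]; exact h j i
  · rintro ⟨h1, h2⟩ 
    have h1' : ∀ i j, (ℓ : ℤ_[ℓ]) ^ (min (lam i) (lam j) + 2) ∣ t i j - t j i := by
      intro i j
      rcases lt_trichotomy i j with h | h | h
      · exact h1 i j h
      · rw [h, sub_self]; exact dvd_zero _
      · rw [min_comm, dvd_sub_comm]; exact h1 j i h
    have hd : ∀ i j, (ℓ : ℤ_[ℓ]) ^ (lam i + 2) ∣ dominant lam t i j - t i j ∧
        (ℓ : ℤ_[ℓ]) ^ (lam j + 2) ∣ dominant lam t i j - t j i := by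
      intro i j
      rw [dominant]
      split_ifs with hle
      · refine ⟨by rw [sub_self]; exact dvd_zero _, ?_⟩
        have := h1' i j
        rwa [min_eq_right hle] at this
      · refine ⟨?_, by rw [sub_self]; exact dvd_zero _⟩
        have := h1' j i
        rwa [min_eq_right (by omega)] at this
    intro i j
    rcases le_total i j with h | h
    · have h3 := (pow_dvd_pow _ (by omega : lam i + 2 ≤ max (lam i) (lam j) + 2)).trans (h2 i j h)
      have := dvd_add h3 (hd i j).1
      rwa [sub_add_sub_cancel] at this
    · have h3 := (pow_dvd_pow _ (by omega : lam i + 2 ≤ max (lam j) (lam i) + 2)).trans (h2 j i h)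
      have := dvd_add h3 (hd j i).2
      rwa [sub_add_sub_cancel, hs] at this

end SymmetricCongruences

/-! ### The probability that a tuple presents the cokernel -/

section PresentationProbability

open MeasureTheory

variable {ℓ : ℕ} [hl : Fact ℓ.Prime] {g r m : ℕ} {lam : Fin r → ℕ}

theorem continuous_toZModPow (n : ℕ) : Continuous (PadicInt.toZModPow n : ℤ_[ℓ] → ZMod (ℓ ^ n)) :=
  ⟨fun S _ => isOpen_toZModPow_comp n continuous_id S⟩

theorem continuous_toZMod : Continuous (PadicInt.toZMod : ℤ_[ℓ] → ZMod ℓ) := by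
  have h : ∀ x : ℤ_[ℓ], PadicInt.toZMod x =
      ZMod.castHom (dvd_of_eq (pow_one ℓ).symm) (ZMod ℓ) (PadicInt.toZModPow 1 x) := by
    intro x
    obtain ⟨k, hk⟩ := ZMod.intCast_surjective (PadicInt.toZModPow 1 x)
    have h1 : PadicInt.toZModPow 1 x = PadicInt.toZModPow 1 (k : ℤ_[ℓ]) := by rw [map_intCast, hk]
    rw [toZModPow_eq_iff_dvd, pow_one, ← toZMod_eq_iff_dvd, map_intCast] at h1
    rw [h1, ← hk, map_intCast]
  have h2 : (PadicInt.toZMod : ℤ_[ℓ] → ZMod ℓ) =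
      (ZMod.castHom (dvd_of_eq (pow_one ℓ).symm) (ZMod ℓ)) ∘ (PadicInt.toZModPow 1) := funext h
  rw [h2]
  exact continuous_of_discreteTopology.comp (continuous_toZModPow 1)

/-- The group of symmetric matrices. -/
def symmSubgroup (ι F : Type*) [AddCommGroup F] : AddSubgroup (Matrix ι ι F) where
  carrier := {A | A.IsSymm}
  zero_mem' := Matrix.isSymm_zero
  add_mem' := Matrix.IsSymm.add
  neg_mem' := Matrix.IsSymm.neg

/-- Residues of the entries of a symmetric matrix with blocks of sizes `r` and `m`. -/
abbrev FormResidues (ℓ : ℕ) {r : ℕ} (lam : Fin r → ℕ) (m : ℕ) :=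
  (∀ p : {p : Fin r × Fin r // p.1 ≤ p.2}, ZMod (ℓ ^ (max (lam p.1.1) (lam p.1.2) + 2))) ×
    (∀ i : Fin r, Fin m → ZMod (ℓ ^ (lam i + 1))) × symmSubgroup (Fin m) (ZMod ℓ)

/-- The residues of the symmetric matrix `P (M J) Pᵀ`. -/
noncomputable def formResidues (lam : Fin r → ℕ) (P : Matrix (Fin r ⊕ Fin m) (Fin g ⊕ Fin g) ℤ_[ℓ]) :
    SkewSymp ℓ g →+ FormResidues ℓ lam m :=
  AddMonoidHom.mk' (fun M =>
    (fun p => PadicInt.toZModPow _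
        ((P * (M.1 * Matrix.J (Fin g) ℤ_[ℓ]) * P.transpose) (Sum.inl p.1.1) (Sum.inl p.1.2)),
      fun i k => PadicInt.toZModPow _
        ((P * (M.1 * Matrix.J (Fin g) ℤ_[ℓ]) * P.transpose) (Sum.inl i) (Sum.inr k)),
      ⟨(P * (M.1 * Matrix.J (Fin g) ℤ_[ℓ]) * P.transpose).toBlocks₂₂.map PadicInt.toZMod, by
        have h : (P * (M.1 * Matrix.J (Fin g) ℤ_[ℓ]) * P.transpose).IsSymm := by
          rw [Matrix.IsSymm, Matrix.transpose_mul, Matrix.transpose_mul,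
            Matrix.transpose_transpose, (SkewSymp.isSymm_mul_J M).eq, ← Matrix.mul_assoc]
        ext k k'
        exact congrArg PadicInt.toZMod (h.apply (Sum.inr k) (Sum.inr k'))⟩)) fun M N => by
    have h : P * ((M + N).1 * Matrix.J (Fin g) ℤ_[ℓ]) * P.transpose =
        P * (M.1 * Matrix.J (Fin g) ℤ_[ℓ]) * P.transpose +
          P * (N.1 * Matrix.J (Fin g) ℤ_[ℓ]) * P.transpose := by
      rw [← Matrix.add_mul, ← Matrix.mul_add, ← Matrix.add_mul]
      rfl
    simp only [h]
    refine Prod.ext ?_ (Prod.ext ?_ ?_)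
    · funext p
      exact map_add _ _ _
    · funext i k
      exact map_add _ _ _
    · refine Subtype.ext ?_
      ext k k'
      exact map_add PadicInt.toZMod _ _

/-- Any residues lift to a symmetric matrix S, and R S Rᵀ is of the form MJ; conjugating by P
returns S. Surjectivity makes the residues of a Haar-random M uniform. -/
theorem formResidues_surjective {P : Matrix (Fin r ⊕ Fin m) (Fin g ⊕ Fin g) ℤ_[ℓ]}
    {R : Matrix (Fin g ⊕ Fin g) (Fin r ⊕ Fin m) ℤ_[ℓ]} (hPR : P * R = 1) :
    Function.Surjective (formResidues (g := g) lam P) := by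
  rintro ⟨a, b, c⟩
  have hlift : ∀ (n : ℕ) (z : ZMod (ℓ ^ n)), ∃ y : ℤ_[ℓ], PadicInt.toZModPow n y = z :=
    fun n => ZMod.ringHom_surjective (PadicInt.toZModPow n)
  choose a' ha' using fun p => hlift _ (a p)
  choose b' hb' using fun i k => hlift _ (b i k)
  let A : Matrix (Fin r) (Fin r) ℤ_[ℓ] := Matrix.of fun i j =>
    if h : i ≤ j then a' ⟨(i, j), h⟩ else a' ⟨(j, i), le_of_not_ge h⟩
  have hA : A.IsSymm := by
    ext i j
    simp only [A, Matrix.transpose_apply, Matrix.of_apply]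
    rcases lt_trichotomy i j with h | h | h
    · rw [dif_neg (not_le.2 h), dif_pos h.le]
    · subst h; rfl
    · rw [dif_pos h.le, dif_neg (not_le.2 h)]
  let D : Matrix (Fin m) (Fin m) ℤ_[ℓ] := Matrix.of fun i j => ((c.1 i j).val : ℤ_[ℓ])
  have hD : D.IsSymm := by
    ext i j
    change (((c.1 j i).val : ℕ) : ℤ_[ℓ]) = ((c.1 i j).val : ℕ)
    rw [(show c.1.IsSymm from c.2).apply]
  let S := Matrix.fromBlocks A (Matrix.of b') (Matrix.of b').transpose D
  have hS : S.IsSymm := by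
    rw [Matrix.IsSymm, Matrix.fromBlocks_transpose, hA.eq, hD.eq, Matrix.transpose_transpose]
  obtain ⟨M, hM⟩ := SkewSymp.exists_mul_J_eq (S := R * S * R.transpose) (by
    rw [Matrix.IsSymm, Matrix.transpose_mul, Matrix.transpose_mul, Matrix.transpose_transpose,
      hS.eq, Matrix.mul_assoc])
  have hPM : P * (M.1 * Matrix.J (Fin g) ℤ_[ℓ]) * P.transpose = S := by
    have h1 : R.transpose * P.transpose = 1 := by
      rw [← Matrix.transpose_mul, hPR, Matrix.transpose_one]
    rw [hM, ← Matrix.mul_assoc, ← Matrix.mul_assoc, hPR, Matrix.one_mul, Matrix.mul_assoc, h1,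
      Matrix.mul_one]
  refine ⟨M, Prod.ext ?_ (Prod.ext ?_ ?_)⟩
  · funext p
    change PadicInt.toZModPow _ ((P * (M.1 * Matrix.J (Fin g) ℤ_[ℓ]) * P.transpose) _ _) = _
    rw [hPM]
    refine Eq.trans (congrArg _ (dif_pos p.2)) (ha' p)
  · funext i k
    change PadicInt.toZModPow _ ((P * (M.1 * Matrix.J (Fin g) ℤ_[ℓ]) * P.transpose) _ _) = _
    rw [hPM]
    exact hb' i k
  · refine Subtype.ext ?_
    ext k k'
    change PadicInt.toZMod ((P * (M.1 * Matrix.J (Fin g) ℤ_[ℓ]) * P.transpose) (Sum.inr k)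
      (Sum.inr k')) = _
    rw [hPM]
    exact toZMod_natCast_val _

theorem continuous_formResidues (P : Matrix (Fin r ⊕ Fin m) (Fin g ⊕ Fin g) ℤ_[ℓ]) :
    Continuous (formResidues (g := g) lam P) := by
  have h : Continuous fun M : SkewSymp ℓ g =>
      P * (M.1 * Matrix.J (Fin g) ℤ_[ℓ]) * P.transpose := by fun_prop
  refine Continuous.prodMk (continuous_pi fun p => ?_) (Continuous.prodMk (continuous_pi fun i =>
    continuous_pi fun k => ?_) (Continuous.subtype_mk (continuous_matrix fun k k' => ?_) _))
  · exact (continuous_toZModPow _).comp (h.matrix_elem _ _)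
  · exact (continuous_toZModPow _).comp (h.matrix_elem _ _)
  · exact continuous_toZMod.comp (h.matrix_elem _ _)

/-- The residue prescribed for the entry `(i, j)` of the leading block. -/
noncomputable def formTarget (x : Fin g ⊕ Fin g → CycProd ℓ lam)
    (C : Matrix (Fin r) (Fin r) (ZMod ℓ)) (i j : Fin r) : ℤ_[ℓ] :=
  (ℓ : ℤ_[ℓ]) ^ (lam i + 1) * ((C i j).val : ℤ_[ℓ]) -
    ℓ * (tupleLift x * Matrix.J (Fin g) ℤ_[ℓ] * (tupleLift x).transpose) i j

/-- The residues prescribed for the entries `(i, j)` and `(j, i)` agree. -/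
def IsConsistent (x : Fin g ⊕ Fin g → CycProd ℓ lam) (C : Matrix (Fin r) (Fin r) (ZMod ℓ)) : Prop :=
  ∀ i j, i < j → (ℓ : ℤ_[ℓ]) ^ (min (lam i) (lam j) + 2) ∣ formTarget x C i j - formTarget x C j i

/-- The term ℓJ is constant, so it only shifts the residues prescribed for MJ; in the last block,
taken modulo ℓ, it disappears. The consistency condition does not involve M and factors out. -/
theorem isPresentation_iff_formResidues (x : Fin g ⊕ Fin g → CycProd ℓ lam)
    (C : Matrix (Fin r) (Fin r) (ZMod ℓ)) (hx : Function.Surjective (tupleHom x))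
    {Q : Matrix (Fin m) (Fin g ⊕ Fin g) ℤ_[ℓ]} {R : Matrix (Fin g ⊕ Fin g) (Fin r ⊕ Fin m) ℤ_[ℓ]}
    (hRP : R * Matrix.fromRows (tupleLift x) Q = 1)
    (hPR : Matrix.fromRows (tupleLift x) Q * R = 1) :
    ∃ a b, ∀ M, IsPresentation x C M ↔ (C.det ≠ 0 ∧ IsConsistent x C) ∧
      formResidues lam (Matrix.fromRows (tupleLift x) Q) M ∈
        ({a} ×ˢ {b} ×ˢ {c | c.1.det ≠ 0} : Set (FormResidues ℓ lam m)) := by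
  set P := Matrix.fromRows (tupleLift x) Q with hP
  refine ⟨fun p => PadicInt.toZModPow _ (dominant lam (formTarget x C) p.1.1 p.1.2),
    fun i k => PadicInt.toZModPow _ (-((ℓ : ℤ_[ℓ]) *
      (P * Matrix.J (Fin g) ℤ_[ℓ] * P.transpose) (Sum.inl i) (Sum.inr k))), fun M => ?_⟩
  set S := P * (M.1 * Matrix.J (Fin g) ℤ_[ℓ]) * P.transpose with hS
  have hB : S + (ℓ : ℤ_[ℓ]) • (P * Matrix.J (Fin g) ℤ_[ℓ] * P.transpose) =
      P * shiftForm M * P.transpose := by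
    rw [shiftForm, Matrix.mul_add, Matrix.add_mul, Matrix.mul_smul, Matrix.smul_mul]
  have hsymm : S.IsSymm := by
    rw [hS, Matrix.IsSymm, Matrix.transpose_mul, Matrix.transpose_mul,
      Matrix.transpose_transpose, (SkewSymp.isSymm_mul_J M).eq, ← Matrix.mul_assoc]
  rw [isPresentation_iff_of_completion x C M hx hRP hPR hB]
  have h11 : (∀ i j, (ℓ : ℤ_[ℓ]) ^ (lam i + 2) ∣
      (S + (ℓ : ℤ_[ℓ]) • (P * Matrix.J (Fin g) ℤ_[ℓ] * P.transpose)) (Sum.inl i) (Sum.inl j) -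
        (ℓ : ℤ_[ℓ]) ^ (lam i + 1) * ((C i j).val : ℤ_[ℓ])) ↔ IsConsistent x C ∧
      (formResidues lam P M).1 = fun p =>
        PadicInt.toZModPow _ (dominant lam (formTarget x C) p.1.1 p.1.2) := by
    have h1 := symm_congruences_iff lam (fun i j => S (Sum.inl i) (Sum.inl j)) (formTarget x C)
      fun i j => (hsymm.apply (Sum.inl j) (Sum.inl i))
    have h2 : ∀ i j, (S + (ℓ : ℤ_[ℓ]) • (P * Matrix.J (Fin g) ℤ_[ℓ] * P.transpose))
        (Sum.inl i) (Sum.inl j) - (ℓ : ℤ_[ℓ]) ^ (lam i + 1) * ((C i j).val : ℤ_[ℓ]) =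
        S (Sum.inl i) (Sum.inl j) - formTarget x C i j := by
      intro i j
      rw [Matrix.add_apply, Matrix.smul_apply, hP, conj_fromRows_apply_inl, formTarget, smul_eq_mul]
      ring
    simp only [h2]
    rw [h1]
    refine and_congr_right fun _ => ?_
    constructor
    · intro h
      funext p
      exact toZModPow_eq_iff_dvd.2 (h _ _ p.2)
    · intro h i j hij
      exact toZModPow_eq_iff_dvd.1 (congrFun h ⟨(i, j), hij⟩)
  have h12 : (∀ i k, (ℓ : ℤ_[ℓ]) ^ (lam i + 1) ∣
      (S + (ℓ : ℤ_[ℓ]) • (P * Matrix.J (Fin g) ℤ_[ℓ] * P.transpose)) (Sum.inl i) (Sum.inr k)) ↔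
      (formResidues lam P M).2.1 = fun i k => PadicInt.toZModPow _ (-((ℓ : ℤ_[ℓ]) *
        (P * Matrix.J (Fin g) ℤ_[ℓ] * P.transpose) (Sum.inl i) (Sum.inr k))) := by
    simp only [funext_iff]
    refine forall_congr' fun i => forall_congr' fun k => ?_
    refine Iff.trans ?_ toZModPow_eq_iff_dvd.symm
    rw [sub_neg_eq_add]
    rfl
  have h22 : (S + (ℓ : ℤ_[ℓ]) • (P * Matrix.J (Fin g) ℤ_[ℓ] * P.transpose)).toBlocks₂₂.map
      PadicInt.toZMod = (formResidues lam P M).2.2.1 := by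
    ext k k'
    refine toZMod_eq_iff_dvd.2 ?_
    rw [Matrix.toBlocks₂₂, Matrix.of_apply, Matrix.add_apply]
    refine ⟨(P * Matrix.J (Fin g) ℤ_[ℓ] * P.transpose) (Sum.inr k) (Sum.inr k'), ?_⟩
    exact add_sub_cancel_left _ _
  rw [h11, h12, h22]
  simp only [Set.mem_prod, Set.mem_singleton_iff, Set.mem_ofPred_eq]
  tauto

variable [MeasurableSpace (SkewSymp ℓ g)] [BorelSpace (SkewSymp ℓ g)]

open Classical in
/-- The Haar probability that a given generating tuple presents the cokernel with matrix `C`. -/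
theorem measure_isPresentation (x : Fin g ⊕ Fin g → CycProd ℓ lam)
    (C : Matrix (Fin r) (Fin r) (ZMod ℓ)) (hx : Function.Surjective (tupleHom x)) :
    r ≤ g + g ∧ MeasurableSet {M : SkewSymp ℓ g | IsPresentation x C M} ∧
    Measure.addHaarMeasure (⊤ : TopologicalSpace.PositiveCompacts (SkewSymp ℓ g))
      {M | IsPresentation x C M} = if C.det ≠ 0 ∧ IsConsistent x C then
        (Nat.card (SymInv (Fin (g + g - r)) (ZMod ℓ)) : ℝ≥0∞) /
          Nat.card (FormResidues ℓ lam (g + g - r)) else 0 := by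
  obtain ⟨m, Q, R, hm, hRP, hPR⟩ := exists_row_completion _ (linearIndependent_tupleLift x hx)
  rw [Fintype.card_sum, Fintype.card_fin] at hm
  obtain rfl : m = g + g - r := by omega
  have hRP' := mul_eq_one_of_mulVec hRP
  have hPR' := mul_eq_one_of_mulVec hPR
  obtain ⟨a, b, hab⟩ := isPresentation_iff_formResidues x C hx hRP' hPR'
  have hcont := continuous_formResidues (lam := lam) (Matrix.fromRows (tupleLift x) Q)
  have hmeas : ∀ a, MeasurableSet
      (formResidues lam (Matrix.fromRows (tupleLift x) Q) ⁻¹' {a}) :=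
    fun a => (isClosed_singleton.preimage hcont).measurableSet
  have hset : {M : SkewSymp ℓ g | IsPresentation x C M} =
      if C.det ≠ 0 ∧ IsConsistent x C then formResidues lam (Matrix.fromRows (tupleLift x) Q) ⁻¹'
        ({a} ×ˢ {b} ×ˢ {c | c.1.det ≠ 0} : Set (FormResidues ℓ lam (g + g - r))) else ∅ := by
    ext M
    rw [Set.mem_ofPred_eq, hab]
    split_ifs with h
    · rw [and_iff_right h]; rfl
    · simp [h]
  refine ⟨by omega, ?_, ?_⟩
  · rw [hset]
    split_ifs
    · rw [← Set.biUnion_preimage_singleton]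
      exact Set.Finite.measurableSet_biUnion (Set.toFinite _) fun a _ => hmeas a
    · exact MeasurableSet.empty
  · rw [hset]
    split_ifs
    · rw [measure_preimage_finite _ (by exact Measure.addHaarMeasure_self) _ hmeas
        (formResidues_surjective hPR')]
      congr 2
      refine Nat.card_congr ?_
      exact {
        toFun := fun z => ⟨z.1.2.2.1, z.1.2.2.2, z.2.2.2⟩
        invFun := fun c => ⟨(a, b, ⟨c.1, c.2.1⟩), rfl, rfl, c.2.2⟩
        left_inv := by
          rintro ⟨⟨a', b', c⟩, h1, h2, h3⟩
          obtain rfl : a' = a := h1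
          obtain rfl : b' = b := h2
          rfl
        right_inv := fun c => rfl }
    · exact measure_empty

end PresentationProbability

/-! ### The density of consistent generating tuples -/

section ConsistentTuples

open Filter Topology

variable {ℓ : ℕ} [hl : Fact ℓ.Prime] {g r : ℕ} {lam : Fin r → ℕ}

theorem two_nsmul_bijective (hodd : ℓ ≠ 2) {A : Type*} [AddCommGroup A] [Finite A] {N : ℕ}
    (hA : ∀ x : A, ℓ ^ N • x = 0) : Function.Bijective fun x : A => 2 • x := by
  refine Function.Injective.bijective_of_finite fun x y hxy => ?_
  rw [← sub_eq_zero]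
  exact eq_zero_of_two_nsmul hl.out hodd (hA _) (by rw [nsmul_sub]; exact sub_eq_zero.2 hxy)

/-- Values of alternating forms on the coordinates `i < j`. -/
abbrev AltValues (ℓ : ℕ) {r : ℕ} (lam : Fin r → ℕ) :=
  ∀ p : {p : Fin r × Fin r // p.1 < p.2}, ZMod (ℓ ^ (min (lam p.1.1) (lam p.1.2) + 1))

/-- Twice the alternating product of two elements of `G`. -/
noncomputable def altProd (y : CycProd ℓ lam × CycProd ℓ lam) : AltValues ℓ lam := fun p =>
  2 • (ZMod.castHom (pow_dvd_pow ℓ (by omega : min (lam p.1.1) (lam p.1.2) + 1 ≤ lam p.1.1 + 1)) _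
      (y.1 p.1.1) *
    ZMod.castHom (pow_dvd_pow ℓ (by omega : min (lam p.1.1) (lam p.1.2) + 1 ≤ lam p.1.2 + 1)) _
      (y.2 p.1.2) -
    ZMod.castHom (pow_dvd_pow ℓ (by omega : min (lam p.1.1) (lam p.1.2) + 1 ≤ lam p.1.1 + 1)) _
      (y.2 p.1.1) *
    ZMod.castHom (pow_dvd_pow ℓ (by omega : min (lam p.1.1) (lam p.1.2) + 1 ≤ lam p.1.2 + 1)) _
      (y.1 p.1.2))

theorem altProd_zero : altProd (0 : CycProd ℓ lam × CycProd ℓ lam) = 0 := by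
  funext p
  simp [altProd]

/-- For i < j, the pair (c e_i, e_j) has alternating product 2c in position (i, j) and 0 elsewhere,
and doubling is bijective. -/
theorem closure_range_altProd (hodd : ℓ ≠ 2) :
    AddSubgroup.closure (Set.range (altProd : CycProd ℓ lam × CycProd ℓ lam → AltValues ℓ lam)) =
      ⊤ := by
  rw [eq_top_iff]
  intro a _
  rw [← Finset.univ_sum_single a]
  refine sum_mem fun p _ => AddSubgroup.subset_closure ?_
  obtain ⟨c, hc⟩ := (two_nsmul_bijective hodd (N := min (lam p.1.1) (lam p.1.2) + 1)
    (A := ZMod (ℓ ^ (min (lam p.1.1) (lam p.1.2) + 1))) (fun x => by simp)).2 (a p)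
  refine ⟨(Pi.single p.1.1 (c.val : ZMod _), Pi.single p.1.2 1), ?_⟩
  funext q
  have hz : q ≠ p → (q.1.1 ≠ p.1.1 ∨ q.1.2 ≠ p.1.2) := by
    intro h
    by_contra! h'
    exact h (Subtype.ext (Prod.ext h'.1 h'.2))
  -- The transposed index pair does not satisfy i < j, so the second product in `altProd` vanishes.
  have hcross : q.1.1 ≠ p.1.2 ∨ q.1.2 ≠ p.1.1 := by
    by_contra! h'
    have := q.2
    rw [h'.1, h'.2] at this
    exact lt_asymm this p.2
  have h2 : ∀ u : ZMod (ℓ ^ (lam q.1.2 + 1)), ((ZMod.castHom (pow_dvd_pow ℓ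
      (by omega : min (lam q.1.1) (lam q.1.2) + 1 ≤ lam q.1.1 + 1)) (ZMod (ℓ ^ (min (lam q.1.1) (lam q.1.2) + 1)))
      ((Pi.single p.1.2 1 : CycProd ℓ lam) q.1.1)) *
    ZMod.castHom (pow_dvd_pow ℓ (by omega : min (lam q.1.1) (lam q.1.2) + 1 ≤ lam q.1.2 + 1)) _
      ((Pi.single p.1.1 (c.val : ZMod _) : CycProd ℓ lam) q.1.2)) = 0 := by
    intro _
    rcases hcross with h | h
    · rw [Pi.single_eq_of_ne h, map_zero, zero_mul]
    · rw [Pi.single_eq_of_ne h, map_zero, mul_zero]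
  rw [altProd]
  simp only
  rw [h2 0, sub_zero]
  by_cases hq : q = p
  · subst hq
    rw [Pi.single_eq_same, Pi.single_eq_same, Pi.single_eq_same, map_one, mul_one, map_natCast,
      ZMod.natCast_zmod_val]
    exact hc
  · rw [Pi.single_eq_of_ne hq]
    rcases hz hq with h | h
    · rw [Pi.single_eq_of_ne h, map_zero, zero_mul, nsmul_zero]
    · rw [Pi.single_eq_of_ne h, map_zero, mul_zero, nsmul_zero]

/-- The common factor ℓ lowers the modulus in the consistency condition from exponent min + 2 to min
+ 1. At that modulus the symplectic pairing of two rows depends on x and not on its lift. -/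
theorem formTarget_sub (x : Fin g ⊕ Fin g → CycProd ℓ lam) (C : Matrix (Fin r) (Fin r) (ZMod ℓ))
    (i j : Fin r) : formTarget x C i j - formTarget x C j i =
      ℓ * (2 * sympForm (tupleLift x i) (tupleLift x j) -
        ((ℓ : ℤ_[ℓ]) ^ lam j * ((C j i).val : ℤ_[ℓ]) -
          (ℓ : ℤ_[ℓ]) ^ lam i * ((C i j).val : ℤ_[ℓ]))) := by
  have h : ∀ i j, (tupleLift x * Matrix.J (Fin g) ℤ_[ℓ] * (tupleLift x).transpose) i j =
      -sympForm (tupleLift x i) (tupleLift x j) := by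
    intro i j
    rw [sympForm_eq, neg_neg, Matrix.mul_assoc]
    rfl
  rw [formTarget, formTarget, h, h, sympForm_swap (tupleLift x j)]
  ring

theorem castHom_eq_toZModPow_tupleLift {I : Type*} [Fintype I] (x : I → CycProd ℓ lam) (i : Fin r)
    (k : I) {n : ℕ} (h : n ≤ lam i + 1) : ZMod.castHom (pow_dvd_pow ℓ h) (ZMod (ℓ ^ n)) (x k i) =
      PadicInt.toZModPow n (tupleLift x i k) := by
  refine (congrArg _ (toZModPow_tupleLift x i k)).symm.trans ?_
  rw [← RingHom.comp_apply, PadicInt.zmod_cast_comp_toZModPow _ _ h]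

/-- Consistency says that a walk with steps `altProd` (x(e_k), x(f_k)) is at w after g steps. The
target w depends on C but not on g, as the limit g → ∞ requires. -/
theorem exists_isConsistent_iff (C : Matrix (Fin r) (Fin r) (ZMod ℓ)) : ∃ w : AltValues ℓ lam,
    ∀ (g : ℕ) (x : Fin g ⊕ Fin g → CycProd ℓ lam),
      IsConsistent x C ↔ ∑ k, altProd (x (Sum.inl k), x (Sum.inr k)) = w := by
  refine ⟨fun p => PadicInt.toZModPow _ ((ℓ : ℤ_[ℓ]) ^ lam p.1.2 * ((C p.1.2 p.1.1).val : ℤ_[ℓ]) -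
    (ℓ : ℤ_[ℓ]) ^ lam p.1.1 * ((C p.1.1 p.1.2).val : ℤ_[ℓ])), fun g x => ?_⟩
  have hsum : ∀ p : {p : Fin r × Fin r // p.1 < p.2},
      (∑ k, altProd (x (Sum.inl k), x (Sum.inr k))) p =
        PadicInt.toZModPow _ (2 * sympForm (tupleLift x p.1.1) (tupleLift x p.1.2)) := by
    intro p
    rw [Finset.sum_apply, sympForm, Finset.mul_sum, map_sum]
    refine Finset.sum_congr rfl fun k _ => ?_
    simp only [altProd, map_mul, map_sub, nsmul_eq_mul, map_ofNat, Nat.cast_ofNat]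
    exact congrArg (2 * ·) (congrArg₂ (· - ·)
      (congrArg₂ (· * ·) (castHom_eq_toZModPow_tupleLift x _ _ (by omega))
        (castHom_eq_toZModPow_tupleLift x _ _ (by omega)))
      (congrArg₂ (· * ·) (castHom_eq_toZModPow_tupleLift x _ _ (by omega))
        (castHom_eq_toZModPow_tupleLift x _ _ (by omega))))
  have hdiv : ∀ p : {p : Fin r × Fin r // p.1 < p.2},
      (ℓ : ℤ_[ℓ]) ^ (min (lam p.1.1) (lam p.1.2) + 2) ∣
        formTarget x C p.1.1 p.1.2 - formTarget x C p.1.2 p.1.1 ↔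
      (∑ k, altProd (x (Sum.inl k), x (Sum.inr k))) p = PadicInt.toZModPow _
        ((ℓ : ℤ_[ℓ]) ^ lam p.1.2 * ((C p.1.2 p.1.1).val : ℤ_[ℓ]) -
          (ℓ : ℤ_[ℓ]) ^ lam p.1.1 * ((C p.1.1 p.1.2).val : ℤ_[ℓ])) := by
    intro p
    have h0 : (ℓ : ℤ_[ℓ]) ≠ 0 := by exact_mod_cast hl.out.ne_zero
    rw [hsum, toZModPow_eq_iff_dvd, formTarget_sub, pow_succ', mul_dvd_mul_iff_left h0]
  rw [funext_iff]
  exact ⟨fun h p => (hdiv p).1 (h _ _ p.2), fun h i j hij => (hdiv ⟨(i, j), hij⟩).2 (h _)⟩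

theorem tendsto_card_isConsistent (hodd : ℓ ≠ 2) (C : Matrix (Fin r) (Fin r) (ZMod ℓ)) :
    Tendsto (fun g => (Nat.card {x : Fin g ⊕ Fin g → CycProd ℓ lam // IsConsistent x C} : ℝ) /
      (Nat.card (CycProd ℓ lam) : ℝ) ^ (g + g)) atTop (𝓝 (1 / Nat.card (AltValues ℓ lam))) := by
  obtain ⟨w, hw⟩ := exists_isConsistent_iff (lam := lam) C
  have h := tendsto_card_sum_eq (altProd (ℓ := ℓ) (lam := lam)) ⟨0, altProd_zero⟩
    (closure_range_altProd hodd) w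
  refine h.congr fun g => ?_
  rw [Nat.card_prod, Nat.cast_mul, ← pow_two, ← pow_mul, two_mul]
  congr 2
  refine Nat.card_congr ?_
  refine Equiv.subtypeEquiv ((Equiv.arrowProdEquivProdArrow (Fin g) _ _).trans
    (Equiv.sumArrowEquivProdArrow (Fin g) (Fin g) _).symm) fun y => ?_
  rw [hw]
  rfl

/-- A tuple that does not generate lies in a proper subgroup, whose order is at most half that of G.
-/
theorem card_not_surjective_le (I : Type*) [Fintype I] [DecidableEq I] :
    Nat.card {x : I → CycProd ℓ lam // ¬ Function.Surjective (tupleHom x)} * 2 ^ Fintype.card I ≤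
      Nat.card (AddSubgroup (CycProd ℓ lam)) * Nat.card (CycProd ℓ lam) ^ Fintype.card I := by
  classical
  have hfin : Finite (AddSubgroup (CycProd ℓ lam)) :=
    Finite.of_injective (fun K => (K : Set (CycProd ℓ lam))) SetLike.coe_injective
  have hF : Fintype (AddSubgroup (CycProd ℓ lam)) := Fintype.ofFinite _
  let S := {K : AddSubgroup (CycProd ℓ lam) // K ≠ ⊤}
  let f : {x : I → CycProd ℓ lam // ¬ Function.Surjective (tupleHom x)} → Σ K : S, (I → K.1) :=
    fun x => ⟨⟨(tupleHom x.1).range, fun h => x.2 (AddMonoidHom.range_eq_top.1 h)⟩,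
      fun k => ⟨x.1 k, ⟨Pi.single k 1, by rw [tupleHom_single]⟩⟩⟩
  have hf : Function.Injective f := by
    intro x y h
    have h1 : ∀ z, z = f y → ∀ k, (z.2 k : CycProd ℓ lam) = y.1 k := by rintro _ rfl k; rfl
    exact Subtype.ext (funext fun k => h1 _ h k)
  have hK : ∀ K : S, Nat.card K.1 * 2 ≤ Nat.card (CycProd ℓ lam) := by
    intro K
    rw [← K.1.card_mul_index]
    refine Nat.mul_le_mul_left _ ?_
    have h0 : K.1.index ≠ 0 := AddSubgroup.index_ne_zero_of_finite
    have h1 : K.1.index ≠ 1 := fun h => K.2 (AddSubgroup.index_eq_one.1 h)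
    omega
  calc _ ≤ Nat.card (Σ K : S, (I → K.1)) * 2 ^ Fintype.card I :=
        Nat.mul_le_mul_right _ (Nat.card_le_card_of_injective f hf)
    _ = ∑ K : S, (Nat.card K.1 * 2) ^ Fintype.card I := by
        rw [Nat.card_sigma, Finset.sum_mul]
        refine Finset.sum_congr rfl fun K _ => ?_
        rw [Nat.card_fun, Nat.card_eq_fintype_card (α := I), mul_pow]
    _ ≤ ∑ _K : S, Nat.card (CycProd ℓ lam) ^ Fintype.card I :=
        Finset.sum_le_sum fun K _ => Nat.pow_le_pow_left (hK K) _
    _ = Nat.card S * Nat.card (CycProd ℓ lam) ^ Fintype.card I := by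
        rw [Finset.sum_const, Finset.card_univ, ← Nat.card_eq_fintype_card, smul_eq_mul]
    _ ≤ _ := Nat.mul_le_mul_right _ (Nat.card_le_card_of_injective _ Subtype.val_injective)

theorem tendsto_card_not_surjective :
    Tendsto (fun g : ℕ => (Nat.card {x : Fin g ⊕ Fin g → CycProd ℓ lam //
      ¬ Function.Surjective (tupleHom x)} : ℝ) / (Nat.card (CycProd ℓ lam) : ℝ) ^ (g + g))
      atTop (𝓝 0) := by
  have hpos : (0 : ℝ) < Nat.card (CycProd ℓ lam) := by exact_mod_cast Nat.card_pos
  have h1 : Tendsto (fun g : ℕ => (Nat.card (AddSubgroup (CycProd ℓ lam)) : ℝ) * ((1 / 4 : ℝ)) ^ g)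
      atTop (𝓝 0) := by
    rw [← mul_zero (Nat.card (AddSubgroup (CycProd ℓ lam)) : ℝ)]
    exact (tendsto_pow_atTop_nhds_zero_of_lt_one (by norm_num) (by norm_num)).const_mul _
  refine squeeze_zero (fun g => by positivity) (fun g => ?_) h1
  have h := card_not_surjective_le (ℓ := ℓ) (lam := lam) (Fin g ⊕ Fin g)
  rw [Fintype.card_sum, Fintype.card_fin] at h
  have h' : (Nat.card {x : Fin g ⊕ Fin g → CycProd ℓ lam //
      ¬ Function.Surjective (tupleHom x)} : ℝ) * 2 ^ (g + g) ≤
      Nat.card (AddSubgroup (CycProd ℓ lam)) * (Nat.card (CycProd ℓ lam) : ℝ) ^ (g + g) := by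
    exact_mod_cast h
  have h4 : (2 : ℝ) ^ (g + g) = 4 ^ g := by rw [← two_mul, pow_mul]; norm_num
  rw [h4] at h'
  rw [div_le_iff₀ (by positivity), one_div, inv_pow, ← div_eq_mul_inv, div_mul_eq_mul_div,
    le_div_iff₀ (by positivity)]
  exact h'

/-- Nonsurjective tuples being negligible, the consistent generating tuples have the same density
as the consistent tuples. -/
theorem tendsto_card_surjective_isConsistent (hodd : ℓ ≠ 2) (C : Matrix (Fin r) (Fin r) (ZMod ℓ)) :
    Tendsto (fun g => (Nat.card {x : Fin g ⊕ Fin g → CycProd ℓ lam //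
      Function.Surjective (tupleHom x) ∧ IsConsistent x C} : ℝ) /
        (Nat.card (CycProd ℓ lam) : ℝ) ^ (g + g)) atTop (𝓝 (1 / Nat.card (AltValues ℓ lam))) := by
  classical
  have hpos : (0 : ℝ) < Nat.card (CycProd ℓ lam) := by exact_mod_cast Nat.card_pos
  have h1 := (tendsto_card_isConsistent (lam := lam) hodd C).sub
    (tendsto_card_not_surjective (ℓ := ℓ) (lam := lam))
  rw [sub_zero] at h1
  refine tendsto_of_tendsto_of_tendsto_of_le_of_le h1 (tendsto_card_isConsistent hodd C)
    (fun g => ?_) fun g => ?_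
  · simp only
    rw [← sub_div]
    refine div_le_div_of_nonneg_right ?_ (by positivity)
    rw [sub_le_iff_le_add]
    norm_cast
    rw [Nat.card_eq_fintype_card, Nat.card_eq_fintype_card, Nat.card_eq_fintype_card,
      Fintype.card_subtype, Fintype.card_subtype, Fintype.card_subtype]
    refine (Finset.card_le_card fun x hx => ?_).trans (Finset.card_union_le _ _)
    simp only [Finset.mem_filter, Finset.mem_union, Finset.mem_univ, true_and] at hx ⊢
    tauto
  · simp only
    refine div_le_div_of_nonneg_right ?_ (by positivity)
    norm_cast
    exact Nat.card_le_card_of_injective (fun x => ⟨x.1, x.2.2⟩) fun x y h =>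
      Subtype.ext (congrArg (fun z => z.1) h)

end ConsistentTuples

/-! ### The expected number of presentations in the limit -/

section PresentationLimit

open Filter Topology MeasureTheory

variable {ℓ : ℕ} [hl : Fact ℓ.Prime] {g r : ℕ} {lam : Fin r → ℕ}

theorem succ_choose_two_mul_two (r : ℕ) : (r + 1).choose 2 * 2 = r * r + r := by
  rw [Nat.choose_two_right, Nat.add_sub_cancel, mul_comm (r + 1),
    Nat.div_two_mul_two_of_even (Nat.even_mul_succ_self r)]
  ring

/-- The exponents occurring in the residues of a symmetric form and in the values of an
alternating form. -/
theorem card_symm_mul_card_alt :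
    Nat.card (∀ p : {p : Fin r × Fin r // p.1 ≤ p.2},
      ZMod (ℓ ^ (max (lam p.1.1) (lam p.1.2) + 2))) * Nat.card (AltValues ℓ lam) =
        Nat.card (CycProd ℓ lam) ^ r * ℓ ^ (r + 1).choose 2 := by
  have e1 : Nat.card (∀ p : {p : Fin r × Fin r // p.1 ≤ p.2},
      ZMod (ℓ ^ (max (lam p.1.1) (lam p.1.2) + 2))) =
      ℓ ^ ∑ p : Fin r × Fin r, if p.1 ≤ p.2 then max (lam p.1) (lam p.2) + 2 else 0 := by
    rw [Nat.card_pi, ← Finset.sum_filter, ← Finset.prod_pow_eq_pow_sum]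
    simp only [Nat.card_zmod]
    exact (Finset.prod_subtype _ (by simp) fun p : Fin r × Fin r =>
      ℓ ^ (max (lam p.1) (lam p.2) + 2)).symm
  have e2 : Nat.card (AltValues ℓ lam) =
      ℓ ^ ∑ p : Fin r × Fin r, if p.1 < p.2 then min (lam p.1) (lam p.2) + 1 else 0 := by
    rw [Nat.card_pi, ← Finset.sum_filter, ← Finset.prod_pow_eq_pow_sum]
    simp only [Nat.card_zmod]
    exact (Finset.prod_subtype _ (by simp) fun p : Fin r × Fin r =>
      ℓ ^ (min (lam p.1) (lam p.2) + 1)).symm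
  rw [e1, e2, card_cycProd, Finset.prod_pow_eq_pow_sum, ← pow_mul, ← pow_add, ← pow_add]
  congr 1
  set X := ∑ p : Fin r × Fin r, if p.1 ≤ p.2 then max (lam p.1) (lam p.2) + 2 else 0 with hX
  set Y := ∑ p : Fin r × Fin r, if p.1 < p.2 then min (lam p.1) (lam p.2) + 1 else 0 with hY
  have hX' : X = ∑ p : Fin r × Fin r, if p.2 ≤ p.1 then max (lam p.1) (lam p.2) + 2 else 0 := by
    rw [hX, ← Equiv.sum_comp (Equiv.prodComm _ _)]
    exact Finset.sum_congr rfl fun p _ => by simp [max_comm]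
  have hY' : Y = ∑ p : Fin r × Fin r, if p.2 < p.1 then min (lam p.1) (lam p.2) + 1 else 0 := by
    rw [hY, ← Equiv.sum_comp (Equiv.prodComm _ _)]
    exact Finset.sum_congr rfl fun p _ => by simp [min_comm]
  -- Adding the two orders of each pair makes max and min combine to lam i + lam j, so the exponents
  -- separate; the diagonal contributes one extra unit.
  have hpt : ∀ p : Fin r × Fin r,
      (if p.1 ≤ p.2 then max (lam p.1) (lam p.2) + 2 else 0) +
        (if p.1 < p.2 then min (lam p.1) (lam p.2) + 1 else 0) +
        ((if p.2 ≤ p.1 then max (lam p.1) (lam p.2) + 2 else 0) +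
          (if p.2 < p.1 then min (lam p.1) (lam p.2) + 1 else 0)) =
      (lam p.1 + 1) + (lam p.2 + 1) + 1 + if p.1 = p.2 then 1 else 0 := by
    rintro ⟨i, j⟩
    rcases lt_trichotomy i j with h | h | h
    · simp [h, h.le, not_le.2 h, not_lt.2 h.le, h.ne]; omega
    · subst h; simp; omega
    · simp [h, h.le, not_le.2 h, not_lt.2 h.le, h.ne']; omega
  have hdiag : ∑ p : Fin r × Fin r, (if p.1 = p.2 then 1 else 0) = r := by
    rw [Fintype.sum_prod_type]
    simp
  have hsum : X + Y + (X + Y) = 2 * (r * ∑ i, (lam i + 1)) + r * r + r := by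
    nth_rewrite 2 [hX', hY']
    rw [hX, hY, ← Finset.sum_add_distrib, ← Finset.sum_add_distrib, ← Finset.sum_add_distrib,
      Finset.sum_congr rfl fun p _ => hpt p, Finset.sum_add_distrib, Finset.sum_add_distrib,
      Finset.sum_add_distrib, hdiag, Fintype.sum_prod_type, Fintype.sum_prod_type,
      Fintype.sum_prod_type]
    simp only [Finset.sum_const, Finset.card_univ, Fintype.card_fin, smul_eq_mul, mul_one,
      ← Finset.mul_sum]
    ring
  have hch := succ_choose_two_mul_two r
  rw [mul_comm _ r]
  omega

theorem card_formResidues (m : ℕ) : Nat.card (FormResidues ℓ lam m) =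
    Nat.card (∀ p : {p : Fin r × Fin r // p.1 ≤ p.2},
      ZMod (ℓ ^ (max (lam p.1.1) (lam p.1.2) + 2))) *
        (Nat.card (CycProd ℓ lam) ^ m * Nat.card (SymMat (Fin m) (ZMod ℓ))) := by
  rw [Nat.card_prod, Nat.card_prod]
  congr 2
  rw [card_cycProd, Nat.card_pi]
  simp only [Nat.card_fun, Nat.card_zmod, Nat.card_fin]
  rw [Finset.prod_pow]

/-- The Haar probability of a set of skew-symplectic matrices. -/
noncomputable def skewHaar (ℓ : ℕ) [Fact ℓ.Prime] (g : ℕ) (S : Set (SkewSymp ℓ g)) : ℝ≥0∞ :=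
  letI : MeasurableSpace (SkewSymp ℓ g) := borel _
  haveI : BorelSpace (SkewSymp ℓ g) := ⟨rfl⟩
  Measure.addHaarMeasure (⊤ : TopologicalSpace.PositiveCompacts (SkewSymp ℓ g)) S

theorem skewHaar_empty : skewHaar ℓ g ∅ = 0 := measure_empty

open Classical in
theorem skewHaar_isPresentation (x : Fin g ⊕ Fin g → CycProd ℓ lam)
    (C : Matrix (Fin r) (Fin r) (ZMod ℓ)) : skewHaar ℓ g {M | IsPresentation x C M} =
      if C.det ≠ 0 ∧ Function.Surjective (tupleHom x) ∧ IsConsistent x C then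
        (Nat.card (SymInv (Fin (g + g - r)) (ZMod ℓ)) : ℝ≥0∞) /
          Nat.card (FormResidues ℓ lam (g + g - r)) else 0 := by
  let _ : MeasurableSpace (SkewSymp ℓ g) := borel _
  have : BorelSpace (SkewSymp ℓ g) := ⟨rfl⟩
  by_cases hx : Function.Surjective (tupleHom x)
  · simp only [hx, true_and]
    exact (measure_isPresentation x C hx).2.2
  · have h : {M : SkewSymp ℓ g | IsPresentation x C M} = ∅ :=
      Set.eq_empty_of_forall_notMem fun M hM => hx hM.1
    rw [h, skewHaar_empty, if_neg fun h => hx h.2.1]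

theorem card_mul_skewHaar_eq_sum {ι : Type*} [Fintype ι] (x : ι → Fin g ⊕ Fin g → CycProd ℓ lam)
    (C : ι → Matrix (Fin r) (Fin r) (ZMod ℓ)) (S : Set (SkewSymp ℓ g)) (N : ℕ) (hN : N ≠ 0)
    (hin : ∀ M ∈ S, Nat.card {j // IsPresentation (x j) (C j) M} = N)
    (hout : ∀ j M, IsPresentation (x j) (C j) M → M ∈ S) :
    (N : ℝ≥0∞) * skewHaar ℓ g S = ∑ j, skewHaar ℓ g {M | IsPresentation (x j) (C j) M} := by
  let _ : MeasurableSpace (SkewSymp ℓ g) := borel _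
  have : BorelSpace (SkewSymp ℓ g) := ⟨rfl⟩
  refine card_mul_measure_eq_sum _ (fun j => {M | IsPresentation (x j) (C j) M}) (fun j => ?_) S N hN
    hin hout
  by_cases hx : Function.Surjective (tupleHom (x j))
  · exact (measure_isPresentation (x j) (C j) hx).2.1
  · have h : {M : SkewSymp ℓ g | IsPresentation (x j) (C j) M} = ∅ :=
      Set.eq_empty_of_forall_notMem fun M hM => hx hM.1
    rw [h]
    exact MeasurableSet.empty

-- The residues of the border account for |G|^(2g - r) and those of the leading block, together with
-- the alternating values, for |G|^r. Their product is the number of all tuples, which turns the sum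
-- into a density of tuples times an invertibility probability.
open Classical in
theorem sum_skewHaar_isPresentation (hg : r ≤ g + g) (C : Matrix (Fin r) (Fin r) (ZMod ℓ))
    (hC : C.det ≠ 0) : ∑ x : Fin g ⊕ Fin g → CycProd ℓ lam, skewHaar ℓ g {M | IsPresentation x C M} =
      ENNReal.ofReal ((Nat.card {x : Fin g ⊕ Fin g → CycProd ℓ lam //
        Function.Surjective (tupleHom x) ∧ IsConsistent x C} : ℝ) /
          (Nat.card (CycProd ℓ lam) : ℝ) ^ (g + g) * symInvProb (ZMod ℓ) (g + g - r) *
            (Nat.card (AltValues ℓ lam) / (ℓ : ℝ) ^ (r + 1).choose 2)) := by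
  simp only [skewHaar_isPresentation, hC, ne_eq, not_false_iff, true_and]
  rw [← Finset.sum_filter, Finset.sum_const, nsmul_eq_mul, ← Fintype.card_subtype,
    ← Nat.card_eq_fintype_card]
  have hG : (Nat.card (CycProd ℓ lam) : ℝ) ≠ 0 := by exact_mod_cast Nat.card_pos.ne'
  have hS : (Nat.card (SymMat (Fin (g + g - r)) (ZMod ℓ)) : ℝ) ≠ 0 := by
    exact_mod_cast (card_symMat_pos (ZMod ℓ) (g + g - r)).ne'
  have hA : (Nat.card (AltValues ℓ lam) : ℝ) ≠ 0 := by exact_mod_cast Nat.card_pos.ne'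
  have hl0 : (ℓ : ℝ) ≠ 0 := by exact_mod_cast hl.out.ne_zero
  have hF0 : Nat.card (FormResidues ℓ lam (g + g - r)) ≠ 0 := Nat.card_pos.ne'
  have hF : (Nat.card (FormResidues ℓ lam (g + g - r)) : ℝ) * Nat.card (AltValues ℓ lam) =
      (ℓ : ℝ) ^ (r + 1).choose 2 * (Nat.card (CycProd ℓ lam) : ℝ) ^ (g + g) *
        Nat.card (SymMat (Fin (g + g - r)) (ZMod ℓ)) := by
    have h1 := card_symm_mul_card_alt (ℓ := ℓ) (lam := lam)
    rw [card_formResidues]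
    norm_cast
    rw [mul_right_comm, h1, ← Nat.add_sub_cancel' hg, pow_add, Nat.add_sub_cancel' hg]
    ring
  have h3 : (Nat.card (SymInv (Fin (g + g - r)) (ZMod ℓ)) : ℝ≥0∞) /
      Nat.card (FormResidues ℓ lam (g + g - r)) =
      ENNReal.ofReal ((Nat.card (SymInv (Fin (g + g - r)) (ZMod ℓ)) : ℝ) /
        Nat.card (FormResidues ℓ lam (g + g - r))) := by
    rw [ENNReal.ofReal_div_of_pos (by exact_mod_cast Nat.card_pos), ENNReal.ofReal_natCast,
      ENNReal.ofReal_natCast]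
  rw [h3, ← ENNReal.ofReal_natCast, ← ENNReal.ofReal_mul (by positivity)]
  congr 1
  have hF0' : (Nat.card (FormResidues ℓ lam (g + g - r)) : ℝ) ≠ 0 := by exact_mod_cast hF0
  rw [symInvProb]
  field_simp
  linear_combination -(Nat.card {x : Fin g ⊕ Fin g → CycProd ℓ lam //
    Function.Surjective (tupleHom x) ∧ IsConsistent x C} : ℝ) *
      Nat.card (SymInv (Fin (g + g - r)) (ZMod ℓ)) * hF

/-- The density 1/|AltValues| of consistent generating tuples cancels the number of alternating
values, so the limit depends on r and the invertibility of C but not on the exponents lam. -/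
theorem tendsto_sum_skewHaar_isPresentation (hodd : ℓ ≠ 2) (C : Matrix (Fin r) (Fin r) (ZMod ℓ)) :
    Tendsto (fun g => ∑ x : Fin g ⊕ Fin g → CycProd ℓ lam, skewHaar ℓ g {M | IsPresentation x C M})
      atTop (𝓝 (open Classical in if C.det ≠ 0 then
        ENNReal.ofReal (malleConst (ℓ : ℝ)⁻¹ 0 / (ℓ : ℝ) ^ (r + 1).choose 2) else 0)) := by
  split_ifs with hC
  · have hA : (Nat.card (AltValues ℓ lam) : ℝ) ≠ 0 := by exact_mod_cast Nat.card_pos.ne'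
    have h1 := tendsto_symInvProb (ZMod ℓ)
    rw [Nat.card_zmod] at h1
    have h2 : Tendsto (fun g : ℕ => g + g - r) atTop atTop :=
      (tendsto_sub_atTop_nat r).comp (tendsto_atTop_mono (fun n => Nat.le_add_left n n) tendsto_id)
    have h3 := ((tendsto_card_surjective_isConsistent (lam := lam) hodd C).mul
      (h1.comp h2)).mul_const ((Nat.card (AltValues ℓ lam) : ℝ) / (ℓ : ℝ) ^ (r + 1).choose 2)
    have h4 : 1 / (Nat.card (AltValues ℓ lam) : ℝ) * malleConst (ℓ : ℝ)⁻¹ 0 *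
        ((Nat.card (AltValues ℓ lam) : ℝ) / (ℓ : ℝ) ^ (r + 1).choose 2) =
        malleConst (ℓ : ℝ)⁻¹ 0 / (ℓ : ℝ) ^ (r + 1).choose 2 := by
      field_simp
    rw [h4] at h3
    refine (ENNReal.tendsto_ofReal h3).congr' ?_
    filter_upwards [eventually_ge_atTop r] with g hg
    exact (sum_skewHaar_isPresentation (by omega) C hC).symm
  · refine tendsto_const_nhds.congr fun g => (Finset.sum_eq_zero fun x _ => ?_).symm
    rw [skewHaar_isPresentation, if_neg fun h => hC h.1]

end PresentationLimit

/-! ### BEG structures on G as matrices over ℤ/ℓ -/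

section MatrixOfPsi

variable {ℓ : ℕ} [hl : Fact ℓ.Prime] {g r : ℕ} {lam : Fin r → ℕ}

/-- The character `x ↦ x_j / ℓ` of `G`. -/
noncomputable def coordChar (ℓ : ℕ) {r : ℕ} (lam : Fin r → ℕ) (j : Fin r) :
    Tors (ℓ ^ 1) (PDual (CycProd ℓ lam)) :=
  ⟨(zmodToCircle (ℓ ^ 1)).comp ((ZMod.castHom (pow_dvd_pow ℓ (Nat.le_add_left 1 (lam j)))
    (ZMod (ℓ ^ 1))).toAddMonoidHom.comp (Pi.evalAddMonoidHom _ j)), by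
    rw [mem_tors]
    ext x
    change ℓ ^ 1 • zmodToCircle (ℓ ^ 1) _ = 0
    rw [← map_nsmul, nsmul_eq_mul, ZMod.natCast_self, zero_mul, map_zero]⟩

theorem coordChar_apply (j : Fin r) (x : CycProd ℓ lam) : (coordChar ℓ lam j).1 x =
    zmodToCircle (ℓ ^ 1) (ZMod.castHom (pow_dvd_pow ℓ (Nat.le_add_left 1 (lam j))) _ (x j)) := rfl

theorem exists_eq_sum_coordChar (α : Tors (ℓ ^ 1) (PDual (CycProd ℓ lam))) :
    ∃ n : Fin r → ℕ, α = ∑ j, n j • coordChar ℓ lam j := by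
  have hα : ∀ x, ℓ ^ 1 • α.1 x = 0 := fun x => DFunLike.congr_fun (mem_tors.1 α.2) x
  choose c hc using fun j => exists_zmodToCircle_eq (ell_pow_ne_zero (ℓ := ℓ) 1) _
    (hα (Pi.single j 1))
  refine ⟨fun j => (c j).val, Subtype.ext ?_⟩
  refine cycProd_hom_ext fun i => ?_
  rw [← hc i, AddSubgroup.val_finsetSum, AddMonoidHom.finsetSum_apply, Finset.sum_eq_single i]
  · change _ = (c i).val • (coordChar ℓ lam i).1 (Pi.single i 1)
    rw [coordChar_apply, Pi.single_eq_same, map_one, ← map_nsmul, nsmul_one, ZMod.natCast_zmod_val]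
  · intro j _ hj
    change (c j).val • (coordChar ℓ lam j).1 (Pi.single i 1) = 0
    rw [coordChar_apply, Pi.single_eq_of_ne hj, map_zero, map_zero, nsmul_zero]
  · simp

/-- `C` is the matrix of `ψ : G^∨[ℓ] → G[ℓ]`. -/
def IsPsiMatrix (d : EnhData ℓ 1 (CycProd ℓ lam)) (C : Matrix (Fin r) (Fin r) (ZMod ℓ)) : Prop :=
  ∀ i j, (d.psi (coordChar ℓ lam j) : CycProd ℓ lam) i =
    PadicInt.toZModPow (lam i + 1) ((ℓ : ℤ_[ℓ]) ^ lam i * ((C i j).val : ℤ_[ℓ]))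

theorem IsPsiMatrix.psi_eq {d d' : EnhData ℓ 1 (CycProd ℓ lam)}
    {C : Matrix (Fin r) (Fin r) (ZMod ℓ)} (h : IsPsiMatrix d C) (h' : IsPsiMatrix d' C) :
    d.psi = d'.psi := by
  have h1 : ∀ j, d.psi (coordChar ℓ lam j) = d'.psi (coordChar ℓ lam j) := fun j =>
    Subtype.ext (funext fun i => (h i j).trans (h' i j).symm)
  ext1 α
  obtain ⟨n, rfl⟩ := exists_eq_sum_coordChar α
  rw [map_sum, map_sum]
  exact Finset.sum_congr rfl fun j _ => by rw [map_nsmul, map_nsmul, h1]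

theorem IsPsiMatrix.matrix_eq {d : EnhData ℓ 1 (CycProd ℓ lam)}
    {C C' : Matrix (Fin r) (Fin r) (ZMod ℓ)} (h : IsPsiMatrix d C) (h' : IsPsiMatrix d C') :
    C = C' := by
  ext i j
  have h1 := toZModPow_eq_iff_dvd.1 ((h i j).symm.trans (h' i j))
  rw [← mul_sub, pow_succ, mul_dvd_mul_iff_left (padicInt_pow_ne_zero _), ← toZMod_eq_iff_dvd,
    toZMod_natCast_val, toZMod_natCast_val] at h1
  exact h1

theorem exists_isPsiMatrix (d : EnhData ℓ 1 (CycProd ℓ lam)) : ∃ C, IsPsiMatrix d C := by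
  have h : ∀ i j, ∃ c : ZMod ℓ, (d.psi (coordChar ℓ lam j) : CycProd ℓ lam) i =
      PadicInt.toZModPow (lam i + 1) ((ℓ : ℤ_[ℓ]) ^ lam i * (c.val : ℤ_[ℓ])) := by
    intro i j
    obtain ⟨y, hy⟩ := ZMod.ringHom_surjective (PadicInt.toZModPow (lam i + 1))
      ((d.psi (coordChar ℓ lam j) : CycProd ℓ lam) i)
    have h0 : ℓ ^ 1 • (d.psi (coordChar ℓ lam j) : CycProd ℓ lam) i = 0 :=
      congrFun (mem_tors.1 (d.psi (coordChar ℓ lam j)).2) i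
    rw [← hy, ← map_nsmul, toZModPow_eq_zero, nsmul_eq_mul] at h0
    obtain ⟨z, hz⟩ := h0
    have hyz : y = (ℓ : ℤ_[ℓ]) ^ lam i * z := by
      refine mul_left_cancel₀ (padicInt_pow_ne_zero (ℓ := ℓ) 1) ?_
      push_cast at hz
      rw [hz]
      ring
    refine ⟨PadicInt.toZMod z, ?_⟩
    rw [← hy, toZModPow_eq_iff_dvd, hyz, ← mul_sub, pow_succ,
      mul_dvd_mul_iff_left (padicInt_pow_ne_zero _), ← toZMod_eq_iff_dvd, toZMod_natCast_val]
  choose C hC using h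
  exact ⟨Matrix.of C, hC⟩

/-- The coordinate character j is represented by u = J X_j, where X_j is the j-th row of the lift.
Writing (M + ℓ)u = ℓw, the entry (i, j) of the Gram matrix is ℓ times X_i · w, and X_i · w is
coordinate i of ψ at this character. Hence the modulus exponent lam i + 1 becomes lam i + 2. -/
theorem isPsiMatrix_push_iff {M : SkewSymp ℓ g} (f : LinCoker 1 M →+ CycProd ℓ lam)
    (x : Fin g ⊕ Fin g → CycProd ℓ lam) (hf : cokerComp f = tupleHom x)
    (C : Matrix (Fin r) (Fin r) (ZMod ℓ)) : IsPsiMatrix ((linData 1 M).push f) C ↔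
      ∀ i j, (ℓ : ℤ_[ℓ]) ^ (lam i + 2) ∣
        (tupleLift x * shiftForm M * (tupleLift x).transpose) i j -
          (ℓ : ℤ_[ℓ]) ^ (lam i + 1) * ((C i j).val : ℤ_[ℓ]) := by
  refine forall_congr' fun i => forall_congr' fun j => ?_
  let u := (Matrix.J (Fin g) ℤ_[ℓ]).mulVec (tupleLift x j)
  have hu : ∀ v, sympForm v u = (tupleLift x).mulVec v j := by
    intro v
    rw [sympForm_eq, Matrix.mulVec_mulVec, Matrix.J_squared, Matrix.neg_mulVec, Matrix.one_mulVec,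
      dotProduct_neg, neg_neg, dotProduct_comm]
    rfl
  have hchar : ∀ v, (torsDual (ℓ ^ 1) f (coordChar ℓ lam j)).1 (toCoker 1 M v) =
      zmodToCircle (ℓ ^ 1) (PadicInt.toZModPow 1 (sympForm v u)) := by
    intro v
    change (coordChar ℓ lam j).1 (cokerComp f v) = _
    rw [hf, coordChar_apply, tupleHom_eq_mulVec, ← RingHom.comp_apply,
      PadicInt.zmod_cast_comp_toZModPow _ _ (Nat.le_add_left 1 (lam j)), hu]
  have hw : ∃ w, shiftMap 1 M u = (ℓ : ℤ_[ℓ]) ^ 1 • w := by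
    have h0 : ∀ v, PadicInt.toZModPow (1 + 0) (sympForm (shiftMap 1 M v) u) = 0 := by
      intro v
      refine zmodToCircle_injective (ell_pow_ne_zero 1) ?_
      exact (hchar _).symm.trans (by rw [toCoker_shiftMap, map_zero, map_zero])
    obtain ⟨k, hk⟩ := exists_shiftMap_eq h0
    exact ⟨_, hk⟩
  obtain ⟨w, hw⟩ := hw
  have hpsi : (((linData 1 M).push f).psi (coordChar ℓ lam j) : CycProd ℓ lam) i =
      PadicInt.toZModPow (lam i + 1) ((tupleLift x).mulVec w i) := by
    change f (linPsi 1 M (torsDual (ℓ ^ 1) f (coordChar ℓ lam j))) i = _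
    rw [linPsi_eq _ ⟨hchar, hw⟩, ← cokerComp_apply, hf, tupleHom_eq_mulVec]
  have hform : (tupleLift x * shiftForm M * (tupleLift x).transpose) i j =
      (ℓ : ℤ_[ℓ]) * (tupleLift x).mulVec w i := by
    have h1 : (tupleLift x * shiftForm M * (tupleLift x).transpose) i j =
        (tupleLift x).mulVec ((shiftForm M).mulVec (tupleLift x j)) i := by
      rw [Matrix.mulVec_mulVec]
      rfl
    rw [h1, shiftForm_mulVec, hw, Matrix.mulVec_smul, pow_one]
    rfl
  have h0 : (ℓ : ℤ_[ℓ]) ≠ 0 := by exact_mod_cast hl.out.ne_zero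
  rw [hpsi, toZModPow_eq_iff_dvd, hform, pow_succ' _ (lam i), mul_assoc, ← mul_sub,
    pow_succ' _ (lam i + 1), mul_dvd_mul_iff_left h0, pow_succ' _ (lam i)]

/-- The images of the standard basis under the map from `ℤ_ℓ^{2g}`. -/
noncomputable def cokerTuple {n : ℕ} {M : SkewSymp ℓ g} (f : LinCoker n M →+ CycProd ℓ lam) :
    Fin g ⊕ Fin g → CycProd ℓ lam := fun k => cokerComp f (Pi.single k 1)

theorem cokerComp_eq_tupleHom {n : ℕ} {M : SkewSymp ℓ g} (f : LinCoker n M →+ CycProd ℓ lam) :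
    cokerComp f = tupleHom (cokerTuple f) := eq_tupleHom _

theorem toCoker_surjective (n : ℕ) (M : SkewSymp ℓ g) : Function.Surjective (toCoker n M) :=
  Submodule.mkQ_surjective _

theorem toCoker_eq_zero_iff {n : ℕ} {M : SkewSymp ℓ g} {v : Fin g ⊕ Fin g → ℤ_[ℓ]} :
    toCoker n M v = 0 ↔ v ∈ LinearMap.range (shiftMap n M) :=
  Submodule.Quotient.mk_eq_zero _

theorem isPresentation_cokerTuple {M : SkewSymp ℓ g} (e : LinCoker 1 M ≃+ CycProd ℓ lam)
    {C : Matrix (Fin r) (Fin r) (ZMod ℓ)}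
    (hC : IsPsiMatrix ((linData 1 M).push e.toAddMonoidHom) C) :
    IsPresentation (cokerTuple e.toAddMonoidHom) C M := by
  refine ⟨?_, fun v => ?_, (isPsiMatrix_push_iff _ _ (cokerComp_eq_tupleHom _) C).1 hC⟩
  · rw [← cokerComp_eq_tupleHom]
    exact e.surjective.comp (toCoker_surjective 1 M)
  · rw [← cokerComp_eq_tupleHom, cokerComp_apply, ← toCoker_eq_zero_iff]
    exact EmbeddingLike.map_eq_zero_iff (f := e)

theorem IsPresentation.exists_equiv {x : Fin g ⊕ Fin g → CycProd ℓ lam} {M : SkewSymp ℓ g}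
    {C : Matrix (Fin r) (Fin r) (ZMod ℓ)} (h : IsPresentation x C M) :
    ∃ e : LinCoker 1 M ≃+ CycProd ℓ lam, cokerTuple e.toAddMonoidHom = x ∧
      IsPsiMatrix ((linData 1 M).push e.toAddMonoidHom) C := by
  let f : LinCoker 1 M →+ CycProd ℓ lam := QuotientAddGroup.lift
    (LinearMap.range (shiftMap 1 M)).toAddSubgroup (tupleHom x) fun v hv => (h.2.1 v).2 hv
  have hf : ∀ v, f (toCoker 1 M v) = tupleHom x v := fun v => rfl
  have hbij : Function.Bijective f := by
    constructor
    · rw [injective_iff_map_eq_zero]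
      intro a ha
      obtain ⟨v, rfl⟩ := toCoker_surjective 1 M a
      rw [hf] at ha
      exact toCoker_eq_zero_iff.2 ((h.2.1 v).1 ha)
    · intro y
      obtain ⟨v, hv⟩ := h.1 y
      exact ⟨toCoker 1 M v, hv⟩
  have hcomp : cokerComp (AddEquiv.ofBijective f hbij).toAddMonoidHom = tupleHom x :=
    AddMonoidHom.ext hf
  refine ⟨AddEquiv.ofBijective f hbij, ?_, (isPsiMatrix_push_iff _ x hcomp C).2 h.2.2⟩
  funext k
  rw [cokerTuple, hcomp, tupleHom_single]

theorem cokerTuple_injective {M : SkewSymp ℓ g} {e e' : LinCoker 1 M ≃+ CycProd ℓ lam}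
    (h : cokerTuple e.toAddMonoidHom = cokerTuple e'.toAddMonoidHom) : e = e' := by
  ext1 a
  obtain ⟨v, rfl⟩ := toCoker_surjective 1 M a
  have := DFunLike.congr_fun ((cokerComp_eq_tupleHom e.toAddMonoidHom).trans
    ((congrArg tupleHom h).trans (cokerComp_eq_tupleHom e'.toAddMonoidHom).symm)) v
  exact this

/-- The matrices of the BEGs with underlying group `G` in the class `c`. -/
def matricesOf (lam : Fin r → ℕ) (c : BEGClass ℓ 1) : Set (Matrix (Fin r) (Fin r) (ZMod ℓ)) :=
  {C | ∃ X : BEG ℓ 1, (⟦X⟧ : BEGClass ℓ 1) = c ∧ ∃ e : X.carrier ≃+ CycProd ℓ lam,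
    IsPsiMatrix (X.data.push e.toAddMonoidHom) C}

theorem EnhData.push_symm {n : ℕ} {G H : Type*} [AddCommGroup G] [AddCommGroup H] (e : G ≃+ H)
    {d : EnhData ℓ n G} {d' : EnhData ℓ n H} (h : d.push e.toAddMonoidHom = d') :
    d'.push e.symm.toAddMonoidHom = d := by
  rw [← h, EnhData.push_push]
  have : e.symm.toAddMonoidHom.comp e.toAddMonoidHom = AddMonoidHom.id _ := by
    ext x; simp
  rw [this, EnhData.push_id]

theorem EnhData.push_trans {n : ℕ} {G H K : Type*} [AddCommGroup G] [AddCommGroup H]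
    [AddCommGroup K] (e : G ≃+ H) (f : H ≃+ K) (d : EnhData ℓ n G) :
    d.push (e.trans f).toAddMonoidHom = (d.push e.toAddMonoidHom).push f.toAddMonoidHom := by
  have h : (e.trans f).toAddMonoidHom = f.toAddMonoidHom.comp e.toAddMonoidHom := rfl
  rw [h, EnhData.push_push]

/-- `M` belongs to the event defining the mass of `c`. -/
def InClass (c : BEGClass ℓ 1) (M : SkewSymp ℓ g) : Prop :=
  ∃ X : BEG ℓ 1, (⟦X⟧ : BEGClass ℓ 1) = c ∧
    ∃ e : LinCoker 1 M ≃+ X.carrier, (linData 1 M).push e.toAddMonoidHom = X.data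

theorem InClass.mem_matricesOf {c : BEGClass ℓ 1} {M : SkewSymp ℓ g} (h : InClass c M)
    (e : LinCoker 1 M ≃+ CycProd ℓ lam) {C : Matrix (Fin r) (Fin r) (ZMod ℓ)}
    (hC : IsPsiMatrix ((linData 1 M).push e.toAddMonoidHom) C) : C ∈ matricesOf lam c := by
  obtain ⟨X, hX, e1, he1⟩ := h
  refine ⟨X, hX, e1.symm.trans e, ?_⟩
  rwa [EnhData.push_trans, EnhData.push_symm e1 he1]

theorem inClass_of_mem_matricesOf (hodd : ℓ ≠ 2) {c : BEGClass ℓ 1} {M : SkewSymp ℓ g}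
    (e : LinCoker 1 M ≃+ CycProd ℓ lam) {C : Matrix (Fin r) (Fin r) (ZMod ℓ)}
    (hC : IsPsiMatrix ((linData 1 M).push e.toAddMonoidHom) C) (hc : C ∈ matricesOf lam c) :
    InClass c M := by
  obtain ⟨X, hX, e', he'⟩ := hc
  have h := EnhData.IsBEG.ext_psi hodd (X.isBEG.push e'.toAddMonoidHom)
    (isBEG_push_linData hodd e.toAddMonoidHom) (he'.psi_eq hC)
  exact ⟨X, hX, e.trans e'.symm, by rw [EnhData.push_trans]; exact EnhData.push_symm e' h⟩

/-- C determines ψ, and ψ determines ω, so the same matrix gives isomorphic BEGs; the sets of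
matrices of distinct classes are disjoint. -/
theorem matricesOf_unique (hodd : ℓ ≠ 2) {c c' : BEGClass ℓ 1}
    {C : Matrix (Fin r) (Fin r) (ZMod ℓ)} (hc : C ∈ matricesOf lam c) (hc' : C ∈ matricesOf lam c') :
    c = c' := by
  obtain ⟨X, rfl, e, he⟩ := hc
  obtain ⟨X', rfl, e', he'⟩ := hc'
  have h := EnhData.IsBEG.ext_psi hodd (X.isBEG.push e.toAddMonoidHom)
    (X'.isBEG.push e'.toAddMonoidHom) (he.psi_eq he')
  exact Quotient.sound ⟨e.trans e'.symm, by rw [EnhData.push_trans, h]; exact EnhData.push_symm e' rfl⟩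

/-- The class is that of the linear data transported to G, which form a BEG. -/
theorem exists_mem_matricesOf (hodd : ℓ ≠ 2) {M : SkewSymp ℓ g}
    {x : Fin g ⊕ Fin g → CycProd ℓ lam} {C : Matrix (Fin r) (Fin r) (ZMod ℓ)}
    (h : IsPresentation x C M) : ∃ c, C ∈ matricesOf lam c := by
  obtain ⟨e, -, he⟩ := h.exists_equiv
  let X : BEG ℓ 1 :=
    { carrier := CycProd ℓ lam
      ellGroup := fun y => (cycProd_torsion lam).imp fun k hk => hk y
      data := (linData 1 M).push e.toAddMonoidHom
      isBEG := isBEG_push_linData hodd _ }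
  refine ⟨⟦X⟧, X, rfl, AddEquiv.refl _, ?_⟩
  have : X.data.push (AddEquiv.refl (CycProd ℓ lam)).toAddMonoidHom = X.data := X.data.push_id
  rwa [this]

theorem matricesOf_carrier {c : BEGClass ℓ 1} {C : Matrix (Fin r) (Fin r) (ZMod ℓ)}
    (hc : C ∈ matricesOf lam c) :
    ∃ X : BEG ℓ 1, ⟦X⟧ = c ∧ Nonempty (X.carrier ≃+ CycProd ℓ lam) := by
  obtain ⟨X, hX, e, _⟩ := hc
  exact ⟨X, hX, ⟨e⟩⟩

/-- Each isomorphism from the cokernel to G yields one presentation, its matrix being determined.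
Membership of M in the class guarantees that such isomorphisms exist, and then there are |Aut G| of
them. -/
theorem card_isPresentation {c : BEGClass ℓ 1}
    (hc : ∃ X : BEG ℓ 1, ⟦X⟧ = c ∧ Nonempty (X.carrier ≃+ CycProd ℓ lam)) {M : SkewSymp ℓ g}
    (hM : InClass c M) :
    Nat.card {j : (Fin g ⊕ Fin g → CycProd ℓ lam) × matricesOf lam c //
      IsPresentation j.1 j.2.1 M} = Nat.card (CycProd ℓ lam ≃+ CycProd ℓ lam) := by
  obtain ⟨X, hX, ⟨f⟩⟩ := hc
  have hM' := hM
  obtain ⟨Y, hY, e1, -⟩ := hM'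
  obtain ⟨e2, -⟩ := Quotient.exact (hY.trans hX.symm)
  let e0 : LinCoker 1 M ≃+ CycProd ℓ lam := e1.trans (e2.trans f)
  have hcard : Nat.card (CycProd ℓ lam ≃+ CycProd ℓ lam) =
      Nat.card (LinCoker 1 M ≃+ CycProd ℓ lam) :=
    Nat.card_congr
      { toFun := fun f => e0.trans f
        invFun := fun f => e0.symm.trans f
        left_inv := fun f => by ext; simp
        right_inv := fun f => by ext; simp }
  rw [hcard]
  choose C hC using fun e : LinCoker 1 M ≃+ CycProd ℓ lam =>
    exists_isPsiMatrix ((linData 1 M).push e.toAddMonoidHom)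
  symm
  refine Nat.card_congr (Equiv.ofBijective (fun e => ⟨(cokerTuple e.toAddMonoidHom,
    ⟨C e, hM.mem_matricesOf e (hC e)⟩), isPresentation_cokerTuple e (hC e)⟩) ⟨fun e e' h => ?_, ?_⟩)
  · exact cokerTuple_injective (congrArg (fun j => j.1.1) h)
  · rintro ⟨⟨x, D, hD⟩, hj⟩
    obtain ⟨e, rfl, he⟩ := hj.exists_equiv
    refine ⟨e, Subtype.ext (Prod.ext rfl (Subtype.ext ((hC e).matrix_eq he)))⟩

end MatrixOfPsi

/-! ### The universal measure and the iteration of Q -/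

section UniversalGroupMass

open Filter Topology

variable {ℓ : ℕ} [hl : Fact ℓ.Prime] {r : ℕ} {lam : Fin r → ℕ}

open Classical in
/-- The limiting expected number of presentations with matrix `C`. -/
noncomputable def presentationLimit (C : Matrix (Fin r) (Fin r) (ZMod ℓ)) : ℝ≥0∞ :=
  if C.det ≠ 0 then ENNReal.ofReal (malleConst (ℓ : ℝ)⁻¹ 0 / (ℓ : ℝ) ^ (r + 1).choose 2) else 0

instance finite_cycProd_aut : Finite (CycProd ℓ lam ≃+ CycProd ℓ lam) :=
  Finite.of_injective (fun e => (e : CycProd ℓ lam → CycProd ℓ lam)) DFunLike.coe_injective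

-- Double counting of pairs of M and a presentation gives |Aut G| times the mass as a sum over the
-- matrices of the class. These are finitely many, so the limit passes inside the sum.
open Classical in
theorem tendsto_linearMeasure (hodd : ℓ ≠ 2) {c : BEGClass ℓ 1}
    (hc : ∃ X : BEG ℓ 1, ⟦X⟧ = c ∧ Nonempty (X.carrier ≃+ CycProd ℓ lam)) :
    Tendsto (fun g => linearMeasure ℓ 1 g c) atTop (𝓝 ((∑ C : matricesOf lam c,
      presentationLimit C.1) / Nat.card (CycProd ℓ lam ≃+ CycProd ℓ lam))) := by
  have hN : Nat.card (CycProd ℓ lam ≃+ CycProd ℓ lam) ≠ 0 := Nat.card_pos.ne'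
  have h1 : Tendsto (fun g => ∑ C : matricesOf lam c, ∑ x : Fin g ⊕ Fin g → CycProd ℓ lam,
      skewHaar ℓ g {M | IsPresentation x C.1 M}) atTop
      (𝓝 (∑ C : matricesOf lam c, presentationLimit C.1)) :=
    tendsto_finsetSum _ fun C _ => tendsto_sum_skewHaar_isPresentation hodd C.1
  have h2 := ENNReal.Tendsto.div_const h1
    (b := (Nat.card (CycProd ℓ lam ≃+ CycProd ℓ lam) : ℝ≥0∞)) (Or.inr (by exact_mod_cast hN))
  refine h2.congr fun g => ?_
  have h3 := card_mul_skewHaar_eq_sum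
    (fun j : (Fin g ⊕ Fin g → CycProd ℓ lam) × matricesOf lam c => j.1) (fun j => j.2.1)
    {M | InClass c M} _ hN (fun M hM => card_isPresentation hc hM) fun j M hj => by
      obtain ⟨e, -, he⟩ := hj.exists_equiv
      exact inClass_of_mem_matricesOf hodd e he j.2.2
  rw [Fintype.sum_prod_type_right] at h3
  rw [← h3, mul_comm, ENNReal.mul_div_cancel_right (by exact_mod_cast hN) (ENNReal.natCast_ne_top _)]
  rfl

open Classical in
theorem universalMeasure_eq (hodd : ℓ ≠ 2) {c : BEGClass ℓ 1}
    (hc : ∃ X : BEG ℓ 1, ⟦X⟧ = c ∧ Nonempty (X.carrier ≃+ CycProd ℓ lam)) :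
    universalMeasure ℓ 1 c = (∑ C : matricesOf lam c, presentationLimit C.1) /
      Nat.card (CycProd ℓ lam ≃+ CycProd ℓ lam) :=
  (tendsto_linearMeasure hodd hc).limUnder_eq

/-- Without convergence, `limUnder` would carry no information; the explicit limit for a cyclic
product isomorphic to the underlying group supplies it. -/
theorem tendsto_universalMeasure (hodd : ℓ ≠ 2) (c : BEGClass ℓ 1) :
    Tendsto (fun g => linearMeasure ℓ 1 g c) atTop (𝓝 (universalMeasure ℓ 1 c)) := by
  obtain ⟨X, rfl⟩ := Quotient.exists_rep c
  obtain ⟨r, lam, ⟨e⟩⟩ := exists_equiv_cycProd ℓ X.carrier X.ellGroup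
  have h := tendsto_linearMeasure hodd ⟨X, rfl, ⟨e⟩⟩
  rwa [← universalMeasure_eq hodd ⟨X, rfl, ⟨e⟩⟩] at h

theorem exists_mem_matricesOf_of_presentationLimit_ne_zero (hodd : ℓ ≠ 2) (lam : Fin r → ℕ)
    {C : Matrix (Fin r) (Fin r) (ZMod ℓ)} (hC : presentationLimit C ≠ 0) :
    ∃ c, C ∈ matricesOf lam c := by
  by_contra hne
  refine hC (tendsto_nhds_unique (tendsto_sum_skewHaar_isPresentation (lam := lam) hodd C) ?_)
  refine tendsto_const_nhds.congr fun g => (Finset.sum_eq_zero fun x _ => ?_).symm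
  have : {M : SkewSymp ℓ g | IsPresentation x C M} = ∅ :=
    Set.eq_empty_of_forall_notMem fun M hM => hne (exists_mem_matricesOf hodd hM)
  rw [this, skewHaar_empty]

/-- Every C with nonzero limit belongs to exactly one class, so summing over classes sums over all
matrices once. -/
theorem groupMass_universalMeasure_eq_sum (hodd : ℓ ≠ 2) (lam : Fin r → ℕ) :
    groupMass (universalMeasure ℓ 1) (CycProd ℓ lam) =
      (∑ C : Matrix (Fin r) (Fin r) (ZMod ℓ), presentationLimit C) /
        Nat.card (CycProd ℓ lam ≃+ CycProd ℓ lam) := by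
  classical
  have h1 : ∀ c : {c : BEGClass ℓ 1 // ∃ X : BEG ℓ 1, ⟦X⟧ = c ∧
      Nonempty (X.carrier ≃+ CycProd ℓ lam)}, universalMeasure ℓ 1 c.1 =
      (∑ C : Matrix (Fin r) (Fin r) (ZMod ℓ), if C ∈ matricesOf lam c.1 then
        presentationLimit C else 0) / Nat.card (CycProd ℓ lam ≃+ CycProd ℓ lam) := by
    intro c
    rw [universalMeasure_eq hodd c.2, ← Finset.sum_filter]
    congr 1
    exact (Finset.sum_subtype _ (by simp) _).symm
  rw [groupMass, tsum_congr h1]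
  simp only [div_eq_mul_inv]
  rw [ENNReal.tsum_mul_right]
  congr 1
  -- The finite sum over C is written as a `tsum` so that it can be interchanged with the sum over
  -- classes.
  simp only [← tsum_fintype (L := SummationFilter.unconditional _)]
  rw [ENNReal.tsum_comm]
  refine tsum_congr fun C => ?_
  by_cases hC : presentationLimit C = 0
  · simp [hC]
  · obtain ⟨c, hc⟩ := exists_mem_matricesOf_of_presentationLimit_ne_zero hodd lam hC
    rw [tsum_eq_single ⟨c, matricesOf_carrier hc⟩, if_pos hc]
    intro c' hc'
    rw [if_neg]
    exact fun h => hc' (Subtype.ext (matricesOf_unique hodd h hc))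

theorem qPoch_eq_prod_range (q : ℝ) (j : ℕ) : qPoch q j = ∏ i ∈ Finset.range j, (1 - q ^ (i + 1)) := by
  rw [qPoch, Finset.range_eq_Ico, Finset.prod_Ico_add' (fun i => 1 - q ^ i) 0 j 1]
  rfl

theorem card_det_ne_zero (ℓ : ℕ) [Fact ℓ.Prime] (r : ℕ) :
    (Nat.card {C : Matrix (Fin r) (Fin r) (ZMod ℓ) // C.det ≠ 0} : ℝ) =
      (ℓ : ℝ) ^ (r * r) * qPoch (ℓ : ℝ)⁻¹ r := by
  have h1 : Nat.card {C : Matrix (Fin r) (Fin r) (ZMod ℓ) // C.det ≠ 0} =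
      Nat.card (GL (Fin r) (ZMod ℓ)) :=
    Nat.card_congr
      { toFun := fun C => Matrix.GeneralLinearGroup.mkOfDetNeZero C.1 C.2
        invFun := fun A => ⟨A.1, ((Matrix.isUnit_iff_isUnit_det _).1 A.isUnit).ne_zero⟩
        left_inv := fun C => rfl
        right_inv := fun A => Units.ext rfl }
  have hl1 : 1 ≤ ℓ := (Fact.out : ℓ.Prime).one_le
  have hl0 : (ℓ : ℝ) ≠ 0 := by exact_mod_cast (Fact.out : ℓ.Prime).ne_zero
  rw [h1, Matrix.card_GL_field, ZMod.card, Nat.cast_prod, pow_mul, qPoch_eq_prod_range,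
    Fin.prod_univ_eq_prod_range (fun i => ((ℓ ^ r - ℓ ^ i : ℕ) : ℝ)) r,
    ← Finset.prod_range_reflect (fun i => 1 - (ℓ : ℝ)⁻¹ ^ (i + 1))]
  have hpow : ((ℓ : ℝ) ^ r) ^ r = ∏ _i ∈ Finset.range r, (ℓ : ℝ) ^ r := by
    rw [Finset.prod_const, Finset.card_range]
  rw [hpow, ← Finset.prod_mul_distrib]
  refine Finset.prod_congr rfl fun i hi => ?_
  have hi' := Finset.mem_range.1 hi
  rw [Nat.cast_sub (Nat.pow_le_pow_right hl1 hi'.le), Nat.cast_pow, Nat.cast_pow,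
    (by omega : r - 1 - i + 1 = r - i), mul_sub, mul_one, inv_pow]
  congr 1
  rw [eq_mul_inv_iff_mul_eq₀ (pow_ne_zero _ hl0), ← pow_add]
  congr 1
  omega

/-- The limit is the same for every invertible C, so the sum is their number times this constant. -/
theorem groupMass_universalMeasure (hodd : ℓ ≠ 2) (lam : Fin r → ℕ) :
    groupMass (universalMeasure ℓ 1) (CycProd ℓ lam) = ENNReal.ofReal (malleMass ℓ 0 r
      (Nat.card (CycProd ℓ lam ≃+ CycProd ℓ lam)) (Nat.card (CycProd ℓ lam))) := by
  classical
  have hl0 : (ℓ : ℝ) ≠ 0 := by exact_mod_cast hl.out.ne_zero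
  have hA : (0 : ℝ) < Nat.card (CycProd ℓ lam ≃+ CycProd ℓ lam) := by exact_mod_cast Nat.card_pos
  rw [groupMass_universalMeasure_eq_sum hodd]
  simp only [presentationLimit]
  rw [← Finset.sum_filter, Finset.sum_const, nsmul_eq_mul, ← Fintype.card_subtype,
    ← Nat.card_eq_fintype_card, ← ENNReal.ofReal_natCast, ← ENNReal.ofReal_natCast,
    ← ENNReal.ofReal_mul (by positivity), ← ENNReal.ofReal_div_of_pos hA, card_det_ne_zero]
  congr 1
  -- This is why ℓ^(r²) from the order of GL_r, divided by ℓ^(binom(r+1,2)), leaves ℓ^(binom(r,2)).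
  have h2 : r * r = r.choose 2 + (r + 1).choose 2 := by
    have h3 := succ_choose_two_mul_two r
    have h4 : (r + 1).choose 2 = r.choose 1 + r.choose 2 := Nat.choose_succ_succ r 1
    rw [Nat.choose_one_right] at h4
    omega
  have h5 : qPoch (ℓ : ℝ)⁻¹ 0 = 1 := by simp [qPoch]
  rw [malleMass, h5, h2, pow_add, add_zero, pow_zero]
  field_simp

theorem groupMass_eq_of_cycProd {n : ℕ} (ν : BEGClass ℓ n → ℝ≥0∞) (t : ℕ)
    (h : ∀ (r : ℕ) (lam : Fin r → ℕ), groupMass ν (CycProd ℓ lam) = ENNReal.ofReal (malleMass ℓ t r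
      (Nat.card (CycProd ℓ lam ≃+ CycProd ℓ lam)) (Nat.card (CycProd ℓ lam))))
    (G : Type*) [AddCommGroup G] [Finite G] (hG : ∀ x : G, ∃ k : ℕ, ℓ ^ k • x = 0) :
    groupMass ν G = ENNReal.ofReal (malleMass ℓ t (ellRank ℓ G) (Nat.card (G ≃+ G)) (Nat.card G)) := by
  obtain ⟨r, lam, ⟨e⟩⟩ := exists_equiv_cycProd ℓ G hG
  have hA : Nat.card (G ≃+ G) = Nat.card (CycProd ℓ lam ≃+ CycProd ℓ lam) :=
    Nat.card_congr
      { toFun := fun f => (e.symm.trans f).trans e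
        invFun := fun f => (e.trans f).trans e.symm
        left_inv := fun f => by ext; simp
        right_inv := fun f => by ext; simp }
  rw [groupMass_congr ν e, h, hA, ellRank_congr ℓ e, ellRank_cycProd, Nat.card_congr e.toEquiv]

theorem groupMass_iterate_quotMeasure (hodd : ℓ ≠ 2) (t : ℕ) :
    ∀ (r : ℕ) (lam : Fin r → ℕ),
      groupMass (quotMeasure^[t] (universalMeasure ℓ 1)) (CycProd ℓ lam) =
        ENNReal.ofReal (malleMass ℓ t r (Nat.card (CycProd ℓ lam ≃+ CycProd ℓ lam))
          (Nat.card (CycProd ℓ lam))) := by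
  induction t with
  | zero => exact fun r lam => groupMass_universalMeasure hodd lam
  | succ t ih =>
    intro r lam
    rw [Function.iterate_succ_apply']
    exact groupMass_quotMeasure_of_malle _ t
      (fun G _ _ hG => groupMass_eq_of_cycProd _ t ih G hG) lam

end UniversalGroupMass

open Filter Topology in
theorem mainTheorem8 (ℓ : ℕ) [Fact ℓ.Prime] (hodd : ℓ ≠ 2) (t : ℕ) (G : Type*)
    [AddCommGroup G] [Finite G] (hG : ∀ x : G, ∃ k : ℕ, ℓ ^ k • x = 0) :
    (∀ c : BEGClass ℓ 1,
      Tendsto (fun g => linearMeasure ℓ 1 g c) atTop (𝓝 (universalMeasure ℓ 1 c))) ∧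
    groupMass (quotMeasure^[t] (universalMeasure ℓ 1)) G =
      ENNReal.ofReal
        ((∏' i : ℕ, (1 + (ℓ : ℝ)⁻¹ ^ (t + 1 + i))⁻¹) *
          ((ℓ : ℝ) ^ (ellRank ℓ G).choose 2 * qPoch (ℓ : ℝ)⁻¹ (ellRank ℓ G + t)) /
            (qPoch (ℓ : ℝ)⁻¹ t * Nat.card (G ≃+ G) * (Nat.card G : ℝ) ^ t)) :=
  ⟨tendsto_universalMeasure hodd,
    groupMass_eq_of_cycProd _ t (groupMass_iterate_quotMeasure hodd t) G hG⟩
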